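/- For $n\ge 2$ let $p=p_n\ge 1$ be an integer and $\sigma=\sigma_n>0$, $\Delta_n>0$ real numbers. One observes $Y=(Y_1,\dots,Y_n)\in\mathbf R^{p\times n}$ with $$Y_i=\eta_i\boldsymbol\theta+\sigma\xi_i,\qquad i=1,\dots,n,$$ where $\xi_1,\dots,\xi_n$ are independent standard Gaussian vectors of $\mathbf R^p$ and $(\boldsymbol\theta,\eta)$ is an unknown element of $$\Omega_{\Delta_n}=\{\boldsymbol\theta\in\mathbf R^p:\|\boldsymbol\theta\|\ge\Delta_n\}\times\{-1,1\}^n ;$$ $\mathbf E_{(\boldsymbol\theta,\eta)}$ is the corresponding expectation. An estimator is a measurable function $\hat\eta=\hat\eta(Y)$ with values in $\{-1,1\}^n$, and its loss is $$r(\hat\eta,\eta)=\min_{\nu\in\{-1,1\}}\sum_{j=1}^n|\hat\eta_j-\nu\eta_j|.$$ A sequence of estimators $\hat\eta$ achieves exact recovery if $$\lim_{n\to\infty}\ \sup_{(\boldsymbol\theta,\eta)\in\Omega_{\Delta_n}}\mathbf E_{(\boldsymbol\theta,\eta)}\,r(\hat\eta,\eta)=0 ,$$ and exact recovery is impossible if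 $$\liminf_{n\to\infty}\ \inf_{\tilde\eta}\ \sup_{(\boldsymbol\theta,\eta)\in\Omega_{\Delta_n}}\mathbf E_{(\boldsymbol\theta,\eta)}\,r(\tilde\eta,\eta)>0 ,$$ the infimum being over all estimators. For a square matrix $M$ let $\mathbf H(M)=M-\mathrm{diag}(M)$, and let $\mathrm{sign}$ act entrywise with values in $\{-1,1\}$, $\mathrm{sign}(0)=1$. Let $\eta^0=\mathrm{sign}(\hat v)$, where $\hat v$ is an eigenvector of $\mathbf H(Y^\top Y)$ for its largest eigenvalue, chosen in any way for which $\eta^0$ is measurable in $Y$, and let $$\eta^{k+1}=\mathrm{sign}\big(\mathbf H(Y^\top Y)\,\eta^k\big),\qquad k\ge 0 .$$ Define $\bar\Delta_n>0$ by $$\bar\Delta_n^2=\sigma^2\left(1+\sqrt{1+\frac{2p}{n\log n}}\right)\log n .$$ Let $\varepsilon>0$ be fixed. (i) If $\Delta_n\ge(1+\varepsilon)\bar\Delta_n$ for all $n\ge2$, then the estimator $\eta^k$ with $k=\lfloor 3\log n\rfloor$ achieves exact recovery. (ii) If $\Delta_n\le(1-\varepsilon)\bar\Delta_n$ for all $n\ge2$,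 then exact recovery is impossible. -/

import Mathlib

open MeasureTheory ProbabilityTheory Filter Topology
open scoped Matrix

noncomputable section

namespace TwoGaussianMixture

/-- A sample `(Y_1, …, Y_n)` of `n` vectors of the Euclidean space `ℝ^p`. -/
abbrev Sample (n p : ℕ) : Type := Fin n → EuclideanSpace ℝ (Fin p)

/-- The label vectors `{-1, 1}^n`, as a subset of `ℝ^n`. -/
def labels (n : ℕ) : Set (Fin n → ℝ) := {η | ∀ i, η i = 1 ∨ η i = -1}

/-- The law `P_(θ,η)` of the sample `Y_i = η_i θ + σ ξ_i`, with `ξ_1, …, ξ_n` independent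
standard Gaussian vectors of `ℝ^p`. -/
def law {n p : ℕ} (σ : ℝ) (θ : EuclideanSpace ℝ (Fin p)) (η : Fin n → ℝ) :
    Measure (Sample n p) :=
  (Measure.pi fun _ : Fin n => stdGaussian (EuclideanSpace ℝ (Fin p))).map
    fun ξ i => η i • θ + σ • ξ i

/-- The Hamming-type distance `∑ |η_j - η'_j|`. -/
def hamming {n : ℕ} (η η' : Fin n → ℝ) : ℝ := ∑ j, |η j - η' j|

/-- The loss `r(η, η') = min over ν ∈ {-1, 1} of |η - ν η'|`. -/
def loss {n : ℕ} (η η' : Fin n → ℝ) : ℝ := min (hamming η η') (hamming η (-η'))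

/-- An estimator of the labels: a measurable function of the sample with values in `{-1, 1}^n`. -/
def IsEstimator {n p : ℕ} (f : Sample n p → Fin n → ℝ) : Prop :=
  Measurable f ∧ ∀ Y, f Y ∈ labels n

/-- The expected loss `E_(θ,η) r(f(Y), η)`, as an extended nonnegative number. -/
def risk {n p : ℕ} (σ : ℝ) (f : Sample n p → Fin n → ℝ) (θ : EuclideanSpace ℝ (Fin p))
    (η : Fin n → ℝ) : ENNReal :=
  ∫⁻ Y, ENNReal.ofReal (loss (f Y) η) ∂(law σ θ η)

/-- The maximal expected loss of `f` over `Ω_Δ = {θ : ‖θ‖ ≥ Δ} × {-1, 1}^n`. -/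
def maxRisk {n p : ℕ} (σ Δ : ℝ) (f : Sample n p → Fin n → ℝ) : ENNReal :=
  ⨆ (θ : EuclideanSpace ℝ (Fin p)) (_ : Δ ≤ ‖θ‖) (η : Fin n → ℝ) (_ : η ∈ labels n),
    risk σ f θ η

/-- The minimax expected loss: the infimum of the maximal expected loss over all estimators. -/
def minimaxRisk (n p : ℕ) (σ Δ : ℝ) : ENNReal :=
  ⨅ (f : Sample n p → Fin n → ℝ) (_ : IsEstimator f), maxRisk σ Δ f

/-- The sequence `(f n)`, `n ≥ 2`, is a sequence of estimators that achieves exact recovery. -/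
def AchievesExactRecovery (p : ℕ → ℕ) (σ Δ : ℕ → ℝ)
    (f : ∀ n, Sample n (p n) → Fin n → ℝ) : Prop :=
  (∀ n, 2 ≤ n → IsEstimator (f n)) ∧
    Tendsto (fun n => maxRisk (σ n) (Δ n) (f n)) atTop (𝓝 0)

/-- Exact recovery is impossible: the lower limit of the minimax expected loss is positive. -/
def ExactRecoveryImpossible (p : ℕ → ℕ) (σ Δ : ℕ → ℝ) : Prop :=
  0 < liminf (fun n => minimaxRisk n (p n) (σ n) (Δ n)) atTop

/-- The data matrix `Y ∈ ℝ^(p × n)`, whose columns are `Y_1, …, Y_n`. -/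
def dataMatrix {n p : ℕ} (Y : Sample n p) : Matrix (Fin p) (Fin n) ℝ :=
  Matrix.of fun j i => Y i j

/-- The operator `H(M) = M - diag(M)`. -/
def hollow {n : ℕ} (M : Matrix (Fin n) (Fin n) ℝ) : Matrix (Fin n) (Fin n) ℝ :=
  M - Matrix.diagonal M.diag

/-- The hollowed Gram matrix `H(Yᵀ Y)`. -/
def hollowGram {n p : ℕ} (Y : Sample n p) : Matrix (Fin n) (Fin n) ℝ :=
  hollow ((dataMatrix Y)ᵀ * dataMatrix Y)

/-- The entrywise sign, with values in `{-1, 1}^n` (the sign of `0` is `1`). -/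
def signVec {n : ℕ} (x : Fin n → ℝ) : Fin n → ℝ := fun i => if 0 ≤ x i then 1 else -1

/-- `v` is an eigenvector of `M` for its largest eigenvalue. -/
def IsTopEigenvector {n : ℕ} (M : Matrix (Fin n) (Fin n) ℝ) (v : Fin n → ℝ) : Prop :=
  ∃ μ : ℝ, Module.End.HasEigenvector (Matrix.toLin' M) μ v ∧
    ∀ ν : ℝ, Module.End.HasEigenvalue (Matrix.toLin' M) ν → ν ≤ μ

/-- `η⁰` is a spectral estimator: a measurable function of the sample that is the sign of an
eigenvector of `H(Yᵀ Y)` for the largest eigenvalue.  (The eigenvector is determined only up to a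
scalar factor, and not even so where the largest eigenvalue is multiple: every measurable choice
is allowed.) -/
def IsSpectralEstimator {n p : ℕ} (η₀ : Sample n p → Fin n → ℝ) : Prop :=
  Measurable η₀ ∧ ∀ Y, ∃ v, IsTopEigenvector (hollowGram Y) v ∧ η₀ Y = signVec v

/-- The iterates `η^(k+1) = sign(H(Yᵀ Y) η^k)` started at `η⁰`. -/
def lloyd {n p : ℕ} (η₀ : Sample n p → Fin n → ℝ) : ℕ → Sample n p → Fin n → ℝ
  | 0 => η₀
  | k + 1 => fun Y => signVec (hollowGram Y *ᵥ lloyd η₀ k Y)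

/-- The threshold `Δ̄_n`, the square root of `σ² (1 + √(1 + 2p / (n log n))) log n`. -/
def threshold (n p : ℕ) (σ : ℝ) : ℝ :=
  √(σ ^ 2 * (1 + √(1 + 2 * p / (n * Real.log n))) * Real.log n)


theorem continuous_hollowGram {n p : ℕ} :
    Continuous (hollowGram : Sample n p → Matrix (Fin n) (Fin n) ℝ) := by
  unfold hollowGram hollow dataMatrix
  have h : Continuous fun Y : Sample n p => (Matrix.of fun j i => Y i j : Matrix (Fin p) (Fin n) ℝ) := by
    refine continuous_matrix fun i j => ?_
    simp only [Matrix.of_apply]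
    fun_prop
  have h2 := h.matrix_transpose.matrix_mul h
  exact h2.sub h2.matrix_diag.matrix_diagonal

theorem hollowGram_isSymm {n p : ℕ} (Y : Sample n p) : (hollowGram Y).IsSymm := by
  unfold hollowGram hollow
  refine Matrix.IsSymm.sub ?_ (Matrix.isSymm_diagonal _)
  simp [Matrix.IsSymm, Matrix.transpose_mul]

theorem dot_pos {n : ℕ} {w : Fin n → ℝ} (hw : w ≠ 0) : 0 < w ⬝ᵥ w := by
  refine lt_of_le_of_ne (Finset.sum_nonneg fun i _ => mul_self_nonneg _) fun h => hw ?_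
  exact dotProduct_self_eq_zero.1 h.symm

/-- A maximizer of the quadratic form on the unit sphere is a top eigenvector. -/
theorem isTopEigenvector_of_max {n : ℕ} (M : Matrix (Fin n) (Fin n) ℝ) (hM : M.IsSymm)
    (v : Fin n → ℝ) (hv : v ⬝ᵥ v = 1)
    (h : ∀ w : Fin n → ℝ, w ⬝ᵥ w = 1 → w ⬝ᵥ (M *ᵥ w) ≤ v ⬝ᵥ (M *ᵥ v)) :
    IsTopEigenvector M v := by
  set μ := v ⬝ᵥ (M *ᵥ v) with hμ
  have h2 : ∀ w : Fin n → ℝ, w ⬝ᵥ (M *ᵥ w) ≤ μ * (w ⬝ᵥ w) := by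
    intro w
    rcases eq_or_ne w 0 with rfl | hw
    · simp
    have hp : 0 < w ⬝ᵥ w := dot_pos hw
    have h3 := h ((√(w ⬝ᵥ w))⁻¹ • w) (by
      simp only [smul_dotProduct, dotProduct_smul, smul_eq_mul]
      rw [← mul_assoc, ← mul_inv, Real.mul_self_sqrt hp.le, inv_mul_cancel₀ hp.ne'])
    simp only [smul_dotProduct, dotProduct_smul, smul_eq_mul, Matrix.mulVec_smul] at h3
    rw [← mul_assoc, ← mul_inv, Real.mul_self_sqrt hp.le] at h3
    rwa [inv_mul_le_iff₀ hp, mul_comm] at h3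
  have hv0 : v ≠ 0 := by rintro rfl; simp at hv
  have hsymm : ∀ a b : Fin n → ℝ, a ⬝ᵥ (M *ᵥ b) = b ⬝ᵥ (M *ᵥ a) := by
    intro a b
    rw [Matrix.dotProduct_mulVec, ← Matrix.mulVec_transpose, hM.eq, dotProduct_comm]
  have hev : M *ᵥ v = μ • v := by
    set u := M *ᵥ v - μ • v with hu
    by_contra hne
    have hu0 : u ≠ 0 := sub_ne_zero.2 hne
    have hp : 0 < u ⬝ᵥ u := dot_pos hu0
    have key : ∀ t : ℝ, 2 * t * (u ⬝ᵥ u) + t ^ 2 * (u ⬝ᵥ (M *ᵥ u) - μ * (u ⬝ᵥ u)) ≤ 0 := by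
      intro t
      have h4 := h2 (v + t • u)
      have e1 : u ⬝ᵥ u = u ⬝ᵥ (M *ᵥ v) - μ * (u ⬝ᵥ v) := by
        conv_lhs => rhs; rw [hu]
        simp [dotProduct_sub, dotProduct_smul]
      simp only [Matrix.mulVec_add, Matrix.mulVec_smul, add_dotProduct, dotProduct_add,
        smul_dotProduct, dotProduct_smul, smul_eq_mul, hsymm v u, dotProduct_comm v u, hv] at h4
      rw [← hμ] at h4
      linear_combination h4 + 2 * t * e1
    set c := u ⬝ᵥ (M *ᵥ u) - μ * (u ⬝ᵥ u)
    set s := u ⬝ᵥ u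
    have h5 := key (s / (|c| + 1))
    have hc := neg_abs_le c
    have hd : 0 < |c| + 1 := by positivity
    have h6 : 0 < 2 * (s / (|c| + 1)) * s + (s / (|c| + 1)) ^ 2 * c := by
      have : 2 * (s / (|c| + 1)) * s + (s / (|c| + 1)) ^ 2 * c
          = s ^ 2 * (2 * (|c| + 1) + c) / (|c| + 1) ^ 2 := by field_simp
      rw [this]
      have : 0 < 2 * (|c| + 1) + c := by linarith
      positivity
    linarith
  refine ⟨μ, ⟨Module.End.mem_eigenspace_iff.2 (by simpa using hev), hv0⟩, ?_⟩
  intro ν hν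
  obtain ⟨w, hw⟩ := hν.exists_hasEigenvector
  have h7 : M *ᵥ w = ν • w := by simpa using hw.apply_eq_smul
  have hp : 0 < w ⬝ᵥ w := dot_pos hw.2
  have h8 := h2 w
  rw [h7, dotProduct_smul, smul_eq_mul] at h8
  exact le_of_mul_le_mul_right h8 hp

theorem isCompact_dotSphere (n : ℕ) : IsCompact {v : Fin n → ℝ | v ⬝ᵥ v = 1} := by
  refine Metric.isCompact_of_isClosed_isBounded
    (isClosed_eq (by fun_prop) continuous_const) ?_
  refine (Metric.isBounded_closedBall (x := (0 : Fin n → ℝ)) (r := 1)).subset ?_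
  intro v hv
  rw [mem_closedBall_zero_iff, pi_norm_le_iff_of_nonneg zero_le_one]
  intro i
  have : v i * v i ≤ v ⬝ᵥ v :=
    Finset.single_le_sum (f := fun i => v i * v i) (fun i _ => mul_self_nonneg _) (Finset.mem_univ i)
  rw [hv] at this
  rw [Real.norm_eq_abs, abs_le_one_iff_mul_self_le_one]
  exact this

/-- Spectral estimators exist: a top eigenvector can be chosen so that its sign is measurable. -/
theorem exists_isSpectralEstimator (n p : ℕ) (hn : 1 ≤ n) :
    ∃ η₀ : Sample n p → Fin n → ℝ, IsSpectralEstimator η₀ := by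
  classical
  let K : Set (Fin n → ℝ) := {v | v ⬝ᵥ v = 1}
  have hK : IsCompact K := isCompact_dotSphere n
  have hKne : K.Nonempty := ⟨Pi.single ⟨0, hn⟩ 1, by simp [K]⟩
  let val : (Fin n → Bool) → Fin n → ℝ := fun s i => if s i then 1 else -1
  let C : (Fin n → Bool) → ℕ → Set (Sample n p × (Fin n → ℝ)) := fun s m =>
    {q | (∀ w ∈ K, w ⬝ᵥ (hollowGram q.1 *ᵥ w) ≤ q.2 ⬝ᵥ (hollowGram q.1 *ᵥ q.2)) ∧
      ∀ i, if s i then 0 ≤ q.2 i else q.2 i ≤ -(1 / ((m : ℝ) + 1))}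
  have hG := continuous_hollowGram (n := n) (p := p)
  have hC : ∀ s m, IsClosed (C s m) := by
    intro s m
    have hq : Continuous fun q : Sample n p × (Fin n → ℝ) => q.2 ⬝ᵥ (hollowGram q.1 *ᵥ q.2) :=
      Continuous.dotProduct continuous_snd
        (Continuous.matrix_mulVec (hG.comp continuous_fst) continuous_snd)
    refine IsClosed.inter (s₁ := {q | _}) (s₂ := {q | _}) ?_ ?_
    · simp only [Set.ofPred_forall]
      refine isClosed_iInter fun w => isClosed_iInter fun _ => isClosed_le ?_ hq
      exact Continuous.dotProduct continuous_const
        (Continuous.matrix_mulVec (hG.comp continuous_fst) continuous_const)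
    · simp only [Set.ofPred_forall]
      refine isClosed_iInter fun i => ?_
      by_cases h : s i
      · simp only [h, if_true]; exact isClosed_le (by fun_prop) (by fun_prop)
      · simp only [h]; exact isClosed_le (by fun_prop) (by fun_prop)
  let A : (Fin n → Bool) → Set (Sample n p) := fun s =>
    ⋃ m, {Y | ∃ v ∈ K, (Y, v) ∈ C s m}
  have hA : ∀ s, MeasurableSet (A s) := by
    intro s
    refine MeasurableSet.iUnion fun m => IsClosed.measurableSet ?_
    have : CompactSpace K := isCompact_iff_compactSpace.1 hK
    have hcl := isClosedMap_fst_of_compactSpace (X := Sample n p) (Y := K) _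
      ((hC s m).preimage (f := fun q : Sample n p × K => (q.1, (q.2 : Fin n → ℝ))) (by fun_prop))
    convert hcl using 1
    ext Y
    simp
  let F : Sample n p → (Fin n → Bool) → Prop := fun Y s => Y ∈ A s
  have hF : Measurable F := measurable_pi_iff.2 fun s => measurableSet_setOfPred.1 (hA s)
  let g : ((Fin n → Bool) → Prop) → Fin n → ℝ :=
    fun P => if h : ∃ s, P s then val h.choose else 0
  have hg : Measurable g := measurable_of_finite g
  refine ⟨g ∘ F, hg.comp hF, fun Y => ?_⟩
  have hex : ∃ s, F Y s := by
    have hq : Continuous fun v : Fin n → ℝ => v ⬝ᵥ (hollowGram Y *ᵥ v) :=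
      Continuous.dotProduct continuous_id (Continuous.matrix_mulVec continuous_const continuous_id)
    obtain ⟨v, hvK, hv⟩ := hK.exists_isMaxOn hKne hq.continuousOn
    have hm : ∃ m : ℕ, ∀ i, v i < 0 → v i ≤ -(1 / ((m : ℝ) + 1)) := by
      have : ∀ i, ∃ m : ℕ, ∀ m', m ≤ m' → v i < 0 → v i ≤ -(1 / ((m' : ℝ) + 1)) := by
        intro i
        by_cases hi : v i < 0
        · obtain ⟨m, hm⟩ := exists_nat_one_div_lt (neg_pos.2 hi)
          refine ⟨m, fun m' hmm _ => ?_⟩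
          have := Nat.one_div_le_one_div (α := ℝ) hmm
          linarith
        · exact ⟨0, fun _ _ h => absurd h hi⟩
      choose m hm using this
      exact ⟨∑ i, m i, fun i =>
        hm i _ (Finset.single_le_sum (f := m) (fun _ _ => Nat.zero_le _) (Finset.mem_univ i))⟩
    obtain ⟨m, hm⟩ := hm
    refine ⟨fun i => decide (0 ≤ v i), Set.mem_iUnion.2 ⟨m, v, hvK, fun w hw => hv hw, fun i => ?_⟩⟩
    by_cases hi : 0 ≤ v i
    · simp [hi]
    · simpa [hi] using hm i (not_le.1 hi)
  have hs := hex.choose_spec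
  have hgF : (g ∘ F) Y = val hex.choose := by simp only [Function.comp, g]; exact dif_pos hex
  rw [hgF]
  generalize hex.choose = s at hs
  obtain ⟨m, v, hvK, hv1, hv2⟩ := Set.mem_iUnion.1 hs
  refine ⟨v, isTopEigenvector_of_max _ (hollowGram_isSymm Y) v hvK hv1, ?_⟩
  ext i
  have h := hv2 i
  by_cases hi : s i
  · simp only [hi, if_true] at h
    simp [val, signVec, hi, h]
  · simp only [hi] at h
    have : (0:ℝ) < 1 / ((m : ℝ) + 1) := by positivity
    have h' : ¬ (0 ≤ v i) := by
      have h1 : v i ≤ -(1 / ((m : ℝ) + 1)) := by simpa using h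
      linarith
    simp [val, signVec, hi, h']

end TwoGaussianMixture

end

/-!
Write `T = ‖θ‖`. After division by `σ` the noise has unit variance (`maxRisk_scale`), and the
square of the threshold `Δ̄` is the positive root of `D² = 2 log n (D + p / n)`
(`threshold_sq_sq`). Thus `T ≥ (1 + ε) Δ̄` means that the squared signal-to-noise ratio
`Q = T⁴ / (T² + p / n)` exceeds `2 log n` by a constant factor, and `exp (-Q / 2)` turns out to be,
to first order in the exponent, the probability of misclassifying one label when all the others are
known. With `n` labels, the critical value of this probability is `1 / n`.

**Recovery.** The hollowed Gram matrix is `T² (η ηᵀ - 1) + N`. By `χ²` tails and a union bound over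
a net (`exists_noise_event`), `‖N‖ ≤ 48 n T + 160 (√(p n) + n)` outside an event of probability
`6 exp (-n)`, and this is of smaller order than `n T²` above the threshold (`noise_norm_le`). On
that event the analysis is deterministic. The sign of a top eigenvector has few errors up to a
global sign (`errors_spectral`), and a step of the iteration divides the number of errors by `16`,
except for the weak coordinates, those where `η i * (H η) i ≤ δ n T²` (`errors_step`). Hence after
`⌊3 log n⌋` steps the loss is at most a constant times the number of weak coordinates plus `O(n⁻²)`
(`loss_iterate_le`). The weakness of a coordinate is a statement about the iteration at the truth
`η`, so that there is no dependence to fight: `η i * (H η) i` is the inner product of two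
independent Gaussian vectors, its Laplace transform is explicit (`lintegral_exp_oracle`), and
Chernoff's bound gives the probability `exp (-Q (1/2 - 2δ - 2/m))`, `m = n - 1`
(`noise_oracle_le`). For small `δ` this is at most `n ^ (-1 - ε)`, and the expected number of weak
coordinates tends to `0`.

**Impossibility.** Estimating each label with the knowledge of the others costs at most four times
the loss (`sum_align_le`), so for any prior on `θ` and uniform labels, the risk is at least `n / 4`
times the overlap of the two mixtures that differ in one label, up to a term that is small when the
prior hardly charges centres of norm below the required radius (`bayes_lower`). If `p ≤ ε n log n`,
the prior is a point mass at a vector of norm `T = (1 - ε) Δ̄`, and the overlap is at least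
`exp (-T² / 2 - 2 T)`. Otherwise the prior is a centred Gaussian law, whose norm is concentrated
slightly below `Δ̄`, and the overlap is at least `exp (-Q / 2 - 3 √Q)`. In both cases the two
densities are `exp (h + X)` and `exp (h - X)`, up to a constant factor, with explicit `h` and `X`,
and the lower bound for the integral of `exp (h - |X|)` follows from the Laplace transforms of `X`
under `exp h` (`lintegral_exp_sub_abs_ge`). As the overlap is of larger order than `1 / n`, the
maximal risk is eventually at least `1`.
-/

noncomputable section

namespace TwoGaussianMixture

/-! ### Gaussian vectors -/

theorem lintegral_pi_prod {ι : Type*} [Fintype ι] {α : ι → Type*} [∀ i, MeasurableSpace (α i)]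
    (μ : ∀ i, Measure (α i)) [∀ i, IsProbabilityMeasure (μ i)] (f : ∀ i, α i → ENNReal)
    (hf : ∀ i, Measurable (f i)) :
    ∫⁻ x, ∏ i, f i (x i) ∂(Measure.pi μ) = ∏ i, ∫⁻ y, f i y ∂(μ i) := by
  have hind : iIndepFun (fun i (x : ∀ i, α i) => f i (x i)) (Measure.pi μ) :=
    iIndepFun_pi (fun i => (hf i).aemeasurable)
  rw [lintegral_prod_eq_prod_lintegral_of_indepFun Finset.univ
    (fun i (x : ∀ i, α i) => f i (x i)) hind (fun i => (hf i).comp (measurable_pi_apply i))]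
  refine Finset.prod_congr rfl fun i _ => ?_
  exact (measurePreserving_eval μ i).lintegral_comp (hf i)

theorem pi_withDensity {ι : Type*} [Fintype ι] {α : ι → Type*} [∀ i, MeasurableSpace (α i)]
    (μ : ∀ i, Measure (α i)) [∀ i, IsProbabilityMeasure (μ i)] (f : ∀ i, α i → ENNReal)
    (hf : ∀ i, Measurable (f i)) [∀ i, SigmaFinite ((μ i).withDensity (f i))] :
    Measure.pi (fun i => (μ i).withDensity (f i)) =
      (Measure.pi μ).withDensity (fun x => ∏ i, f i (x i)) := by
  refine Measure.pi_eq fun s hs => ?_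
  rw [withDensity_apply _ (MeasurableSet.univ_pi hs),
    ← lintegral_indicator (MeasurableSet.univ_pi hs)]
  have h : ∀ x : ∀ i, α i, (Set.univ.pi s).indicator (fun x => ∏ i, f i (x i)) x =
      ∏ i, (s i).indicator (f i) (x i) := by
    intro x
    by_cases hx : x ∈ Set.univ.pi s
    · rw [Set.indicator_of_mem hx]
      exact Finset.prod_congr rfl fun i _ =>
        (Set.indicator_of_mem (hx i (Set.mem_univ i)) _).symm
    · rw [Set.indicator_of_notMem hx]
      simp only [Set.mem_pi, Set.mem_univ, true_implies, not_forall] at hx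
      obtain ⟨i, hi⟩ := hx
      exact (Finset.prod_eq_zero (Finset.mem_univ i) (Set.indicator_of_notMem hi _)).symm
  simp_rw [h]
  rw [lintegral_pi_prod μ _ fun i => (hf i).indicator (hs i)]
  refine Finset.prod_congr rfl fun i _ => ?_
  rw [lintegral_indicator (hs i), withDensity_apply _ (hs i)]

/-- Completing the square: the integrand times the standard Gaussian density is a multiple of the
density of the Gaussian law of variance `(1 - a)⁻¹`. -/
theorem lintegral_exp_quadratic_gaussianReal (v a : ℝ) (ha : a < 1) :
    ∫⁻ x, ENNReal.ofReal (Real.exp (v * x + a / 2 * x ^ 2)) ∂(gaussianReal 0 1) =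
      ENNReal.ofReal ((√(1 - a))⁻¹ * Real.exp (v ^ 2 / (2 * (1 - a)))) := by
  have h1 : 0 < 1 - a := by linarith
  rw [gaussianReal_of_var_ne_zero 0 one_ne_zero,
    lintegral_withDensity_eq_lintegral_mul _ (measurable_gaussianPDF 0 1) (by fun_prop)]
  set w : NNReal := ⟨(1 - a)⁻¹, by positivity⟩ with hw
  have hw0 : w ≠ 0 := by
    intro h
    have : (w : ℝ) = 0 := by rw [h]; rfl
    rw [hw] at this
    exact (inv_pos.2 h1).ne' this
  have hpt : ∀ x : ℝ,
      (gaussianPDF 0 1 * fun x => ENNReal.ofReal (Real.exp (v * x + a / 2 * x ^ 2))) x =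
      ENNReal.ofReal ((√(1 - a))⁻¹ * Real.exp (v ^ 2 / (2 * (1 - a)))) *
        gaussianPDF (v / (1 - a)) w x := by
    intro x
    simp only [Pi.mul_apply, gaussianPDF, gaussianPDFReal]
    rw [← ENNReal.ofReal_mul (by positivity), ← ENNReal.ofReal_mul (by positivity)]
    congr 1
    have hwc : (w : ℝ) = (1 - a)⁻¹ := rfl
    rw [hwc]
    have e1 : √(2 * Real.pi * (1 - a)⁻¹) = √(2 * Real.pi) * (√(1 - a))⁻¹ := by
      rw [Real.sqrt_mul (by positivity), Real.sqrt_inv]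
    rw [e1, NNReal.coe_one, mul_one, mul_assoc, ← Real.exp_add, mul_inv, inv_inv]
    have hs : √(1 - a) ≠ 0 := (Real.sqrt_pos.2 h1).ne'
    have e2 : (√(1 - a))⁻¹ * Real.exp (v ^ 2 / (2 * (1 - a))) *
        ((√(2 * Real.pi))⁻¹ * √(1 - a) *
          Real.exp (-(x - v / (1 - a)) ^ 2 / (2 * (1 - a)⁻¹))) =
        (√(2 * Real.pi))⁻¹ * (Real.exp (v ^ 2 / (2 * (1 - a))) *
          Real.exp (-(x - v / (1 - a)) ^ 2 / (2 * (1 - a)⁻¹))) := by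
      field_simp
    rw [e2, ← Real.exp_add]
    congr 2
    field_simp
    ring
  simp_rw [hpt]
  rw [lintegral_const_mul _ (measurable_gaussianPDF _ _), lintegral_gaussianPDF_eq_one _ hw0,
    mul_one]

/-- The standard Gaussian measure of `ℝ^p`. -/
abbrev gauss (p : ℕ) : Measure (EuclideanSpace ℝ (Fin p)) := stdGaussian _

theorem lintegral_gauss_prod {p : ℕ} (f : Fin p → ℝ → ENNReal) (hf : ∀ i, Measurable (f i)) :
    ∫⁻ z, ∏ i, f i (z i) ∂(gauss p) = ∏ i, ∫⁻ x, f i x ∂(gaussianReal 0 1) := by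
  rw [gauss, ← map_pi_eq_stdGaussian, lintegral_map (by fun_prop) (by fun_prop)]
  exact lintegral_pi_prod (fun _ : Fin p => gaussianReal 0 1) f hf

/-- The Laplace transform from which all exponential moments below are computed. -/
theorem lintegral_exp_quadratic_gauss {p : ℕ} (v : EuclideanSpace ℝ (Fin p)) (a : ℝ) (ha : a < 1) :
    ∫⁻ z, ENNReal.ofReal (Real.exp (inner ℝ v z + a / 2 * ‖z‖ ^ 2)) ∂(gauss p) =
      ENNReal.ofReal ((√(1 - a))⁻¹ ^ p * Real.exp (‖v‖ ^ 2 / (2 * (1 - a)))) := by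
  have h : ∀ z : EuclideanSpace ℝ (Fin p),
      ENNReal.ofReal (Real.exp (inner ℝ v z + a / 2 * ‖z‖ ^ 2)) =
        ∏ i, ENNReal.ofReal (Real.exp (v i * z i + a / 2 * (z i) ^ 2)) := by
    intro z
    rw [← ENNReal.ofReal_prod_of_nonneg (fun _ _ => (Real.exp_pos _).le), ← Real.exp_sum,
      Finset.sum_add_distrib, ← Finset.mul_sum, ← EuclideanSpace.real_norm_sq_eq,
      PiLp.inner_apply]
    simp [mul_comm]
  simp_rw [h]
  rw [lintegral_gauss_prod (fun i x => ENNReal.ofReal (Real.exp (v i * x + a / 2 * x ^ 2)))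
    (by fun_prop)]
  simp_rw [lintegral_exp_quadratic_gaussianReal _ a ha]
  rw [← ENNReal.ofReal_prod_of_nonneg (fun _ _ => by positivity), Finset.prod_mul_distrib,
    ← Real.exp_sum, ← Finset.sum_div, ← EuclideanSpace.real_norm_sq_eq]
  simp

/-- The Cameron–Martin formula. -/
theorem map_add_gauss {p : ℕ} (v : EuclideanSpace ℝ (Fin p)) :
    (gauss p).map (fun z => v + z) =
      (gauss p).withDensity fun z => ENNReal.ofReal (Real.exp (inner ℝ v z - ‖v‖ ^ 2 / 2)) := by
  have h1 : ∀ m : ℝ, gaussianReal m 1 = (gaussianReal 0 1).withDensity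
      fun x => ENNReal.ofReal (Real.exp (m * x - m ^ 2 / 2)) := by
    intro m
    rw [gaussianReal_of_var_ne_zero 0 one_ne_zero, gaussianReal_of_var_ne_zero m one_ne_zero,
      ← withDensity_mul _ (measurable_gaussianPDF 0 1) (by fun_prop)]
    congr 1
    ext x
    simp only [Pi.mul_apply, gaussianPDF, gaussianPDFReal]
    rw [← ENNReal.ofReal_mul (by positivity)]
    simp only [NNReal.coe_one, mul_one, sub_zero]
    rw [mul_assoc, ← Real.exp_add]
    congr 3
    ring
  have h2 : (gauss p).map (fun z => v + z) =
      (Measure.pi fun i => gaussianReal (v i) 1).map (WithLp.toLp 2) := by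
    rw [gauss, ← map_pi_eq_stdGaussian, Measure.map_map (by fun_prop) (by fun_prop)]
    have : Measure.pi (fun i => gaussianReal (v i) 1) =
        (Measure.pi fun _ : Fin p => gaussianReal 0 1).map (fun x i => v i + x i) := by
      rw [Measure.pi_map_pi (by fun_prop)]
      congr 1
      ext i : 1
      rw [gaussianReal_map_const_add, zero_add]
    rw [this, Measure.map_map (by fun_prop) (by fun_prop)]
    congr 1
  rw [h2, show (fun i => gaussianReal (v i) 1) = _ from funext fun i => h1 (v i)]
  have : ∀ m : ℝ, SigmaFinite ((gaussianReal 0 1).withDensity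
      fun x => ENNReal.ofReal (Real.exp (m * x - m ^ 2 / 2))) := by
    intro m; rw [← h1]; infer_instance
  rw [pi_withDensity (fun _ : Fin p => gaussianReal 0 1)
    (fun i x => ENNReal.ofReal (Real.exp (v i * x - v i ^ 2 / 2))) (by fun_prop)]
  ext s hs
  rw [Measure.map_apply (by fun_prop) hs, withDensity_apply _ hs,
    withDensity_apply _ ((by fun_prop : Measurable (WithLp.toLp 2 : (Fin p → ℝ) → _)) hs), gauss,
    ← map_pi_eq_stdGaussian, setLIntegral_map hs (by fun_prop) (by fun_prop)]
  refine lintegral_congr fun x => ?_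
  rw [← ENNReal.ofReal_prod_of_nonneg (fun _ _ => (Real.exp_pos _).le), ← Real.exp_sum,
    Finset.sum_sub_distrib, ← Finset.sum_div, ← EuclideanSpace.real_norm_sq_eq,
    PiLp.inner_apply]
  simp [mul_comm]

/-- The law of the noise `(ξ_1, …, ξ_n)`. -/
abbrev noise (n p : ℕ) : Measure (Sample n p) := Measure.pi fun _ : Fin n => gauss p

/-- The likelihood ratio against pure noise depends on the labels only through `∑ i, η i • Y i`. -/
theorem law_one_eq_withDensity {n p : ℕ} (θ : EuclideanSpace ℝ (Fin p)) {η : Fin n → ℝ}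
    (hη : η ∈ labels n) :
    law 1 θ η = (noise n p).withDensity fun Y =>
      ENNReal.ofReal (Real.exp (inner ℝ θ (∑ i, η i • Y i) - n * ‖θ‖ ^ 2 / 2)) := by
  have h0 : law 1 θ η = Measure.pi (fun i => (gauss p).map (fun z => η i • θ + z)) := by
    rw [← Measure.pi_map_pi (by fun_prop)]
    simp [law]
  rw [h0]
  simp_rw [map_add_gauss]
  have : ∀ v : EuclideanSpace ℝ (Fin p), SigmaFinite ((gauss p).withDensity
      fun z => ENNReal.ofReal (Real.exp (inner ℝ v z - ‖v‖ ^ 2 / 2))) := by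
    intro v; rw [← map_add_gauss]
    have : IsProbabilityMeasure ((gauss p).map (fun z => v + z)) :=
      Measure.isProbabilityMeasure_map (by fun_prop)
    infer_instance
  rw [pi_withDensity (fun _ : Fin n => gauss p) (fun i z => ENNReal.ofReal
    (Real.exp (inner ℝ (η i • θ) z - ‖η i • θ‖ ^ 2 / 2))) (by fun_prop)]
  congr 1
  ext Y
  rw [← ENNReal.ofReal_prod_of_nonneg (fun _ _ => (Real.exp_pos _).le), ← Real.exp_sum,
    Finset.sum_sub_distrib, inner_sum]
  congr 3
  · refine Finset.sum_congr rfl fun i _ => ?_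
    rw [real_inner_smul_left, real_inner_smul_right]
  · have : ∀ i, ‖η i • θ‖ ^ 2 / 2 = ‖θ‖ ^ 2 / 2 := by
      intro i
      rcases hη i with h | h <;> simp [h]
    simp [this]
    ring

/-- A linear combination of independent standard Gaussian vectors is distributed as a multiple of
one such vector. -/
theorem map_sum_smul_pi_gauss {ι : Type*} [Fintype ι] {p : ℕ} (x : ι → ℝ) (c : ℝ)
    (hc : c ^ 2 = ∑ i, x i ^ 2) :
    (Measure.pi fun _ : ι => gauss p).map (fun ξ => ∑ i, x i • ξ i) =
      (gauss p).map (fun z => c • z) := by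
  have hm1 : Measurable (fun ξ : ι → EuclideanSpace ℝ (Fin p) => ∑ i, x i • ξ i) := by fun_prop
  have h1 : IsProbabilityMeasure ((Measure.pi fun _ : ι => gauss p).map
    (fun ξ => ∑ i, x i • ξ i)) := Measure.isProbabilityMeasure_map hm1.aemeasurable
  have h2 : IsProbabilityMeasure ((gauss p).map (fun z => c • z)) :=
    Measure.isProbabilityMeasure_map (by fun_prop)
  refine Measure.ext_of_charFun ?_
  ext t
  have e1 : charFun ((gauss p).map (fun z => c • z)) t = charFun (gauss p) (c • t) := by
    rw [charFun_apply, integral_map (by fun_prop) (by fun_prop), charFun_apply]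
    simp [real_inner_smul_left, real_inner_smul_right]
  rw [e1, charFun_stdGaussian, charFun_apply, integral_map hm1.aemeasurable (by fun_prop)]
  simp_rw [sum_inner, real_inner_smul_left, Complex.ofReal_sum, Finset.sum_mul, Complex.exp_sum]
  rw [integral_fintype_prod_eq_prod (f := fun i (z : EuclideanSpace ℝ (Fin p)) =>
    Complex.exp (((x i * inner ℝ z t : ℝ) : ℂ) * Complex.I))]
  have e2 : ∀ i, ∫ z, Complex.exp (((x i * inner ℝ z t : ℝ) : ℂ) * Complex.I) ∂(gauss p) =
      Complex.exp (-((x i ^ 2 * ‖t‖ ^ 2 : ℝ) : ℂ) / 2) := by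
    intro i
    have := charFun_stdGaussian (x i • t)
    rw [charFun_apply] at this
    simp_rw [real_inner_smul_right] at this
    rw [this, norm_smul]
    congr 2
    push_cast
    rw [mul_pow]
    norm_cast
    rw [Real.norm_eq_abs, sq_abs]
  simp_rw [e2]
  rw [← Complex.exp_sum]
  congr 1
  rw [← Finset.sum_div, Finset.sum_neg_distrib, norm_smul, ← Complex.ofReal_sum, ← Finset.sum_mul,
    ← hc]
  push_cast
  rw [mul_pow]
  norm_cast
  rw [Real.norm_eq_abs, sq_abs]

theorem lintegral_sum_smul {ι : Type*} [Fintype ι] {p : ℕ} (x : ι → ℝ) (c : ℝ)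
    (hc : c ^ 2 = ∑ i, x i ^ 2) (F : EuclideanSpace ℝ (Fin p) → ENNReal) (hF : Measurable F) :
    ∫⁻ ξ, F (∑ i, x i • ξ i) ∂(Measure.pi fun _ : ι => gauss p) = ∫⁻ z, F (c • z) ∂(gauss p) := by
  rw [← lintegral_map hF (by fun_prop : Measurable fun z : EuclideanSpace ℝ (Fin p) => c • z),
    ← map_sum_smul_pi_gauss x c hc, lintegral_map hF (by fun_prop)]

/-! ### Tails of norms and linear forms -/

/-- Chernoff's bound, the tilt and the level being absorbed into `h`. -/
theorem measure_nonneg_le_lintegral_exp {Ω : Type*} [MeasurableSpace Ω] (μ : Measure Ω)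
    {h : Ω → ℝ} (hh : Measurable h) :
    μ {x | 0 ≤ h x} ≤ ∫⁻ x, ENNReal.ofReal (Real.exp (h x)) ∂μ := by
  have := mul_meas_ge_le_lintegral (μ := μ)
    (f := fun x => ENNReal.ofReal (Real.exp (h x))) (by fun_prop) 1
  rw [one_mul] at this
  refine le_trans (measure_mono fun x hx => ?_) this
  simp only [Set.mem_ofPred_eq, ENNReal.one_le_ofReal, Real.one_le_exp_iff] at hx ⊢
  exact hx

/-- An upper bound for `-log (1 - u) / 2`, of second order in `u` on both sides of `0`. -/
theorem inv_sqrt_one_sub_le {u : ℝ} (hu : |u| ≤ 1 / 2) :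
    (√(1 - u))⁻¹ ≤ Real.exp (u / 2 + u ^ 2 / 2) := by
  obtain ⟨h1, h2⟩ := abs_le.1 hu
  have key : 1 ≤ Real.exp (u + u ^ 2) * (1 - u) := by
    rcases le_total 0 u with h | h
    · have := Real.quadratic_le_exp_of_nonneg (x := u + u ^ 2) (by positivity)
      have h3 : (1 + (u + u ^ 2) + (u + u ^ 2) ^ 2 / 2) * (1 - u) ≤
          Real.exp (u + u ^ 2) * (1 - u) := by
        gcongr
        linarith
      refine le_trans ?_ h3
      have : 0 ≤ u ^ 2 * ((1 + u) ^ 2 * (1 - u) - 2 * u) := by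
        refine mul_nonneg (sq_nonneg _) ?_
        nlinarith [mul_nonneg h (sub_nonneg.2 h2), mul_nonneg h (mul_nonneg h (sub_nonneg.2 h2))]
      nlinarith
    · have := Real.add_one_le_exp (u + u ^ 2)
      have h3 : (u + u ^ 2 + 1) * (1 - u) ≤ Real.exp (u + u ^ 2) * (1 - u) := by
        gcongr
        linarith
      refine le_trans ?_ h3
      have : u * u ^ 2 ≤ 0 := mul_nonpos_of_nonpos_of_nonneg h (sq_nonneg _)
      nlinarith
  have h0 : 0 < 1 - u := by linarith
  rw [inv_le_comm₀ (Real.sqrt_pos.2 h0) (Real.exp_pos _), ← Real.exp_neg]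
  refine Real.le_sqrt_of_sq_le ?_
  rw [← Real.exp_nat_mul]
  have e : ((2 : ℕ) : ℝ) * -(u / 2 + u ^ 2 / 2) = -(u + u ^ 2) := by push_cast; ring
  rw [e, Real.exp_neg, inv_le_iff_one_le_mul₀ (Real.exp_pos _), mul_comm]
  exact key

theorem lintegral_exp_normSq_gauss_le {p : ℕ} {s : ℝ} (hs : |s| ≤ 1 / 4) (t : ℝ) :
    ∫⁻ z, ENNReal.ofReal (Real.exp (s * (‖z‖ ^ 2 - p) - t)) ∂(gauss p) ≤
      ENNReal.ofReal (Real.exp (2 * s ^ 2 * p - t)) := by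
  have h2 : |2 * s| ≤ 1 / 2 := by rw [abs_mul, abs_two]; linarith
  have e : ∀ z : EuclideanSpace ℝ (Fin p), ENNReal.ofReal (Real.exp (s * (‖z‖ ^ 2 - p) - t)) =
      ENNReal.ofReal (Real.exp (-(s * p) - t)) *
        ENNReal.ofReal (Real.exp (inner ℝ 0 z + 2 * s / 2 * ‖z‖ ^ 2)) := by
    intro z
    rw [← ENNReal.ofReal_mul (Real.exp_pos _).le, ← Real.exp_add, inner_zero_left]
    congr 2
    ring
  simp_rw [e]
  rw [lintegral_const_mul _ (by fun_prop),
    lintegral_exp_quadratic_gauss 0 (2 * s) (by linarith [(abs_le.1 h2).2]),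
    ← ENNReal.ofReal_mul (Real.exp_pos _).le]
  refine ENNReal.ofReal_le_ofReal ?_
  have h3 : (√(1 - 2 * s))⁻¹ ^ p ≤ Real.exp (2 * s / 2 + (2 * s) ^ 2 / 2) ^ p := by
    gcongr
    exact inv_sqrt_one_sub_le h2
  rw [← Real.exp_nat_mul] at h3
  simp only [norm_zero, ne_eq, OfNat.ofNat_ne_zero, not_false_eq_true, zero_pow, zero_div,
    Real.exp_zero, mul_one]
  calc _ ≤ Real.exp (-(s * p) - t) * Real.exp (p * (2 * s / 2 + (2 * s) ^ 2 / 2)) := by gcongr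
    _ = _ := by rw [← Real.exp_add]; congr 1; ring

theorem gauss_normSq_ge_le {p : ℕ} {s t : ℝ} (hs0 : 0 ≤ s) (hs : s ≤ 1 / 4) :
    gauss p {z | t ≤ ‖z‖ ^ 2 - p} ≤ ENNReal.ofReal (Real.exp (2 * s ^ 2 * p - s * t)) := by
  refine le_trans (measure_mono ?_) (le_trans (measure_nonneg_le_lintegral_exp (gauss p)
    (h := fun z => s * (‖z‖ ^ 2 - p) - s * t) (by fun_prop))
    (lintegral_exp_normSq_gauss_le (by rwa [abs_of_nonneg hs0]) (s * t)))
  intro z hz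
  have := mul_le_mul_of_nonneg_left hz hs0
  simp only [Set.mem_ofPred_eq] at this ⊢
  linarith

theorem gauss_normSq_le_le {p : ℕ} {s t : ℝ} (hs0 : 0 ≤ s) (hs : s ≤ 1 / 4) :
    gauss p {z | ‖z‖ ^ 2 - p ≤ -t} ≤ ENNReal.ofReal (Real.exp (2 * s ^ 2 * p - s * t)) := by
  have h1 := lintegral_exp_normSq_gauss_le (p := p) (s := -s)
    (by rwa [abs_neg, abs_of_nonneg hs0]) (s * t)
  rw [neg_sq] at h1
  refine le_trans (measure_mono ?_) (le_trans (measure_nonneg_le_lintegral_exp (gauss p)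
    (h := fun z => -s * (‖z‖ ^ 2 - p) - s * t) (by fun_prop)) h1)
  intro z hz
  have := mul_le_mul_of_nonneg_left hz hs0
  simp only [Set.mem_ofPred_eq] at this ⊢
  linarith

/-- Concentration of `χ²` at the exponential rate `n`. The factor `20` makes the exponent `39/8`,
which is larger than `log 25 + 1`: this allows a union bound over `25 ^ n` events. -/
theorem gauss_abs_normSq_sub_ge_le {p n : ℕ} (hn : 1 ≤ n) :
    gauss p {z | 20 * (√(p * n) + n) ≤ |‖z‖ ^ 2 - p|} ≤
      ENNReal.ofReal (2 * Real.exp (-(39 / 8 * n))) := by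
  have hn' : (0 : ℝ) < √n := Real.sqrt_pos.2 (by exact_mod_cast hn)
  have hp' : (0 : ℝ) ≤ √p := Real.sqrt_nonneg _
  -- the optimal tilt is of order `√(n / p)`, and it has to stay below `1 / 4`
  set s : ℝ := 1 / 4 * (√n / (√n + √p)) with hs
  have hs0 : 0 ≤ s := by positivity
  have hr : √n / (√n + √p) ≤ 1 := by
    rw [div_le_one (by positivity)]; linarith
  have hs1 : s ≤ 1 / 4 := by rw [hs]; linarith
  set t : ℝ := 20 * (√(p * n) + n) with ht
  have en : (n : ℝ) = √n * √n := (Real.mul_self_sqrt (Nat.cast_nonneg n)).symm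
  have ep : (p : ℝ) = √p * √p := (Real.mul_self_sqrt (Nat.cast_nonneg p)).symm
  have hst : s * t = 5 * n := by
    rw [hs, ht, Real.sqrt_mul (Nat.cast_nonneg p)]
    have : √p * √n + n = √n * (√n + √p) := by linarith
    rw [this, show (5 : ℝ) * n = 5 * (√n * √n) by rw [← en]]
    field_simp
    ring
  have hsp : 2 * s ^ 2 * p ≤ n / 8 := by
    have h1 : √n / (√n + √p) * √p ≤ √n := by
      rw [div_mul_eq_mul_div, div_le_iff₀ (by positivity)]
      nlinarith
    have h2 : (√n / (√n + √p) * √p) ^ 2 ≤ √n ^ 2 := by gcongr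
    have h3 : 2 * s ^ 2 * p = 1 / 8 * (√n / (√n + √p) * √p) ^ 2 := by
      rw [hs, mul_pow _ (√(p : ℝ)), Real.sq_sqrt (Nat.cast_nonneg p)]; ring
    rw [h3]
    rw [Real.sq_sqrt (Nat.cast_nonneg n)] at h2
    linarith
  have hle : Real.exp (2 * s ^ 2 * p - s * t) ≤ Real.exp (-(39 / 8 * n)) := by
    gcongr
    rw [hst]; linarith
  have hsub : {z : EuclideanSpace ℝ (Fin p) | t ≤ |‖z‖ ^ 2 - p|} ⊆
      {z | t ≤ ‖z‖ ^ 2 - p} ∪ {z | ‖z‖ ^ 2 - p ≤ -t} := by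
    intro z hz
    rcases le_abs.1 (show t ≤ |‖z‖ ^ 2 - p| from hz) with h | h
    · exact Or.inl h
    · exact Or.inr (by simp only [Set.mem_ofPred_eq]; linarith)
  refine (measure_mono hsub).trans ((measure_union_le _ _).trans ?_)
  rw [two_mul, ENNReal.ofReal_add (Real.exp_pos _).le (Real.exp_pos _).le]
  exact add_le_add ((gauss_normSq_ge_le hs0 hs1).trans (ENNReal.ofReal_le_ofReal hle))
    ((gauss_normSq_le_le hs0 hs1).trans (ENNReal.ofReal_le_ofReal hle))

theorem gauss_inner_ge_le {p : ℕ} {u : EuclideanSpace ℝ (Fin p)} (hu : ‖u‖ ≤ 1) {t : ℝ}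
    (ht : 0 ≤ t) : gauss p {z | t ≤ inner ℝ u z} ≤ ENNReal.ofReal (Real.exp (-(t ^ 2 / 2))) := by
  refine le_trans (measure_mono ?_) (le_trans (measure_nonneg_le_lintegral_exp (gauss p)
    (h := fun z => inner ℝ (t • u) z - t ^ 2) (by fun_prop)) ?_)
  · intro z hz
    have := mul_le_mul_of_nonneg_left hz ht
    simp only [Set.mem_ofPred_eq, real_inner_smul_left] at this ⊢
    linarith
  · have e : ∀ z : EuclideanSpace ℝ (Fin p), ENNReal.ofReal (Real.exp (inner ℝ (t • u) z - t ^ 2)) =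
        ENNReal.ofReal (Real.exp (-t ^ 2)) *
        ENNReal.ofReal (Real.exp (inner ℝ (t • u) z + 0 / 2 * ‖z‖ ^ 2)) := by
      intro z
      rw [← ENNReal.ofReal_mul (Real.exp_pos _).le, ← Real.exp_add]
      congr 2
      ring
    simp_rw [e]
    rw [lintegral_const_mul _ (by fun_prop), lintegral_exp_quadratic_gauss _ 0 (by norm_num),
      ← ENNReal.ofReal_mul (Real.exp_pos _).le]
    refine ENNReal.ofReal_le_ofReal ?_
    simp only [sub_zero, Real.sqrt_one, inv_one, one_pow, one_mul, mul_one]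
    rw [← Real.exp_add, norm_smul, Real.norm_of_nonneg ht]
    gcongr
    have : (t * ‖u‖) ^ 2 ≤ (t * 1) ^ 2 := by gcongr
    linarith

/-- Independence of `Y_i` and of the signed sum of the other columns under the law of the noise. -/
theorem lintegral_noise_split {m p : ℕ} (i : Fin (m + 1)) {η : Fin (m + 1) → ℝ} (hη : η ∈ labels _)
    (F : EuclideanSpace ℝ (Fin p) → EuclideanSpace ℝ (Fin p) → ENNReal)
    (hF : Measurable (Function.uncurry F)) :
    ∫⁻ Y, F (Y i) (∑ j, η (i.succAbove j) • Y (i.succAbove j)) ∂(noise (m + 1) p) =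
      ∫⁻ z, ∫⁻ y, F y (√m • z) ∂(gauss p) ∂(gauss p) := by
  have hsq : (√(m : ℝ)) ^ 2 = ∑ j : Fin m, η (i.succAbove j) ^ 2 := by
    rw [Real.sq_sqrt (Nat.cast_nonneg m)]
    have : ∀ j : Fin m, η (i.succAbove j) ^ 2 = 1 := by
      intro j; rcases hη (i.succAbove j) with h | h <;> simp [h]
    simp [this]
  have hmp := measurePreserving_piFinSuccAbove (fun _ : Fin (m + 1) => gauss p) i
  have h1 := hmp.lintegral_comp (f := fun q : EuclideanSpace ℝ (Fin p) ×
    (Fin m → EuclideanSpace ℝ (Fin p)) => F q.1 (∑ j, η (i.succAbove j) • q.2 j)) (by fun_prop)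
  refine Eq.trans ?_ (h1.trans ?_)
  · rfl
  · rw [lintegral_prod_symm _ (by fun_prop)]
    exact lintegral_sum_smul (fun j => η (i.succAbove j)) √m hsq
      (fun s => ∫⁻ y, F y s ∂(gauss p)) hF.lintegral_prod_left'

/-! ### Reduction to unit noise -/

theorem risk_scale {n p : ℕ} {σ : ℝ} {f : Sample n p → Fin n → ℝ} (hf : Measurable f)
    (θ : EuclideanSpace ℝ (Fin p)) (η : Fin n → ℝ) :
    risk σ f (σ • θ) η = risk 1 (fun Y => f fun i => σ • Y i) θ η := by
  have hl : law σ (σ • θ) η = (law 1 θ η).map fun Y i => σ • Y i := by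
    rw [law, law, Measure.map_map (by fun_prop) (by fun_prop)]
    congr 1
    ext ξ i : 2
    simp [smul_add, smul_comm σ (η i)]
  have hm : Measurable fun Y : Sample n p => ENNReal.ofReal (loss (f Y) η) := by
    unfold loss hamming
    fun_prop
  rw [risk, hl, lintegral_map hm (by fun_prop), risk]

/-- Dividing the sample by `σ` turns the noise level `σ` into `1` and the radius `Δ` into
`Δ / σ`. -/
theorem maxRisk_scale {n p : ℕ} {σ : ℝ} (hσ : 0 < σ) (Δ : ℝ) {f : Sample n p → Fin n → ℝ}
    (hf : Measurable f) :
    maxRisk σ Δ f = maxRisk 1 (Δ / σ) (fun Y => f fun i => σ • Y i) := by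
  have hn : ∀ θ : EuclideanSpace ℝ (Fin p), ‖σ • θ‖ = σ * ‖θ‖ := fun θ => by
    rw [norm_smul, Real.norm_of_nonneg hσ.le]
  unfold maxRisk
  refine le_antisymm (iSup_le fun θ => iSup_le fun hθ => iSup_le fun η => iSup_le fun hη => ?_)
    (iSup_le fun θ => iSup_le fun hθ => iSup_le fun η => iSup_le fun hη => ?_)
  · have h := risk_scale (σ := σ) hf (σ⁻¹ • θ) η
    rw [smul_inv_smul₀ hσ.ne'] at h
    rw [h]
    have hθ' : Δ / σ ≤ ‖σ⁻¹ • θ‖ := by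
      rw [div_le_iff₀ hσ, mul_comm, ← hn, smul_inv_smul₀ hσ.ne']; exact hθ
    exact le_iSup₂_of_le (σ⁻¹ • θ) hθ' (le_iSup₂_of_le η hη le_rfl)
  · rw [← risk_scale hf]
    have hθ' : Δ ≤ ‖σ • θ‖ := by
      rw [hn, mul_comm, ← div_le_iff₀ hσ]; exact hθ
    exact le_iSup₂_of_le (σ • θ) hθ' (le_iSup₂_of_le η hη le_rfl)

theorem threshold_eq_mul {n p : ℕ} {σ : ℝ} (hσ : 0 < σ) :
    threshold n p σ = σ * threshold n p 1 := by
  unfold threshold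
  rw [one_pow, one_mul, mul_assoc, Real.sqrt_mul (sq_nonneg σ), Real.sqrt_sq hσ.le]

theorem hollowGram_scale {n p : ℕ} (σ : ℝ) (Y : Sample n p) :
    hollowGram (fun i => σ • Y i) = σ ^ 2 • hollowGram Y := by
  have : dataMatrix (fun i => σ • Y i) = σ • dataMatrix Y := by
    ext; simp [dataMatrix]
  unfold hollowGram hollow
  rw [this]
  ext i j
  simp [Matrix.diagonal_apply, Matrix.transpose_smul]
  split_ifs <;> ring

theorem signVec_smul {n : ℕ} {c : ℝ} (hc : 0 < c) (x : Fin n → ℝ) :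
    signVec (c • x) = signVec x := by
  ext i
  simp [signVec, hc]

theorem lloyd_scale {n p : ℕ} {σ : ℝ} (hσ : 0 < σ) (η₀ : Sample n p → Fin n → ℝ) (k : ℕ)
    (Y : Sample n p) :
    lloyd η₀ k (fun i => σ • Y i) = lloyd (fun Y => η₀ fun i => σ • Y i) k Y := by
  induction k with
  | zero => rfl
  | succ k ih =>
    simp only [lloyd]
    rw [ih, hollowGram_scale, Matrix.smul_mulVec, signVec_smul (by positivity)]

theorem isTopEigenvector_smul {n : ℕ} {c : ℝ} (hc : 0 < c) {M : Matrix (Fin n) (Fin n) ℝ}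
    {v : Fin n → ℝ} (h : IsTopEigenvector (c • M) v) : IsTopEigenvector M v := by
  obtain ⟨μ, ⟨h1, h2⟩, h3⟩ := h
  have h1' : c • (M *ᵥ v) = μ • v := by
    simpa [Matrix.smul_mulVec] using Module.End.mem_eigenspace_iff.1 h1
  refine ⟨c⁻¹ * μ, ⟨Module.End.mem_eigenspace_iff.2 ?_, h2⟩, fun ν hν => ?_⟩
  · rw [Matrix.toLin'_apply, mul_smul, ← h1', inv_smul_smul₀ hc.ne']
  · obtain ⟨w, hw1, hw2⟩ := hν.exists_hasEigenvector
    have hw1' : M *ᵥ w = ν • w := by simpa using Module.End.mem_eigenspace_iff.1 hw1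
    have := h3 (c * ν) (Module.End.hasEigenvalue_of_hasEigenvector (x := w)
      ⟨Module.End.mem_eigenspace_iff.2 (by
        rw [Matrix.toLin'_apply, Matrix.smul_mulVec, hw1', mul_smul]), hw2⟩)
    rw [le_inv_mul_iff₀ hc]
    exact this

theorem isSpectralEstimator_scale {n p : ℕ} {σ : ℝ} (hσ : 0 < σ) {η₀ : Sample n p → Fin n → ℝ}
    (h : IsSpectralEstimator η₀) : IsSpectralEstimator fun Y => η₀ fun i => σ • Y i := by
  refine ⟨h.1.comp (by fun_prop), fun Y => ?_⟩
  obtain ⟨v, h1, h2⟩ := h.2 fun i => σ • Y i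
  rw [hollowGram_scale] at h1
  exact ⟨v, isTopEigenvector_smul (by positivity) h1, h2⟩

theorem signVec_mem_labels {n : ℕ} (x : Fin n → ℝ) : signVec x ∈ labels n := by
  intro i
  simp only [signVec]
  split_ifs <;> simp

theorem measurable_signVec {n : ℕ} : Measurable (signVec : (Fin n → ℝ) → Fin n → ℝ) := by
  refine measurable_pi_lambda _ fun i => ?_
  exact Measurable.ite (measurableSet_le measurable_const (measurable_pi_apply i))
    measurable_const measurable_const

theorem isEstimator_lloyd {n p : ℕ} {η₀ : Sample n p → Fin n → ℝ} (h : IsSpectralEstimator η₀)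
    (k : ℕ) : IsEstimator (lloyd η₀ k) := by
  induction k with
  | zero =>
    refine ⟨h.1, fun Y => ?_⟩
    obtain ⟨v, -, hv⟩ := h.2 Y
    simp only [lloyd, hv]
    exact signVec_mem_labels v
  | succ k ih =>
    refine ⟨?_, fun Y => signVec_mem_labels _⟩
    refine measurable_signVec.comp ?_
    have h1 : Continuous fun q : Matrix (Fin n) (Fin n) ℝ × (Fin n → ℝ) => q.1 *ᵥ q.2 :=
      continuous_fst.matrix_mulVec continuous_snd
    refine measurable_pi_lambda _ fun i => ?_
    simp only [Matrix.mulVec, dotProduct]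
    refine Finset.measurable_sum _ fun j _ => Measurable.mul ?_ ?_
    · exact ((continuous_hollowGram (n := n) (p := p)).matrix_elem i j).measurable
    · exact (measurable_pi_apply j).comp ih.1

/-! ### Deterministic analysis of the iteration -/

/-- The number of coordinates in which two vectors differ. -/
def errors {n : ℕ} (u η : Fin n → ℝ) : ℕ := (Finset.univ.filter fun i => u i ≠ η i).card

/-- The number of weak coordinates: those `i` at which the margin `η i * (M η) i` of one step of the
iteration, started at the truth `η`, is at most `τ`. -/
def weakCount {n : ℕ} (M : Matrix (Fin n) (Fin n) ℝ) (η : Fin n → ℝ) (τ : ℝ) : ℕ :=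
  (Finset.univ.filter fun i => η i * (M *ᵥ η) i ≤ τ).card

theorem labels_sq {n : ℕ} {η : Fin n → ℝ} (hη : η ∈ labels n) (i : Fin n) : η i * η i = 1 := by
  rcases hη i with h | h <;> simp [h]

theorem labels_dot {n : ℕ} {η : Fin n → ℝ} (hη : η ∈ labels n) : η ⬝ᵥ η = n := by
  simp [dotProduct, labels_sq hη]

theorem neg_mem_labels {n : ℕ} {η : Fin n → ℝ} (hη : η ∈ labels n) : -η ∈ labels n := by
  intro i
  rcases hη i with h | h <;> simp [h]

theorem hamming_eq {n : ℕ} {u η : Fin n → ℝ} (hu : u ∈ labels n) (hη : η ∈ labels n) :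
    hamming u η = 2 * errors u η := by
  rw [hamming, errors, Finset.card_filter, Nat.cast_sum, Finset.mul_sum]
  refine Finset.sum_congr rfl fun i _ => ?_
  rcases hu i with h | h <;> rcases hη i with h' | h' <;> norm_num [h, h']

theorem dot_sub_sub {n : ℕ} {u η : Fin n → ℝ} (hu : u ∈ labels n) (hη : η ∈ labels n) :
    (u - η) ⬝ᵥ (u - η) = 4 * errors u η := by
  rw [dotProduct, errors, Finset.card_filter, Nat.cast_sum, Finset.mul_sum]
  refine Finset.sum_congr rfl fun i _ => ?_
  rcases hu i with h | h <;> rcases hη i with h' | h' <;> norm_num [h, h']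

theorem dot_sub {n : ℕ} {u η : Fin n → ℝ} (hu : u ∈ labels n) (hη : η ∈ labels n) :
    η ⬝ᵥ (u - η) = -2 * errors u η := by
  rw [dotProduct, errors, Finset.card_filter, Nat.cast_sum, Finset.mul_sum]
  refine Finset.sum_congr rfl fun i _ => ?_
  rcases hu i with h | h <;> rcases hη i with h' | h' <;> norm_num [h, h']

theorem errors_le {n : ℕ} (u η : Fin n → ℝ) : errors u η ≤ n :=
  (Finset.card_filter_le _ _).trans_eq (Finset.card_fin n)

theorem loss_le_errors {n : ℕ} {u η : Fin n → ℝ} (hu : u ∈ labels n) (hη : η ∈ labels n) :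
    loss u η ≤ 2 * errors u η := by
  rw [← hamming_eq hu hη]; exact min_le_left _ _

theorem loss_neg {n : ℕ} (u η : Fin n → ℝ) : loss u (-η) = loss u η := by
  rw [loss, loss, neg_neg, min_comm]

theorem loss_le {n : ℕ} {u η : Fin n → ℝ} (hu : u ∈ labels n) (hη : η ∈ labels n) :
    loss u η ≤ 2 * n := by
  refine (loss_le_errors hu hη).trans ?_
  have : (errors u η : ℝ) ≤ n := by exact_mod_cast errors_le u η
  linarith

theorem mul_nonpos_of_signVec_ne {n : ℕ} {x η : Fin n → ℝ} (hη : η ∈ labels n) {i : Fin n}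
    (h : signVec x i ≠ η i) : η i * x i ≤ 0 := by
  simp only [signVec] at h
  split_ifs at h with h0
  · rcases hη i with h' | h'
    · exact absurd h'.symm h
    · rw [h']; linarith
  · rcases hη i with h' | h'
    · rw [h']; linarith
    · exact absurd h'.symm h

theorem abs_dot_mulVec_le {n : ℕ} {N : Matrix (Fin n) (Fin n) ℝ} {K : ℝ} (hK : 0 ≤ K)
    (hN : ∀ x, (N *ᵥ x) ⬝ᵥ (N *ᵥ x) ≤ K ^ 2 * (x ⬝ᵥ x)) (x : Fin n → ℝ) :
    |x ⬝ᵥ (N *ᵥ x)| ≤ K * (x ⬝ᵥ x) := by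
  have h0 : 0 ≤ x ⬝ᵥ x := Finset.sum_nonneg fun i _ => mul_self_nonneg _
  refine abs_le_of_sq_le_sq ?_ (by positivity)
  have hcs : (x ⬝ᵥ (N *ᵥ x)) ^ 2 ≤ (x ⬝ᵥ x) * ((N *ᵥ x) ⬝ᵥ (N *ᵥ x)) := by
    have := Finset.sum_mul_sq_le_sq_mul_sq Finset.univ x (N *ᵥ x)
    simpa [dotProduct, sq] using this
  calc _ ≤ _ := hcs
    _ ≤ (x ⬝ᵥ x) * (K ^ 2 * (x ⬝ᵥ x)) := by gcongr; exact hN x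
    _ = _ := by ring

/-- One step of the iteration for a matrix that is close to a multiple of `η ηᵀ - 1`: the errors
that are not forced by weak coordinates are divided by `16`. -/
theorem errors_step {n : ℕ} (hn : 0 < n) {M N : Matrix (Fin n) (Fin n) ℝ} {η u : Fin n → ℝ}
    {s δ : ℝ} (hs : 0 < s) (hδ : 0 < δ) (hη : η ∈ labels n) (hu : u ∈ labels n)
    (hM : M = s • (Matrix.vecMulVec η η - 1) + N)
    (hN : ∀ x, (N *ᵥ x) ⬝ᵥ (N *ᵥ x) ≤ (δ / 16 * n * s) ^ 2 * (x ⬝ᵥ x))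
    (hm : (errors u η : ℝ) ≤ δ * n / 4) :
    (errors (signVec (M *ᵥ u)) η : ℝ) ≤ weakCount M η (δ * n * s) + errors u η / 16 := by
  classical
  set d := u - η with hd
  set m := (errors u η : ℝ) with hmdef
  have hn' : (0 : ℝ) < n := by exact_mod_cast hn
  have hq : 0 < δ * n * s := by positivity
  set A := Finset.univ.filter fun i => signVec (M *ᵥ u) i ≠ η i with hA
  set B := Finset.univ.filter fun i => η i * (M *ᵥ η) i ≤ δ * n * s with hB
  -- an error at a coordinate that is not weak forces `(N d) i` to be large
  have hpt : ∀ i ∈ A \ B, (δ * n * s / 2) ^ 2 ≤ (N *ᵥ d) i * (N *ᵥ d) i := by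
    intro i hi
    simp only [hA, hB, Finset.mem_sdiff, Finset.mem_filter, Finset.mem_univ, true_and,
      not_le] at hi
    have h1 := mul_nonpos_of_signVec_ne hη hi.1
    have hue : u = η + d := by rw [hd]; abel
    have h2 : (M *ᵥ d) i = s * (η i * (η ⬝ᵥ d) - d i) + (N *ᵥ d) i := by
      rw [hM]
      simp only [Matrix.add_mulVec, Matrix.smul_mulVec, Matrix.sub_mulVec, Matrix.one_mulVec,
        Pi.add_apply, Pi.smul_apply, Pi.sub_apply, smul_eq_mul, Matrix.vecMulVec_mulVec]
      simp
    have h3 : η i * (M *ᵥ u) i = η i * (M *ᵥ η) i + (s * (η ⬝ᵥ d - η i * d i) +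
        η i * (N *ᵥ d) i) := by
      rw [hue, Matrix.mulVec_add, Pi.add_apply, mul_add, h2]
      have := labels_sq hη i
      linear_combination s * (η ⬝ᵥ d) * this
    rw [hd, dot_sub hu hη, ← hd, ← hmdef] at h3
    have h4 : η i * d i ≤ 0 := by
      rw [hd, Pi.sub_apply]
      rcases hu i with h | h <;> rcases hη i with h' | h' <;> norm_num [h, h']
    have h5 : s * m ≤ s * (δ * n / 4) := by gcongr
    have h6 : s * (η i * d i) ≤ 0 := mul_nonpos_of_nonneg_of_nonpos hs.le h4
    have h7 : δ * n * s / 2 ≤ -(η i * (N *ᵥ d) i) := by linarith [hi.2]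
    have h8 : (δ * n * s / 2) ^ 2 ≤ (-(η i * (N *ᵥ d) i)) ^ 2 := by gcongr
    have h9 := labels_sq hη i
    calc _ ≤ _ := h8
      _ = _ := by linear_combination (N *ᵥ d) i * (N *ᵥ d) i * h9
  have hsum : ((A \ B).card : ℝ) * (δ * n * s / 2) ^ 2 ≤ (N *ᵥ d) ⬝ᵥ (N *ᵥ d) := by
    rw [← nsmul_eq_mul]
    refine (Finset.card_nsmul_le_sum _ _ _ hpt).trans ?_
    exact Finset.sum_le_sum_of_subset_of_nonneg (Finset.subset_univ _)
      fun i _ _ => mul_self_nonneg _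
  have h1 := hsum.trans (hN d)
  rw [hd, dot_sub_sub hu hη, ← hmdef] at h1
  have h2 : ((A \ B).card : ℝ) ≤ m / 16 := by
    have e : (δ / 16 * n * s) ^ 2 * (4 * m) = m / 16 * (δ * n * s / 2) ^ 2 := by ring
    rw [e] at h1
    exact le_of_mul_le_mul_right h1 (by positivity)
  have h3 : A.card ≤ B.card + (A \ B).card := by
    have := Finset.card_le_card_sdiff_add_card (s := A) (t := B)
    omega
  have h4 : (A.card : ℝ) ≤ B.card + (A \ B).card := by exact_mod_cast h3
  have e1 : errors (signVec (M *ᵥ u)) η = A.card := rfl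
  have e2 : weakCount M η (δ * n * s) = B.card := rfl
  rw [e1, e2]
  linarith

/-- Started close to the truth, the iteration converges geometrically up to twice the number of weak
coordinates. -/
theorem errors_iterate {n : ℕ} (hn : 0 < n) {M N : Matrix (Fin n) (Fin n) ℝ} {η : Fin n → ℝ}
    {u : ℕ → Fin n → ℝ} {s δ : ℝ} (hs : 0 < s) (hδ : 0 < δ) (hη : η ∈ labels n)
    (hu : ∀ k, u k ∈ labels n) (hM : M = s • (Matrix.vecMulVec η η - 1) + N)
    (hN : ∀ x, (N *ᵥ x) ⬝ᵥ (N *ᵥ x) ≤ (δ / 16 * n * s) ^ 2 * (x ⬝ᵥ x))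
    (hstep : ∀ k, u (k + 1) = signVec (M *ᵥ u k)) (h0 : (errors (u 0) η : ℝ) ≤ δ * n / 4)
    (hw : (weakCount M η (δ * n * s) : ℝ) ≤ δ * n / 8) (k : ℕ) :
    (errors (u k) η : ℝ) ≤ 2 * weakCount M η (δ * n * s) + n / 16 ^ k := by
  have hb : (0 : ℝ) ≤ weakCount M η (δ * n * s) := Nat.cast_nonneg _
  have hn' : (0 : ℝ) < n := by exact_mod_cast hn
  have hdn : 0 < δ * n := by positivity
  suffices h : (errors (u k) η : ℝ) ≤ δ * n / 4 ∧
      (errors (u k) η : ℝ) ≤ 2 * weakCount M η (δ * n * s) + n / 16 ^ k from h.2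
  induction k with
  | zero =>
    refine ⟨h0, ?_⟩
    have : (errors (u 0) η : ℝ) ≤ n := by exact_mod_cast errors_le _ _
    simp only [pow_zero, div_one]
    linarith
  | succ k ih =>
    have := errors_step hn hs hδ hη (hu k) hM hN ih.1
    rw [← hstep] at this
    refine ⟨by linarith [ih.1], this.trans ?_⟩
    have e : (n : ℝ) / 16 ^ (k + 1) = n / 16 ^ k / 16 := by rw [pow_succ]; field_simp
    rw [e]
    linarith [ih.2]

/-- The variational characterization of the largest eigenvalue. -/
theorem top_eigenvector_quadratic {n : ℕ} {M : Matrix (Fin n) (Fin n) ℝ} (hM : M.IsSymm)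
    {v : Fin n → ℝ} (hv : IsTopEigenvector M v) :
    ∃ μ : ℝ, M *ᵥ v = μ • v ∧ v ≠ 0 ∧ ∀ w, w ⬝ᵥ (M *ᵥ w) ≤ μ * (w ⬝ᵥ w) := by
  obtain ⟨μ, ⟨h1, h2⟩, h3⟩ := hv
  refine ⟨μ, by simpa using Module.End.mem_eigenspace_iff.1 h1, h2, fun w => ?_⟩
  rcases eq_or_ne w 0 with rfl | hw
  · simp
  have hnorm : ∀ x : Fin n → ℝ, x ≠ 0 →
      ((√(x ⬝ᵥ x))⁻¹ • x) ⬝ᵥ ((√(x ⬝ᵥ x))⁻¹ • x) = 1 := by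
    intro x hx
    have hp := dot_pos hx
    simp only [smul_dotProduct, dotProduct_smul, smul_eq_mul]
    rw [← mul_assoc, ← mul_inv, Real.mul_self_sqrt hp.le, inv_mul_cancel₀ hp.ne']
  have hq : Continuous fun v : Fin n → ℝ => v ⬝ᵥ (M *ᵥ v) :=
    Continuous.dotProduct continuous_id (Continuous.matrix_mulVec continuous_const continuous_id)
  obtain ⟨u, hu, hmax⟩ := (isCompact_dotSphere n).exists_isMaxOn ⟨_, hnorm w hw⟩ hq.continuousOn
  obtain ⟨μ', hμ', -⟩ := isTopEigenvector_of_max M hM u hu fun w hw => hmax hw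
  have hle := h3 μ' (Module.End.hasEigenvalue_of_hasEigenvector hμ')
  have e : M *ᵥ u = μ' • u := by simpa using Module.End.mem_eigenspace_iff.1 hμ'.1
  have h4 : ((√(w ⬝ᵥ w))⁻¹ • w) ⬝ᵥ (M *ᵥ ((√(w ⬝ᵥ w))⁻¹ • w)) ≤ u ⬝ᵥ (M *ᵥ u) :=
    hmax (hnorm w hw)
  have hp := dot_pos hw
  have hu' : u ⬝ᵥ u = 1 := hu
  rw [e, dotProduct_smul, hu', smul_eq_mul, mul_one] at h4
  simp only [smul_dotProduct, dotProduct_smul, smul_eq_mul, Matrix.mulVec_smul] at h4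
  rw [← mul_assoc, ← mul_inv, Real.mul_self_sqrt hp.le, inv_mul_le_iff₀ hp, mul_comm] at h4
  exact h4.trans (by gcongr)

/-- A top eigenvector of a matrix close to a multiple of `η ηᵀ - 1` has, up to a global sign, few
sign errors. -/
theorem errors_spectral {n : ℕ} (hn : 0 < n) {M N : Matrix (Fin n) (Fin n) ℝ} {η v : Fin n → ℝ}
    {s δ : ℝ} (hs : 0 < s) (hδ : 0 < δ) (hδ8 : δ ≤ 8) (hη : η ∈ labels n)
    (hM : M = s • (Matrix.vecMulVec η η - 1) + N) (hsymm : M.IsSymm)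
    (hN : ∀ x, (N *ᵥ x) ⬝ᵥ (N *ᵥ x) ≤ (δ / 16 * n * s) ^ 2 * (x ⬝ᵥ x))
    (hv : IsTopEigenvector M v) :
    (errors (signVec v) η : ℝ) ≤ δ * n / 4 ∨ (errors (signVec v) (-η) : ℝ) ≤ δ * n / 4 := by
  classical
  have hn' : (0 : ℝ) < n := by exact_mod_cast hn
  have hK : 0 ≤ δ / 16 * n * s := by positivity
  obtain ⟨μ, h1, h2, h3⟩ := top_eigenvector_quadratic hsymm hv
  set V := v ⬝ᵥ v with hV
  have hV0 : 0 < V := dot_pos h2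
  have hquad : ∀ x : Fin n → ℝ, x ⬝ᵥ (M *ᵥ x) = s * ((η ⬝ᵥ x) ^ 2 - x ⬝ᵥ x) + x ⬝ᵥ (N *ᵥ x) := by
    intro x
    rw [hM]
    simp only [Matrix.add_mulVec, Matrix.smul_mulVec, Matrix.sub_mulVec, Matrix.one_mulVec,
      Matrix.vecMulVec_mulVec, dotProduct_add, dotProduct_smul, dotProduct_sub, smul_eq_mul,
      op_smul_eq_smul, dotProduct_comm x η]
    ring
  have hη2 := h3 η
  have hvv : μ * V = v ⬝ᵥ (M *ᵥ v) := by rw [h1, dotProduct_smul, smul_eq_mul]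
  rw [hquad, labels_dot hη] at hη2
  rw [hquad, ← hV] at hvv
  have b1 := (abs_le.1 (abs_dot_mulVec_le hK hN η)).1
  have b2 := (abs_le.1 (abs_dot_mulVec_le hK hN v)).2
  rw [labels_dot hη] at b1
  rw [← hV] at b2
  set a := η ⬝ᵥ v with ha
  -- the Rayleigh quotient of `M` is at least as large at `v` as at `η`, so `v` is nearly parallel
  -- to `η`
  have hmain : V * n * (1 - δ / 8) ≤ a ^ 2 := by
    have c1 : s * ((n : ℝ) ^ 2 - n) - δ / 16 * n * s * n ≤ μ * n := by linarith
    have c2 : μ * V ≤ s * (a ^ 2 - V) + δ / 16 * n * s * V := by linarith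
    have c3 := mul_le_mul_of_nonneg_right c1 hV0.le
    have c4 := mul_le_mul_of_nonneg_right c2 hn'.le
    have c5 : s * n * (V * n * (1 - δ / 8)) ≤ s * n * a ^ 2 := by nlinarith
    exact le_of_mul_le_mul_left c5 (by positivity)
  -- `r` is the scale at which `r • η` has the norm of `v`; a sign error costs `r ^ 2` in the
  -- distance
  set r := √(V / n) with hr
  have hr2 : r ^ 2 = V / n := Real.sq_sqrt (by positivity)
  have hr0 : 0 < r := Real.sqrt_pos.2 (by positivity)
  have hra : V * (1 - δ / 8) ≤ r * |a| := by
    refine le_of_sq_le_sq ?_ (by positivity)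
    rw [mul_pow, mul_pow, hr2, sq_abs]
    have e : V / n * (V * n * (1 - δ / 8)) ≤ V / n * a ^ 2 := by gcongr
    have e' : V / n * (V * n * (1 - δ / 8)) = V ^ 2 * (1 - δ / 8) := by field_simp
    rw [e'] at e
    refine le_trans ?_ e
    have : (1 - δ / 8) ^ 2 ≤ 1 - δ / 8 := by nlinarith
    gcongr
  have key : ∀ η' : Fin n → ℝ, η' ∈ labels n → η' ⬝ᵥ v = |a| →
      (errors (signVec v) η' : ℝ) ≤ δ * n / 4 := by
    intro η' hη' hdot
    set A := Finset.univ.filter fun i => signVec v i ≠ η' i with hA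
    have hpt : ∀ i ∈ A, r ^ 2 ≤ (v i - r * η' i) ^ 2 := by
      intro i hi
      simp only [hA, Finset.mem_filter, Finset.mem_univ, true_and] at hi
      have q1 := mul_nonpos_of_signVec_ne hη' hi
      have q2 := labels_sq hη' i
      have q3 : (v i - r * η' i) ^ 2 = v i ^ 2 - 2 * r * (η' i * v i) + r ^ 2 := by
        linear_combination r ^ 2 * q2
      have q4 : 2 * r * (η' i * v i) ≤ 0 :=
        mul_nonpos_of_nonneg_of_nonpos (by positivity) q1
      rw [q3]
      nlinarith [sq_nonneg (v i)]
    have hsum : (A.card : ℝ) * r ^ 2 ≤ ∑ i, (v i - r * η' i) ^ 2 := by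
      rw [← nsmul_eq_mul]
      refine (Finset.card_nsmul_le_sum _ _ _ hpt).trans ?_
      exact Finset.sum_le_sum_of_subset_of_nonneg (Finset.subset_univ _)
        fun i _ _ => sq_nonneg _
    have hexp : ∑ i, (v i - r * η' i) ^ 2 = 2 * V - 2 * (r * |a|) := by
      have e1 : ∀ i, (v i - r * η' i) ^ 2 =
          v i * v i - 2 * r * (η' i * v i) + r ^ 2 * (η' i * η' i) := fun i => by ring
      simp_rw [e1]
      rw [Finset.sum_add_distrib, Finset.sum_sub_distrib, ← Finset.mul_sum, ← Finset.mul_sum]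
      change v ⬝ᵥ v - 2 * r * (η' ⬝ᵥ v) + r ^ 2 * (η' ⬝ᵥ η') = _
      rw [hdot, labels_dot hη', hr2, ← hV]
      field_simp
      ring
    rw [hexp, hr2] at hsum
    have h5 : (A.card : ℝ) * (V / n) ≤ δ * n / 4 * (V / n) := by
      have : δ * n / 4 * (V / n) = V * δ / 4 := by field_simp
      rw [this]; linarith
    exact le_of_mul_le_mul_right h5 (by positivity)
  rcases le_total 0 a with h | h
  · exact Or.inl (key η hη (by rw [abs_of_nonneg h]))
  · exact Or.inr (key (-η) (neg_mem_labels hη) (by rw [neg_dotProduct, abs_of_nonpos h]))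

theorem weakCount_neg {n : ℕ} (M : Matrix (Fin n) (Fin n) ℝ) (η : Fin n → ℝ) (τ : ℝ) :
    weakCount M (-η) τ = weakCount M η τ := by
  simp [weakCount, Matrix.mulVec_neg]

/-- Deterministic bound for the loss of the iterates started at a top eigenvector of a matrix close
to a multiple of `η ηᵀ - 1`. The number of weak coordinates is not assumed to be small. -/
theorem loss_iterate_le {n : ℕ} (hn : 0 < n) {M N : Matrix (Fin n) (Fin n) ℝ} {η v : Fin n → ℝ}
    {u : ℕ → Fin n → ℝ} {s δ : ℝ} (hs : 0 < s) (hδ : 0 < δ) (hδ8 : δ ≤ 8) (hη : η ∈ labels n)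
    (hM : M = s • (Matrix.vecMulVec η η - 1) + N) (hsymm : M.IsSymm)
    (hN : ∀ x, (N *ᵥ x) ⬝ᵥ (N *ᵥ x) ≤ (δ / 16 * n * s) ^ 2 * (x ⬝ᵥ x))
    (hv : IsTopEigenvector M v) (h0 : u 0 = signVec v)
    (hstep : ∀ k, u (k + 1) = signVec (M *ᵥ u k)) (k : ℕ) :
    loss (u k) η ≤ (4 + 16 / δ) * weakCount M η (δ * n * s) + 2 * n / 16 ^ k := by
  have hu : ∀ k, u k ∈ labels n := by
    intro k
    cases k with
    | zero => rw [h0]; exact signVec_mem_labels v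
    | succ k => rw [hstep]; exact signVec_mem_labels _
  have hn' : (0 : ℝ) < n := by exact_mod_cast hn
  set b := (weakCount M η (δ * n * s) : ℝ) with hb
  have hb0 : 0 ≤ b := Nat.cast_nonneg _
  by_cases hw : b ≤ δ * n / 8
  · have h16 : 0 ≤ 16 / δ * b := by positivity
    rcases errors_spectral hn hs hδ hδ8 hη hM hsymm hN hv with h | h
    · have h1 := errors_iterate hn hs hδ hη hu hM hN hstep (by rwa [h0]) hw k
      have h2 := loss_le_errors (hu k) hη
      rw [mul_div_assoc]
      linarith
    · have hM' : M = s • (Matrix.vecMulVec (-η) (-η) - 1) + N := by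
        rw [hM]; simp [Matrix.vecMulVec_neg, Matrix.neg_vecMulVec]
      have h1 := errors_iterate hn hs hδ (neg_mem_labels hη) hu hM' hN hstep (by rwa [h0])
        (by rwa [weakCount_neg]) k
      have h2 := loss_le_errors (hu k) (neg_mem_labels hη)
      rw [loss_neg] at h2
      rw [weakCount_neg] at h1
      rw [mul_div_assoc]
      linarith
  -- with more than `δ n / 8` weak coordinates, the trivial bound `2 n` for the loss is enough
  · have h1 := loss_le (hu k) hη
    have h2 : 2 * (n : ℝ) ≤ 16 / δ * b := by
      rw [div_mul_eq_mul_div, le_div_iff₀ hδ]; linarith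
    have h3 : (0 : ℝ) ≤ 2 * n / 16 ^ k := by positivity
    linarith

/-! ### The operator norm of the noise -/

/-- The unit ball of `ℝ^n` has a `1/2`-net with at most `5^n` elements. -/
theorem exists_net (n : ℕ) : ∃ s : Finset (EuclideanSpace ℝ (Fin n)), s.card ≤ 5 ^ n ∧
    (∀ c ∈ s, ‖c‖ ≤ 1) ∧ ∀ x : EuclideanSpace ℝ (Fin n), ‖x‖ ≤ 1 → ∃ y ∈ s, ‖x - y‖ ≤ 1 / 2 := by
  classical
  -- a maximal `1`-separated subset of the ball of radius `2`, shrunk by the factor `2`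
  let good : Finset (EuclideanSpace ℝ (Fin n)) → Prop := fun t =>
    (∀ c ∈ t, ‖c‖ ≤ 2) ∧ ∀ c ∈ t, ∀ d ∈ t, c ≠ d → 1 ≤ ‖c - d‖
  have hbound : ∀ t, good t → t.card ≤ 5 ^ n := fun t ht => by
    simpa using Besicovitch.card_le_of_separated t ht.1 ht.2
  let P : ℕ → Prop := fun k => ∃ t, good t ∧ t.card = k
  have hP0 : P 0 := ⟨∅, ⟨by simp, by simp⟩, rfl⟩
  obtain ⟨t, ht, htc⟩ := Nat.findGreatest_spec (P := P) (Nat.zero_le (5 ^ n)) hP0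
  have hmax : ∀ t', good t' → t'.card ≤ t.card := fun t' ht' =>
    htc ▸ Nat.le_findGreatest (P := P) (hbound t' ht') ⟨t', ht', rfl⟩
  have hcov : ∀ x : EuclideanSpace ℝ (Fin n), ‖x‖ ≤ 2 → ∃ y ∈ t, ‖x - y‖ < 1 := by
    intro x hx
    by_contra! hcon
    have hxt : x ∉ t := fun h => by
      have := hcon x h
      simp at this
      linarith
    have hg : good (insert x t) := by
      refine ⟨fun c hc => ?_, fun c hc d hd hcd => ?_⟩
      · rcases Finset.mem_insert.1 hc with rfl | h
        exacts [hx, ht.1 c h]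
      · rcases Finset.mem_insert.1 hc with rfl | h <;> rcases Finset.mem_insert.1 hd with rfl | h'
        · exact absurd rfl hcd
        · exact hcon d h'
        · rw [norm_sub_rev]; exact hcon c h
        · exact ht.2 c h d h' hcd
    have := hmax _ hg
    rw [Finset.card_insert_of_notMem hxt] at this
    omega
  refine ⟨t.image fun c => (1 / 2 : ℝ) • c, Finset.card_image_le.trans (hbound t ht), ?_, ?_⟩
  · intro c hc
    obtain ⟨d, hd, rfl⟩ := Finset.mem_image.1 hc
    rw [norm_smul]
    have := ht.1 d hd
    norm_num
    linarith
  · intro x hx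
    obtain ⟨y, hy, hxy⟩ := hcov ((2 : ℝ) • x) (by rw [norm_smul]; norm_num; linarith)
    refine ⟨(1 / 2 : ℝ) • y, Finset.mem_image_of_mem _ hy, ?_⟩
    have : x - (1 / 2 : ℝ) • y = (1 / 2 : ℝ) • ((2 : ℝ) • x - y) := by
      rw [smul_sub, smul_smul]; norm_num
    rw [this, norm_smul]
    norm_num
    linarith

/-- The operator norm is controlled by the bilinear form on a `1/2`-net. -/
theorem opNorm_le_of_net {n : ℕ} {s : Finset (EuclideanSpace ℝ (Fin n))}
    (hs : ∀ x : EuclideanSpace ℝ (Fin n), ‖x‖ ≤ 1 → ∃ y ∈ s, ‖x - y‖ ≤ 1 / 2)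
    (A : EuclideanSpace ℝ (Fin n) →L[ℝ] EuclideanSpace ℝ (Fin n)) {K : ℝ} (hK : 0 ≤ K)
    (h : ∀ x ∈ s, ∀ y ∈ s, inner ℝ y (A x) ≤ K) : ‖A‖ ≤ 4 * K := by
  have h1 : ∀ x ∈ s, ‖A x‖ ≤ 2 * K := by
    intro x hx
    rcases eq_or_ne (A x) 0 with h0 | h0
    · rw [h0, norm_zero]; positivity
    have hz : 0 < ‖A x‖ := norm_pos_iff.2 h0
    obtain ⟨y, hy, hxy⟩ := hs (‖A x‖⁻¹ • A x) (by rw [norm_smul]; simp [hz.ne'])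
    have e : inner ℝ y (A x) = ‖A x‖ - inner ℝ (‖A x‖⁻¹ • A x - y) (A x) := by
      rw [inner_sub_left, real_inner_smul_left, real_inner_self_eq_norm_sq]
      field_simp
      ring
    have h2 := real_inner_le_norm (‖A x‖⁻¹ • A x - y) (A x)
    have h3 : ‖‖A x‖⁻¹ • A x - y‖ * ‖A x‖ ≤ 1 / 2 * ‖A x‖ := by gcongr
    have := h x hx y hy
    linarith
  have h2 : ‖A‖ ≤ 2 * K + ‖A‖ / 2 := by
    refine ContinuousLinearMap.opNorm_le_of_unit_norm (by positivity) fun x hx => ?_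
    obtain ⟨y, hy, hxy⟩ := hs x hx.le
    have e : A x = A y + A (x - y) := by rw [← map_add]; congr 1; abel
    rw [e]
    refine (norm_add_le _ _).trans (add_le_add (h1 y hy) ?_)
    calc ‖A (x - y)‖ ≤ ‖A‖ * ‖x - y‖ := A.le_opNorm _
      _ ≤ ‖A‖ * (1 / 2) := by gcongr
      _ = _ := by ring
  linarith

open scoped Matrix.Norms.L2Operator in
/-- The diagonal of a matrix has operator norm at most that of the matrix. -/
theorem norm_hollow_le {n : ℕ} (A : Matrix (Fin n) (Fin n) ℝ) : ‖hollow A‖ ≤ 2 * ‖A‖ := by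
  have h1 : ‖A.diag‖ ≤ ‖A‖ := by
    rw [pi_norm_le_iff_of_nonneg (norm_nonneg _)]
    intro i
    have h := A.l2_opNorm_mulVec (EuclideanSpace.single i (1 : ℝ))
    rw [PiLp.norm_single, norm_one, mul_one] at h
    refine le_trans ?_ h
    refine le_trans (le_of_eq ?_) (PiLp.norm_apply_le _ i)
    simp [Matrix.diag]
  calc ‖hollow A‖ ≤ ‖A‖ + ‖Matrix.diagonal A.diag‖ := norm_sub_le _ _
    _ ≤ 2 * ‖A‖ := by rw [Matrix.l2_opNorm_diagonal]; linarith

/-- The factor `8` is `4` for the passage to the net times `2` for the removal of the diagonal. -/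
theorem hollow_mulVec_sq_le {n : ℕ} {s : Finset (EuclideanSpace ℝ (Fin n))}
    (hs : ∀ x : EuclideanSpace ℝ (Fin n), ‖x‖ ≤ 1 → ∃ y ∈ s, ‖x - y‖ ≤ 1 / 2)
    (A : Matrix (Fin n) (Fin n) ℝ) {K : ℝ} (hK : 0 ≤ K)
    (h : ∀ x ∈ s, ∀ y ∈ s, (y : Fin n → ℝ) ⬝ᵥ (A *ᵥ x) ≤ K) (x : Fin n → ℝ) :
    (hollow A *ᵥ x) ⬝ᵥ (hollow A *ᵥ x) ≤ (8 * K) ^ 2 * (x ⬝ᵥ x) := by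
  open scoped Matrix.Norms.L2Operator in
  have h1 : ‖A‖ ≤ 4 * K := by
    rw [Matrix.cstar_norm_def]
    refine opNorm_le_of_net hs _ hK fun x hx y hy => ?_
    have := h x hx y hy
    rw [Matrix.inner_toEuclideanCLM]
    simpa using this
  open scoped Matrix.Norms.L2Operator in
  have h2 : ‖hollow A‖ ≤ 8 * K := (norm_hollow_le A).trans (by linarith)
  open scoped Matrix.Norms.L2Operator in
  have h3 := (hollow A).l2_opNorm_mulVec (WithLp.toLp 2 x)
  have e : ∀ z : Fin n → ℝ, z ⬝ᵥ z = ‖WithLp.toLp 2 z‖ ^ 2 := by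
    intro z
    rw [EuclideanSpace.real_norm_sq_eq]
    simp [dotProduct, sq]
  rw [e, e, ← mul_pow]
  gcongr
  refine le_trans (le_of_eq ?_) (h3.trans (by gcongr))
  simp

theorem noise_sum_smul {n p : ℕ} (v : EuclideanSpace ℝ (Fin n))
    {S : Set (EuclideanSpace ℝ (Fin p))} (hS : MeasurableSet S) :
    noise n p {ξ | ∑ i, v i • ξ i ∈ S} = gauss p {z | ‖v‖ • z ∈ S} := by
  have h := map_sum_smul_pi_gauss (p := p) (fun i => v i) ‖v‖ (EuclideanSpace.real_norm_sq_eq v)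
  have h1 : Measurable fun ξ : Sample n p => ∑ i, v i • ξ i := by fun_prop
  have h2 : Measurable fun z : EuclideanSpace ℝ (Fin p) => ‖v‖ • z := by fun_prop
  have h3 := congrArg (fun μ => μ S) h
  simp only at h3
  rwa [Measure.map_apply h1 hS, Measure.map_apply h2 hS] at h3

theorem noise_normSq_le {n p : ℕ} (hn : 1 ≤ n) (v : EuclideanSpace ℝ (Fin n)) :
    noise n p {ξ | 20 * (√(p * n) + n) * ‖v‖ ^ 2 < |‖∑ i, v i • ξ i‖ ^ 2 - p * ‖v‖ ^ 2|} ≤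
      ENNReal.ofReal (2 * Real.exp (-(39 / 8 * n))) := by
  refine le_trans (le_of_eq (noise_sum_smul v (S := {w | 20 * (√(p * n) + n) * ‖v‖ ^ 2 <
    |‖w‖ ^ 2 - p * ‖v‖ ^ 2|}) (measurableSet_lt (by fun_prop) (by fun_prop)))) ?_
  refine le_trans (measure_mono fun z hz => ?_) (gauss_abs_normSq_sub_ge_le hn)
  simp only [Set.mem_ofPred_eq, norm_smul, norm_norm] at hz ⊢
  have e : (‖v‖ * ‖z‖) ^ 2 - p * ‖v‖ ^ 2 = (‖z‖ ^ 2 - p) * ‖v‖ ^ 2 := by ring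
  rw [e, abs_mul, abs_of_nonneg (sq_nonneg ‖v‖)] at hz
  exact (lt_of_mul_lt_mul_right hz (sq_nonneg _)).le

theorem noise_inner_le {n p : ℕ} (v : EuclideanSpace ℝ (Fin n)) (hv : ‖v‖ ≤ 1)
    (θ : EuclideanSpace ℝ (Fin p)) :
    noise n p {ξ | 3 * √n * ‖θ‖ < inner ℝ θ (∑ i, v i • ξ i)} ≤
      ENNReal.ofReal (Real.exp (-(9 / 2 * n))) := by
  refine le_trans (le_of_eq (noise_sum_smul v (S := {w | 3 * √n * ‖θ‖ < inner ℝ θ w})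
    (measurableSet_lt (by fun_prop) (by fun_prop)))) ?_
  have hu : ‖(‖v‖ * ‖θ‖⁻¹) • θ‖ ≤ 1 := by
    rw [norm_smul, norm_mul, norm_norm, norm_inv, norm_norm, mul_assoc]
    calc ‖v‖ * (‖θ‖⁻¹ * ‖θ‖) ≤ 1 * 1 := by
          gcongr
          exact inv_mul_le_one
      _ = 1 := one_mul 1
  refine le_trans (measure_mono fun z hz => ?_)
    ((gauss_inner_ge_le hu (t := 3 * √n) (by positivity)).trans
      (ENNReal.ofReal_le_ofReal (le_of_eq ?_)))
  · simp only [Set.mem_ofPred_eq, real_inner_smul_left, real_inner_smul_right] at hz ⊢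
    have hθ : 0 < ‖θ‖ := by
      rw [norm_pos_iff]; rintro rfl; simp at hz
    rw [← lt_div_iff₀ hθ] at hz
    refine hz.le.trans (le_of_eq ?_)
    field_simp
  · rw [mul_pow, Real.sq_sqrt (Nat.cast_nonneg n)]
    congr 1; ring

theorem hollowGram_apply {n p : ℕ} (Y : Sample n p) :
    hollowGram Y = hollow (Matrix.of fun i j => inner ℝ (Y i) (Y j)) := by
  unfold hollowGram
  congr 1
  ext i j
  simp [Matrix.mul_apply, dataMatrix, PiLp.inner_apply, mul_comm]

/-- With the tails `exp (-(9 / 2) n)` of the events below, this makes a union bound over `25 ^ n`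
pairs of points of the net of the order `exp (-n)`. -/
theorem twentyFive_le_exp : (25 : ℝ) ≤ Real.exp (7 / 2) := by
  have h := Real.exp_one_gt_d9
  have e : Real.exp (7 / 2) = Real.exp 1 ^ 3 * Real.exp (1 / 2) := by
    rw [← Real.exp_nat_mul, ← Real.exp_add]; norm_num
  have h2 := Real.add_one_le_exp (1 / 2 : ℝ)
  rw [e]
  calc (25 : ℝ) ≤ 2.7 ^ 3 * (1 / 2 + 1) := by norm_num
    _ ≤ _ := by gcongr; linarith

/-- Outside an event of exponentially small probability, the hollowed Gram matrix is
`‖θ‖² (η ηᵀ - 1)` up to an error of operator norm at most `48 n ‖θ‖ + 160 (√(p n) + n)`. -/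
theorem exists_noise_event {n p : ℕ} (hn : 1 ≤ n) (θ : EuclideanSpace ℝ (Fin p)) :
    ∃ B : Set (Sample n p), noise n p B ≤ ENNReal.ofReal (6 * Real.exp (-n)) ∧
      ∀ ξ ∉ B, ∀ η ∈ labels n, ∃ N : Matrix (Fin n) (Fin n) ℝ,
        hollowGram (fun i => η i • θ + ξ i) = ‖θ‖ ^ 2 • (Matrix.vecMulVec η η - 1) + N ∧
        ∀ x, (N *ᵥ x) ⬝ᵥ (N *ᵥ x) ≤
          (48 * n * ‖θ‖ + 160 * (√(p * n) + n)) ^ 2 * (x ⬝ᵥ x) := by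
  classical
  obtain ⟨s, hcard, hs1, hs⟩ := exists_net n
  set τ : ℝ := 20 * (√(p * n) + n) with hτ
  have hτ0 : 0 ≤ τ := by positivity
  -- `B1` controls the cross terms between signal and noise, `B2` the Gram matrix of the noise
  let B1 : EuclideanSpace ℝ (Fin n) → Set (Sample n p) := fun v =>
    {ξ | 3 * √n * ‖θ‖ < inner ℝ θ (∑ i, v i • ξ i)}
  let B2 : EuclideanSpace ℝ (Fin n) → Set (Sample n p) := fun v =>
    {ξ | τ * ‖v‖ ^ 2 < |‖∑ i, v i • ξ i‖ ^ 2 - p * ‖v‖ ^ 2|}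
  refine ⟨(⋃ x ∈ s, (B1 x ∪ B1 (-x))) ∪ ⋃ q ∈ s ×ˢ s, (B2 (q.1 + q.2) ∪ B2 (q.1 - q.2)), ?_, ?_⟩
  · have hexp : ∀ c : ℝ, 9 / 2 ≤ c → (25 : ℝ) ^ n * Real.exp (-(c * n)) ≤ Real.exp (-n) := by
      intro c hc
      calc (25 : ℝ) ^ n * Real.exp (-(c * n)) ≤ Real.exp (7 / 2) ^ n * Real.exp (-(c * n)) := by
            gcongr; exact twentyFive_le_exp
        _ = Real.exp (n * (7 / 2) + -(c * n)) := by rw [← Real.exp_nat_mul, Real.exp_add]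
        _ ≤ Real.exp (-n) := by
            gcongr
            have : (9 / 2 : ℝ) * n ≤ c * n := by gcongr
            linarith
    have h1 : noise n p (⋃ x ∈ s, (B1 x ∪ B1 (-x))) ≤ ENNReal.ofReal (2 * Real.exp (-n)) := by
      refine (measure_biUnion_finset_le _ _).trans ?_
      have hb : ∀ x ∈ s, noise n p (B1 x ∪ B1 (-x)) ≤
          ENNReal.ofReal (2 * Real.exp (-(9 / 2 * n))) := by
        intro x hx
        refine (measure_union_le _ _).trans ?_
        rw [two_mul, ENNReal.ofReal_add (Real.exp_pos _).le (Real.exp_pos _).le]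
        exact add_le_add (noise_inner_le x (hs1 x hx) θ)
          (noise_inner_le (-x) (by rw [norm_neg]; exact hs1 x hx) θ)
      refine (Finset.sum_le_card_nsmul _ _ _ hb).trans ?_
      rw [nsmul_eq_mul, ← ENNReal.ofReal_natCast, ← ENNReal.ofReal_mul (Nat.cast_nonneg _)]
      refine ENNReal.ofReal_le_ofReal ?_
      have hc : (s.card : ℝ) ≤ 25 ^ n := by
        have : (s.card : ℝ) ≤ 5 ^ n := by exact_mod_cast hcard
        exact this.trans (by gcongr; norm_num)
      calc _ ≤ (25 : ℝ) ^ n * (2 * Real.exp (-(9 / 2 * n))) := by gcongr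
        _ = 2 * (25 ^ n * Real.exp (-(9 / 2 * n))) := by ring
        _ ≤ _ := by gcongr; exact hexp _ le_rfl
    have h2 : noise n p (⋃ q ∈ s ×ˢ s, (B2 (q.1 + q.2) ∪ B2 (q.1 - q.2))) ≤
        ENNReal.ofReal (4 * Real.exp (-n)) := by
      refine (measure_biUnion_finset_le _ _).trans ?_
      have hb : ∀ q ∈ s ×ˢ s, noise n p (B2 (q.1 + q.2) ∪ B2 (q.1 - q.2)) ≤
          ENNReal.ofReal (4 * Real.exp (-(39 / 8 * n))) := by
        intro q _
        refine (measure_union_le _ _).trans ?_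
        rw [show (4 : ℝ) * Real.exp (-(39 / 8 * n)) = 2 * Real.exp (-(39 / 8 * n)) +
          2 * Real.exp (-(39 / 8 * n)) by ring, ENNReal.ofReal_add (by positivity) (by positivity)]
        exact add_le_add (noise_normSq_le hn _) (noise_normSq_le hn _)
      refine (Finset.sum_le_card_nsmul _ _ _ hb).trans ?_
      rw [nsmul_eq_mul, ← ENNReal.ofReal_natCast, ← ENNReal.ofReal_mul (Nat.cast_nonneg _)]
      refine ENNReal.ofReal_le_ofReal ?_
      have hc : ((s ×ˢ s).card : ℝ) ≤ 25 ^ n := by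
        have : (s.card : ℝ) ≤ 5 ^ n := by exact_mod_cast hcard
        rw [Finset.card_product, Nat.cast_mul]
        calc _ ≤ (5 : ℝ) ^ n * 5 ^ n := by gcongr
          _ = 25 ^ n := by rw [← mul_pow]; norm_num
      calc _ ≤ (25 : ℝ) ^ n * (4 * Real.exp (-(39 / 8 * n))) := by gcongr
        _ = 4 * (25 ^ n * Real.exp (-(39 / 8 * n))) := by ring
        _ ≤ _ := by gcongr; exact hexp _ (by norm_num)
    refine (measure_union_le _ _).trans ((add_le_add h1 h2).trans (le_of_eq ?_))
    rw [← ENNReal.ofReal_add (by positivity) (by positivity)]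
    congr 1; ring
  · intro ξ hξ η hη
    simp only [Set.mem_union, Set.mem_iUnion, not_or, not_exists, exists_prop, not_and,
      Finset.mem_product, and_imp, Prod.forall] at hξ
    obtain ⟨hξ1, hξ2⟩ := hξ
    set g : Fin n → ℝ := fun i => inner ℝ θ (ξ i) with hg
    -- removing the diagonal makes the subtraction of the mean `p • 1` of the Gram matrix harmless
    set A : Matrix (Fin n) (Fin n) ℝ := Matrix.vecMulVec η g + Matrix.vecMulVec g η +
      (Matrix.of (fun i j => inner ℝ (ξ i) (ξ j)) - (p : ℝ) • 1) with hA
    refine ⟨hollow A, ?_, ?_⟩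
    · rw [hollowGram_apply]
      ext i j
      simp only [hollow, hA, Matrix.sub_apply, Matrix.add_apply, Matrix.smul_apply,
        Matrix.vecMulVec_apply, Matrix.diagonal_apply, Matrix.of_apply, Matrix.diag_apply,
        Matrix.one_apply, smul_eq_mul, hg]
      by_cases hij : i = j
      · subst hij
        simp [labels_sq hη]
      · simp only [hij, if_false, inner_add_left, inner_add_right, real_inner_smul_left,
          real_inner_smul_right, real_inner_self_eq_norm_sq, real_inner_comm θ (ξ i)]
        ring
    · have hK : 0 ≤ 6 * n * ‖θ‖ + τ := by positivity
      have hgx : ∀ x ∈ s, |g ⬝ᵥ x| ≤ 3 * √n * ‖θ‖ := by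
        intro x hx
        have h := hξ1 x hx
        simp only [B1, Set.mem_ofPred_eq, not_lt] at h
        have e : inner ℝ θ (∑ i, x i • ξ i) = g ⬝ᵥ x := by
          simp [inner_sum, real_inner_smul_right, dotProduct, hg, mul_comm]
        have e' : inner ℝ θ (∑ i, (-x) i • ξ i) = -(g ⬝ᵥ x) := by
          simp [inner_sum, real_inner_smul_right, dotProduct, hg, mul_comm]
        rw [e, e'] at h
        exact abs_le.2 ⟨by linarith [h.2], h.1⟩
      have hηx : ∀ x ∈ s, |η ⬝ᵥ x| ≤ √n := by
        intro x hx
        refine Real.abs_le_sqrt ?_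
        have := Finset.sum_mul_sq_le_sq_mul_sq Finset.univ η x
        rw [← EuclideanSpace.real_norm_sq_eq x] at this
        have e : ∑ i, η i ^ 2 = n := by rw [← labels_dot hη]; simp [dotProduct, sq]
        rw [e] at this
        refine this.trans ?_
        have h1 : ‖x‖ ^ 2 ≤ 1 := pow_le_one₀ (norm_nonneg _) (hs1 x hx)
        nlinarith [(Nat.cast_nonneg n : (0 : ℝ) ≤ n)]
      have hbil : ∀ x ∈ s, ∀ y ∈ s, (y : Fin n → ℝ) ⬝ᵥ (A *ᵥ x) ≤ 6 * n * ‖θ‖ + τ := by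
        intro x hx y hy
        have e1 : (y : Fin n → ℝ) ⬝ᵥ (A *ᵥ x) = (η ⬝ᵥ y) * (g ⬝ᵥ x) + (g ⬝ᵥ y) * (η ⬝ᵥ x) +
            (inner ℝ (∑ i, y i • ξ i) (∑ i, x i • ξ i) - p * inner ℝ y x) := by
          have e2 : inner ℝ (∑ i, y i • ξ i) (∑ i, x i • ξ i) =
              (y : Fin n → ℝ) ⬝ᵥ (Matrix.of (fun i j => inner ℝ (ξ i) (ξ j)) *ᵥ x) := by
            simp only [sum_inner, inner_sum, real_inner_smul_left, real_inner_smul_right,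
              dotProduct, Matrix.mulVec, Matrix.of_apply, Finset.mul_sum]
            rw [Finset.sum_comm]
            refine Finset.sum_congr rfl fun i _ => Finset.sum_congr rfl fun j _ => ?_
            ring
          have e3 : inner ℝ y x = (y : Fin n → ℝ) ⬝ᵥ x := by
            simp [PiLp.inner_apply, dotProduct, mul_comm]
          rw [e2, e3, hA]
          simp only [Matrix.add_mulVec, Matrix.sub_mulVec, Matrix.smul_mulVec, Matrix.one_mulVec,
            Matrix.vecMulVec_mulVec, dotProduct_add, dotProduct_smul, dotProduct_sub, smul_eq_mul,
            op_smul_eq_smul, dotProduct_comm (y : Fin n → ℝ) η, dotProduct_comm (y : Fin n → ℝ) g]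
          ring
        have h := hξ2 x y hx hy
        simp only [B2, Set.mem_ofPred_eq, not_lt] at h
        obtain ⟨ha, hb⟩ := h
        set X := ∑ i, x i • ξ i with hX
        set Z := ∑ i, y i • ξ i with hZ
        have ea : ∑ i, (x + y) i • ξ i = X + Z := by
          simp [hX, hZ, add_smul, Finset.sum_add_distrib]
        have eb : ∑ i, (x - y) i • ξ i = X - Z := by
          simp [hX, hZ, sub_smul, Finset.sum_sub_distrib]
        rw [ea] at ha
        rw [eb] at hb
        have ha' := (abs_le.1 ha).2
        have hb' := (abs_le.1 hb).1
        have n1 := norm_add_sq_real X Z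
        have n2 := norm_sub_sq_real X Z
        have n3 := norm_add_sq_real x y
        have n4 := norm_sub_sq_real x y
        have h1 : ‖x‖ ^ 2 ≤ 1 := pow_le_one₀ (norm_nonneg _) (hs1 x hx)
        have h2 : ‖y‖ ^ 2 ≤ 1 := pow_le_one₀ (norm_nonneg _) (hs1 y hy)
        -- polarization, with `‖x + y‖² + ‖x - y‖² ≤ 4`
        have hq : inner ℝ Z X - p * inner ℝ y x ≤ τ := by
          have h3 : τ * ‖x + y‖ ^ 2 + τ * ‖x - y‖ ^ 2 ≤ τ * 4 := by
            rw [← mul_add]; gcongr; linarith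
          rw [real_inner_comm X Z, real_inner_comm x y]
          rw [n1, n3] at ha'
          rw [n2, n4] at hb'
          rw [n3, n4] at h3
          linarith
        have hsq : √(n : ℝ) * √n = n := Real.mul_self_sqrt (Nat.cast_nonneg n)
        have p1 : (η ⬝ᵥ y) * (g ⬝ᵥ x) ≤ √n * (3 * √n * ‖θ‖) := by
          refine (le_abs_self _).trans ?_
          rw [abs_mul]
          have := hηx y hy
          have := hgx x hx
          gcongr
        have p2 : (g ⬝ᵥ y) * (η ⬝ᵥ x) ≤ (3 * √n * ‖θ‖) * √n := by
          refine (le_abs_self _).trans ?_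
          rw [abs_mul]
          have := hηx x hx
          have := hgx y hy
          gcongr
        have e5 : √(n : ℝ) * (3 * √n * ‖θ‖) = 3 * n * ‖θ‖ := by
          linear_combination 3 * ‖θ‖ * hsq
        have e6 : (3 * √(n : ℝ) * ‖θ‖) * √n = 3 * n * ‖θ‖ := by
          linear_combination 3 * ‖θ‖ * hsq
        rw [e1]
        linarith
      intro x
      have := hollow_mulVec_sq_le hs A hK hbil x
      refine this.trans (le_of_eq ?_)
      rw [hτ]; ring

/-! ### The oracle statistic and the risk of the iterates -/

/-- The oracle statistic at coordinate `i`: an inner product of two independent Gaussian vectors,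
with means `θ` and `m θ`. -/
theorem oracle_eq {m p : ℕ} (θ : EuclideanSpace ℝ (Fin p)) {η : Fin (m + 1) → ℝ}
    (hη : η ∈ labels _) (ξ : Sample (m + 1) p) (i : Fin (m + 1)) :
    η i * (hollowGram (fun i => η i • θ + ξ i) *ᵥ η) i =
      inner ℝ (θ + η i • ξ i)
        ((m : ℝ) • θ + ∑ j, η (i.succAbove j) • ξ (i.succAbove j)) := by
  have h1 : (hollowGram (fun i => η i • θ + ξ i) *ᵥ η) i =
      inner ℝ (η i • θ + ξ i)
        (∑ j, η (i.succAbove j) • (η (i.succAbove j) • θ + ξ (i.succAbove j))) := by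
    rw [hollowGram_apply, Matrix.mulVec, dotProduct, Fin.sum_univ_succAbove _ i, inner_sum]
    have h0 : ∀ A : Matrix (Fin (m + 1)) (Fin (m + 1)) ℝ, hollow A i i = 0 := fun A => by
      simp [hollow]
    rw [h0, zero_mul, zero_add]
    refine Finset.sum_congr rfl fun j _ => ?_
    have hne : i ≠ i.succAbove j := (Fin.succAbove_ne i j).symm
    rw [real_inner_smul_right]
    simp [hollow, hne, mul_comm]
  have h2 : ∑ j, η (i.succAbove j) • (η (i.succAbove j) • θ + ξ (i.succAbove j)) =
      (m : ℝ) • θ + ∑ j, η (i.succAbove j) • ξ (i.succAbove j) := by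
    simp_rw [smul_add, smul_smul, labels_sq hη, one_smul]
    rw [Finset.sum_add_distrib]
    simp [Nat.cast_smul_eq_nsmul]
  rw [h1, h2, ← real_inner_smul_left, smul_add, smul_smul, labels_sq hη, one_smul]

/-- The Laplace transform of the oracle statistic. -/
theorem lintegral_exp_oracle {m p : ℕ} (θ : EuclideanSpace ℝ (Fin p)) {η : Fin (m + 1) → ℝ}
    (hη : η ∈ labels _) (i : Fin (m + 1)) (l τ : ℝ) (hl : l ^ 2 * m < 1) :
    ∫⁻ ξ, ENNReal.ofReal (Real.exp (l * (τ - η i *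
        (hollowGram (fun i => η i • θ + ξ i) *ᵥ η) i))) ∂(noise (m + 1) p) =
      ENNReal.ofReal (Real.exp (l * τ - l * m * ‖θ‖ ^ 2 + (l * m) ^ 2 * ‖θ‖ ^ 2 / 2) *
        ((√(1 - l ^ 2 * m))⁻¹ ^ p *
          Real.exp (((l ^ 2 * m - l) ^ 2 * m * ‖θ‖ ^ 2) / (2 * (1 - l ^ 2 * m))))) := by
  have hsq : √(m : ℝ) ^ 2 = m := Real.sq_sqrt (Nat.cast_nonneg m)
  simp_rw [oracle_eq θ hη]
  rw [lintegral_noise_split i hη (fun y s => ENNReal.ofReal (Real.exp (l * (τ -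
    inner ℝ (θ + η i • y) ((m : ℝ) • θ + s))))) (by fun_prop)]
  have hin : ∀ z : EuclideanSpace ℝ (Fin p),
      ∫⁻ y, ENNReal.ofReal (Real.exp (l * (τ - inner ℝ (θ + η i • y) ((m : ℝ) • θ + √m • z))))
        ∂(gauss p) =
      ENNReal.ofReal (Real.exp (l * τ - l * m * ‖θ‖ ^ 2 + (l * m) ^ 2 * ‖θ‖ ^ 2 / 2)) *
        ENNReal.ofReal (Real.exp (inner ℝ (((l ^ 2 * m - l) * √m) • θ) z +
          l ^ 2 * m / 2 * ‖z‖ ^ 2)) := by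
    intro z
    set U := (m : ℝ) • θ + √m • z with hU
    have e : ∀ y : EuclideanSpace ℝ (Fin p),
        ENNReal.ofReal (Real.exp (l * (τ - inner ℝ (θ + η i • y) U))) =
        ENNReal.ofReal (Real.exp (l * (τ - inner ℝ θ U))) *
          ENNReal.ofReal (Real.exp (inner ℝ ((-l * η i) • U) y + 0 / 2 * ‖y‖ ^ 2)) := by
      intro y
      rw [← ENNReal.ofReal_mul (Real.exp_pos _).le, ← Real.exp_add, inner_add_left,
        real_inner_smul_left, real_inner_smul_left, real_inner_comm U y]
      congr 2; ring
    simp_rw [e]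
    rw [lintegral_const_mul _ (by fun_prop), lintegral_exp_quadratic_gauss _ 0 (by norm_num),
      ← ENNReal.ofReal_mul (Real.exp_pos _).le, ← ENNReal.ofReal_mul (Real.exp_pos _).le]
    congr 1
    simp only [sub_zero, Real.sqrt_one, inv_one, one_pow, one_mul, mul_one]
    rw [← Real.exp_add, ← Real.exp_add]
    congr 1
    have n1 : ‖(-l * η i) • U‖ ^ 2 = l ^ 2 * ‖U‖ ^ 2 := by
      rw [norm_smul, mul_pow, Real.norm_eq_abs, sq_abs]
      linear_combination l ^ 2 * ‖U‖ ^ 2 * labels_sq hη i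
    have n2 : ‖U‖ ^ 2 = m ^ 2 * ‖θ‖ ^ 2 + 2 * (m * √m) * inner ℝ θ z + m * ‖z‖ ^ 2 := by
      rw [hU, norm_add_sq_real, norm_smul, norm_smul, real_inner_smul_left,
        real_inner_smul_right, mul_pow, mul_pow, Real.norm_eq_abs, Real.norm_eq_abs, sq_abs,
        sq_abs, hsq]
      ring
    have n3 : inner ℝ θ U = m * ‖θ‖ ^ 2 + √m * inner ℝ θ z := by
      rw [hU, inner_add_right, real_inner_smul_right, real_inner_smul_right,
        real_inner_self_eq_norm_sq]
    rw [n1, n2, n3, real_inner_smul_left]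
    ring
  simp_rw [hin]
  rw [lintegral_const_mul _ (by fun_prop), lintegral_exp_quadratic_gauss _ _ hl,
    ← ENNReal.ofReal_mul (Real.exp_pos _).le]
  have n4 : ‖((l ^ 2 * m - l) * √m) • θ‖ ^ 2 = (l ^ 2 * m - l) ^ 2 * m * ‖θ‖ ^ 2 := by
    rw [norm_smul, mul_pow, Real.norm_eq_abs, sq_abs, mul_pow, hsq]
  rw [n4]

/-- The oracle coordinate is weak with probability at most `exp(-Q (1/2 - 2 δ - 2/m))`, where
`Q = ‖θ‖⁴ / (‖θ‖² + p / m)` is the squared signal-to-noise ratio. -/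
theorem noise_oracle_le {m p : ℕ} (hm : 2 ≤ m) {θ : EuclideanSpace ℝ (Fin p)} (hθ : θ ≠ 0)
    {η : Fin (m + 1) → ℝ} (hη : η ∈ labels _) (i : Fin (m + 1)) {δ : ℝ} (hδ : 0 ≤ δ) :
    noise (m + 1) p {ξ | η i * (hollowGram (fun i => η i • θ + ξ i) *ᵥ η) i ≤
        δ * (m + 1) * ‖θ‖ ^ 2} ≤
      ENNReal.ofReal (Real.exp (-((‖θ‖ ^ 2) ^ 2 / (‖θ‖ ^ 2 + p / m) *
        (1 / 2 - 2 * δ - 2 / m)))) := by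
  have hm0 : (0 : ℝ) < m := by exact_mod_cast (by omega : 0 < m)
  have hm2 : (2 : ℝ) ≤ m := by exact_mod_cast hm
  set x := ‖θ‖ ^ 2 with hx
  have hx0 : 0 < x := by have := norm_pos_iff.2 hθ; positivity
  have hp0 : (0 : ℝ) ≤ p := Nat.cast_nonneg p
  set c : ℝ := p / m with hc
  have hc0 : 0 ≤ c := by positivity
  -- `l = s / m` maximizes the leading part `l m x - l² m (m x + p) / 2` of the exponent
  set s := x / (x + c) with hs
  have hs0 : 0 < s := by positivity
  have hs1 : s ≤ 1 := by rw [hs, div_le_one (by positivity)]; linarith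
  have hsx : s * (x + c) = x := by rw [hs]; field_simp
  set l := s / m with hl
  have hl0 : 0 < l := by positivity
  have ha : l ^ 2 * m = s ^ 2 / m := by rw [hl]; field_simp
  have hs2 : s ^ 2 ≤ 1 := pow_le_one₀ hs0.le hs1
  have ha2 : s ^ 2 / m ≤ 1 / 2 := by
    rw [div_le_div_iff₀ hm0 (by norm_num)]; linarith
  have ha0 : 0 ≤ s ^ 2 / m := by positivity
  have hlm : l * m = s := by rw [hl]; field_simp
  have hmeas : Measurable fun ξ : Sample (m + 1) p => l * (δ * (m + 1) * x - η i *
      (hollowGram (fun i => η i • θ + ξ i) *ᵥ η) i) := by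
    simp_rw [oracle_eq θ hη]
    fun_prop
  have hsub : {ξ : Sample (m + 1) p | η i * (hollowGram (fun i => η i • θ + ξ i) *ᵥ η) i ≤
      δ * (m + 1) * x} ⊆ {ξ | 0 ≤ l * (δ * (m + 1) * x - η i *
      (hollowGram (fun i => η i • θ + ξ i) *ᵥ η) i)} := by
    intro ξ hξ
    simp only [Set.mem_ofPred_eq] at hξ ⊢
    exact mul_nonneg hl0.le (by linarith)
  refine (measure_mono hsub).trans ((measure_nonneg_le_lintegral_exp _ hmeas).trans ?_)
  rw [lintegral_exp_oracle θ hη i l _ (by rw [ha]; linarith), ← hx]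
  refine ENNReal.ofReal_le_ofReal ?_
  rw [ha, hlm]
  have hpow : (√(1 - s ^ 2 / m))⁻¹ ^ p ≤
      Real.exp (p * (s ^ 2 / m / 2 + (s ^ 2 / m) ^ 2 / 2)) := by
    rw [Real.exp_nat_mul]
    gcongr
    exact inv_sqrt_one_sub_le (by rwa [abs_of_nonneg ha0])
  have hlast : (s ^ 2 / m - l) ^ 2 * m * x / (2 * (1 - s ^ 2 / m)) ≤ s * x / m := by
    have h1 : (s ^ 2 / m - l) ^ 2 * m = s * (s * (1 - s) ^ 2) / m := by
      rw [hl]; field_simp; ring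
    have h2 : s * (1 - s) ^ 2 ≤ 1 * 1 := by
      gcongr
      exact pow_le_one₀ (by linarith) (by linarith)
    rw [div_le_iff₀ (by linarith), h1]
    have h3 : s * (s * (1 - s) ^ 2) / m * x ≤ s * (1 * 1) / m * x := by gcongr
    have h4 : s * x / m * 1 ≤ s * x / m * (2 * (1 - s ^ 2 / m)) := by
      gcongr; linarith
    calc _ ≤ _ := h3
      _ = s * x / m * 1 := by ring
      _ ≤ _ := h4
  calc _ ≤ Real.exp (l * (δ * (m + 1) * x) - s * x + s ^ 2 * x / 2) *
        (Real.exp (p * (s ^ 2 / m / 2 + (s ^ 2 / m) ^ 2 / 2)) * Real.exp (s * x / m)) := by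
        gcongr
    _ = Real.exp (l * (δ * (m + 1) * x) - s * x + s ^ 2 * x / 2 +
        (p * (s ^ 2 / m / 2 + (s ^ 2 / m) ^ 2 / 2) + s * x / m)) := by
        rw [← Real.exp_add, ← Real.exp_add]
    _ ≤ _ := by
        gcongr
        have hQ : x ^ 2 / (x + c) = s * x := by rw [hs]; ring
        rw [hQ]
        have t1 : l * (δ * (m + 1) * x) ≤ s * x * (2 * δ) := by
          have : l * (δ * (m + 1) * x) = s * x * δ * ((m + 1) / m) := by rw [hl]; ring
          rw [this]
          have h2 : ((m : ℝ) + 1) / m ≤ 2 := by rw [div_le_iff₀ hm0]; linarith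
          calc s * x * δ * (((m : ℝ) + 1) / m) ≤ s * x * δ * 2 := by gcongr
            _ = _ := by ring
        have t2 : p * (s ^ 2 / m / 2) = s * (s * c) / 2 := by rw [hc]; ring
        have t3 : p * ((s ^ 2 / m) ^ 2 / 2) ≤ s * x / m := by
          have e : p * ((s ^ 2 / m) ^ 2 / 2) = s * ((s * c) * s ^ 2) / m / 2 := by rw [hc]; ring
          have h1 : s * c ≤ x := by nlinarith
          have h2 : (s * c) * s ^ 2 ≤ x * 1 := by gcongr
          have h3 : s * ((s * c) * s ^ 2) / m ≤ s * (x * 1) / m := by gcongr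
          have h4 : 0 ≤ s * x / m := by positivity
          rw [e]
          rw [mul_one] at h3
          linarith
        have t4 : s ^ 2 * x / 2 + s * (s * c) / 2 = s * x / 2 := by
          linear_combination s / 2 * hsx
        have t5 : s * x * (2 / m) = s * x / m + s * x / m := by ring
        linarith [mul_add (p : ℝ) (s ^ 2 / m / 2) ((s ^ 2 / m) ^ 2 / 2),
          mul_sub (s * x) (1 / 2 - 2 * δ) (2 / m), mul_sub (s * x) (1 / 2) (2 * δ)]

/-- The defining quadratic equation of the threshold. -/
theorem threshold_sq_sq {n p : ℕ} (hn : 2 ≤ n) :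
    (threshold n p 1 ^ 2) ^ 2 = 2 * Real.log n * (threshold n p 1 ^ 2 + p / n) ∧
      2 * Real.log n ≤ threshold n p 1 ^ 2 := by
  have hL : 0 < Real.log n := Real.log_pos (by exact_mod_cast (by omega : 1 < n))
  have hn0 : (0 : ℝ) < n := by exact_mod_cast (by omega : 0 < n)
  have h : threshold n p 1 ^ 2 = (1 + √(1 + 2 * p / (n * Real.log n))) * Real.log n := by
    unfold threshold
    rw [one_pow, one_mul, Real.sq_sqrt (by positivity)]
  set r := √(1 + 2 * p / (n * Real.log n)) with hr
  have hr2 : r ^ 2 = 1 + 2 * p / (n * Real.log n) := Real.sq_sqrt (by positivity)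
  have hr1 : 1 ≤ r := by
    rw [hr, Real.one_le_sqrt]
    have : (0 : ℝ) ≤ 2 * p / (n * Real.log n) := by positivity
    linarith
  rw [h]
  constructor
  · have : r ^ 2 * Real.log n ^ 2 = Real.log n ^ 2 + 2 * Real.log n * (p / n) := by
      rw [hr2]; field_simp
    linear_combination this
  · nlinarith

theorem threshold_nonneg (n p : ℕ) (σ : ℝ) : 0 ≤ threshold n p σ := Real.sqrt_nonneg _

theorem threshold_pos {n p : ℕ} (hn : 2 ≤ n) : 0 < threshold n p 1 := by
  have hL : 0 < Real.log n := Real.log_pos (by exact_mod_cast (by omega : 1 < n))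
  have h2 := (threshold_sq_sq (p := p) hn).2
  refine (threshold_nonneg n p 1).lt_of_ne fun h => ?_
  rw [← h, zero_pow two_ne_zero] at h2
  linarith

/-- At `1 + ε` times the threshold, the squared signal-to-noise ratio exceeds `2 log n` by the
factor `(1 + ε)²`, up to `1 - 1 / n`. -/
theorem snr_ge {n p : ℕ} (hn : 2 ≤ n) {ε T : ℝ} (hε : 0 < ε)
    (hT : (1 + ε) * threshold n p 1 ≤ T) :
    (1 + ε) ^ 2 * (2 * Real.log n) * (((n : ℝ) - 1) / n) ≤
      (T ^ 2) ^ 2 / (T ^ 2 + p / ((n : ℝ) - 1)) := by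
  have hL : 0 < Real.log n := Real.log_pos (by exact_mod_cast (by omega : 1 < n))
  have hn0 : (0 : ℝ) < n := by exact_mod_cast (by omega : 0 < n)
  have hn1 : (0 : ℝ) < (n : ℝ) - 1 := by
    have : (1 : ℝ) < n := by exact_mod_cast (by omega : 1 < n)
    linarith
  obtain ⟨h1, h2⟩ := threshold_sq_sq (p := p) hn
  set D := threshold n p 1 ^ 2 with hD
  set L := Real.log n
  have hx : (1 + ε) ^ 2 * D ≤ T ^ 2 := by
    rw [hD, ← mul_pow]
    have := threshold_nonneg n p 1
    gcongr
  set x := T ^ 2 with hxdef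
  have hD0 : 0 < D := by linarith
  have hx0 : 0 < x := lt_of_lt_of_le (by positivity) hx
  set y := x / (1 + ε) ^ 2 with hy
  have hxy : x = (1 + ε) ^ 2 * y := by rw [hy]; field_simp
  have hyD : D ≤ y := by rw [hy, le_div_iff₀ (by positivity)]; linarith
  have hy2 : 2 * L * (y + p / n) ≤ y ^ 2 := by nlinarith
  have hc0 : (0 : ℝ) ≤ p / n := by positivity
  have hmain : (1 + ε) ^ 2 * (2 * L) * (x + p / n) ≤ x ^ 2 := by
    have h3 : (1 + ε) ^ 2 * (2 * L) * (x + p / n) ≤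
        (1 + ε) ^ 2 * (2 * L) * ((1 + ε) ^ 2 * (y + p / n)) := by
      gcongr
      rw [hxy, mul_add]
      have : 1 * (p / n : ℝ) ≤ (1 + ε) ^ 2 * (p / n) := by
        gcongr
        nlinarith
      linarith
    have h4 : (1 + ε) ^ 2 * ((1 + ε) ^ 2 * (2 * L * (y + p / n))) ≤
        (1 + ε) ^ 2 * ((1 + ε) ^ 2 * y ^ 2) := by gcongr
    calc _ ≤ _ := h3
      _ = (1 + ε) ^ 2 * ((1 + ε) ^ 2 * (2 * L * (y + p / n))) := by ring
      _ ≤ _ := h4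
      _ = x ^ 2 := by rw [hxy]; ring
  rw [le_div_iff₀ (by positivity)]
  refine le_trans ?_ hmain
  rw [mul_assoc]
  gcongr
  have : ((n : ℝ) - 1) / n * (x + p / ((n : ℝ) - 1)) = ((n : ℝ) - 1) / n * x + p / n := by
    field_simp
  rw [this]
  have : ((n : ℝ) - 1) / n * x ≤ 1 * x := by
    gcongr
    rw [div_le_one hn0]; linarith
  linarith

/-- The bound of `exists_noise_event` for the noise is smaller than the signal `n T²` by a factor of
order `√(log n)`; here `368 = 48 + 160 + 160`. -/
theorem noise_norm_le {n p : ℕ} (hn : 2 ≤ n) (hL1 : 1 ≤ Real.log n) {T : ℝ} (hT0 : 0 ≤ T)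
    (hT : threshold n p 1 ≤ T) :
    48 * n * T + 160 * (√(p * n) + n) ≤ 368 / √(Real.log n) * n * T ^ 2 := by
  have hn0 : (0 : ℝ) < n := by exact_mod_cast (by omega : 0 < n)
  obtain ⟨h1, h2⟩ := threshold_sq_sq (p := p) hn
  set D := threshold n p 1 ^ 2 with hD
  set L := Real.log n
  have hL : 0 < L := by linarith
  have hDT : D ≤ T ^ 2 := by
    rw [hD]
    have := threshold_nonneg n p 1
    gcongr
  set r := √L with hr
  have hr1 : 1 ≤ r := by rw [hr, Real.one_le_sqrt]; exact hL1
  have hr2 : r ^ 2 = L := Real.sq_sqrt hL.le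
  have hr0 : 0 < r := by linarith
  have hrT : r ≤ T := by
    refine le_of_sq_le_sq ?_ hT0
    rw [hr2]; linarith
  have b1 : n * T * r ≤ n * T ^ 2 := by
    rw [sq, mul_assoc]; gcongr
  have b2 : n * r ≤ n * T ^ 2 := by
    gcongr
    nlinarith
  have b3 : √((p : ℝ) * n) * r ≤ n * T ^ 2 := by
    refine le_of_sq_le_sq ?_ (by positivity)
    rw [mul_pow, Real.sq_sqrt (by positivity), hr2]
    have h3 : n ^ 2 * D ^ 2 = 2 * L * (n ^ 2 * D + p * n) := by rw [h1]; field_simp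
    have hD0 : 0 ≤ D := by linarith
    have h4 : 0 ≤ L * (n ^ 2 * D) := by positivity
    have h5 : 0 ≤ L * (p * n) := by positivity
    calc (p : ℝ) * n * L ≤ n ^ 2 * D ^ 2 := by rw [h3]; linarith
      _ ≤ n ^ 2 * (T ^ 2) ^ 2 := by gcongr
      _ = _ := by ring
  rw [div_mul_eq_mul_div, div_mul_eq_mul_div, le_div_iff₀ hr0]
  linarith

/-- As `16 > e`, the initial errors have disappeared after `⌊3 log n⌋` steps. -/
theorem two_mul_div_sixteen_pow_floor_le {n : ℕ} (hn : 1 ≤ n) :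
    2 * (n : ℝ) / 16 ^ ⌊3 * Real.log n⌋₊ ≤ 2 * Real.exp (1 - 2 * Real.log n) := by
  have hn0 : (0 : ℝ) < n := by exact_mod_cast hn
  set k := ⌊3 * Real.log n⌋₊
  have hk : 3 * Real.log n < k + 1 := Nat.lt_floor_add_one _
  have h16 : Real.exp k ≤ 16 ^ k := by
    rw [← mul_one (k : ℝ), Real.exp_nat_mul]
    gcongr
    linarith [Real.exp_one_lt_d9]
  calc 2 * (n : ℝ) / 16 ^ k ≤ 2 * n / Real.exp k := by gcongr
    _ = 2 * Real.exp (Real.log n - k) := by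
        rw [Real.exp_sub, Real.exp_log hn0]; ring
    _ ≤ _ := mul_le_mul_of_nonneg_left (Real.exp_le_exp.2 (by linarith)) two_pos.le

/-- The risk of the iterates when the noise is small (`hN`) and each coordinate is weak with
probability at most `q` (`hq`). -/
theorem risk_lloyd_le {m p : ℕ} {θ : EuclideanSpace ℝ (Fin p)} (hθ : θ ≠ 0)
    {η : Fin (m + 1) → ℝ} (hη : η ∈ labels _) {η₀ : Sample (m + 1) p → Fin (m + 1) → ℝ}
    (hη₀ : IsSpectralEstimator η₀) {δ q : ℝ} (hδ : 0 < δ) (hδ8 : δ ≤ 8)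
    (hN : 48 * ((m + 1 : ℕ) : ℝ) * ‖θ‖ + 160 * (√(p * (m + 1 : ℕ)) + (m + 1 : ℕ)) ≤
      δ / 16 * (m + 1 : ℕ) * ‖θ‖ ^ 2)
    (hq : ∀ i, noise (m + 1) p {ξ | η i * (hollowGram (fun i => η i • θ + ξ i) *ᵥ η) i ≤
        δ * (m + 1) * ‖θ‖ ^ 2} ≤ ENNReal.ofReal q) (hq0 : 0 ≤ q) (k : ℕ) :
    risk 1 (lloyd η₀ k) θ η ≤ ENNReal.ofReal ((4 + 16 / δ) * ((m + 1) * q) +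
      2 * (m + 1 : ℕ) / 16 ^ k + 12 * ((m + 1) * Real.exp (-(m + 1 : ℕ)))) := by
  classical
  have hθ0 : 0 < ‖θ‖ := norm_pos_iff.2 hθ
  set C := 4 + 16 / δ with hC
  have hC0 : 0 < C := by positivity
  obtain ⟨B, hB, hgood⟩ := exists_noise_event (n := m + 1) (by omega) θ
  set Bad : Fin (m + 1) → Set (Sample (m + 1) p) := fun i =>
    {ξ | η i * (hollowGram (fun i => η i • θ + ξ i) *ᵥ η) i ≤ δ * (m + 1) * ‖θ‖ ^ 2} with hBad
  -- measurable hulls make the measurability of the exceptional events irrelevant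
  set B' := toMeasurable (noise (m + 1) p) B
  set Bad' : Fin (m + 1) → Set (Sample (m + 1) p) := fun i =>
    toMeasurable (noise (m + 1) p) (Bad i)
  have hest := isEstimator_lloyd hη₀ k
  have hpt : ∀ ξ : Sample (m + 1) p,
      ENNReal.ofReal (loss (lloyd η₀ k (fun i => η i • θ + (1 : ℝ) • ξ i)) η) ≤
      (∑ i, ENNReal.ofReal C * (Bad' i).indicator 1 ξ) +
        ENNReal.ofReal (2 * (m + 1 : ℕ) / 16 ^ k) +
        ENNReal.ofReal (2 * (m + 1 : ℕ)) * B'.indicator 1 ξ := by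
    intro ξ
    simp only [one_smul]
    by_cases hξ : ξ ∈ B
    · have hξ' : ξ ∈ B' := subset_toMeasurable _ _ hξ
      rw [Set.indicator_of_mem hξ', Pi.one_apply, mul_one]
      exact le_add_left (ENNReal.ofReal_le_ofReal (loss_le (hest.2 _) hη))
    · refine le_add_right ?_
      obtain ⟨N, hM, hNb⟩ := hgood ξ hξ η hη
      set Y : Sample (m + 1) p := fun i => η i • θ + ξ i
      obtain ⟨v, hv, h0⟩ := hη₀.2 Y
      have hN' : ∀ x, (N *ᵥ x) ⬝ᵥ (N *ᵥ x) ≤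
          (δ / 16 * (m + 1 : ℕ) * ‖θ‖ ^ 2) ^ 2 * (x ⬝ᵥ x) := by
        intro x
        refine (hNb x).trans ?_
        have : 0 ≤ x ⬝ᵥ x := Finset.sum_nonneg fun i _ => mul_self_nonneg _
        gcongr
      have hloss := loss_iterate_le (n := m + 1) (by omega) (u := fun k => lloyd η₀ k Y)
        (s := ‖θ‖ ^ 2) (by positivity) hδ hδ8 hη hM (hollowGram_isSymm Y) hN' hv h0
        (fun k => rfl) k
      refine (ENNReal.ofReal_le_ofReal hloss).trans ?_
      rw [ENNReal.ofReal_add (by positivity) (by positivity)]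
      gcongr
      rw [weakCount, Finset.card_filter, Nat.cast_sum, Finset.mul_sum,
        ENNReal.ofReal_sum_of_nonneg (fun i _ => by positivity)]
      refine Finset.sum_le_sum fun i _ => ?_
      split_ifs with hi
      · have hmem : ξ ∈ Bad' i := by
          refine subset_toMeasurable _ _ ?_
          simp only [hBad, Set.mem_ofPred_eq]
          push_cast at hi
          exact hi
        rw [Set.indicator_of_mem hmem]
        simp [hC]
      · simp
  have hmeas : Measurable fun Y : Sample (m + 1) p =>
      ENNReal.ofReal (loss (lloyd η₀ k Y) η) := by
    have := hest.1
    unfold loss hamming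
    fun_prop
  have hmB : ∀ i, MeasurableSet (Bad' i) := fun i => measurableSet_toMeasurable _ _
  have hmB' : MeasurableSet B' := measurableSet_toMeasurable _ _
  have hmi : ∀ i, Measurable fun ξ : Sample (m + 1) p =>
      ENNReal.ofReal C * (Bad' i).indicator (1 : Sample (m + 1) p → ENNReal) ξ := fun i =>
    (measurable_one.indicator (hmB i)).const_mul _
  rw [risk, law, lintegral_map hmeas (by fun_prop)]
  refine (lintegral_mono hpt).trans ?_
  have hsplit : ENNReal.ofReal (C * ((m + 1) * q) + 2 * (m + 1 : ℕ) / 16 ^ k +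
      12 * ((m + 1) * Real.exp (-(m + 1 : ℕ)))) = ENNReal.ofReal (C * ((m + 1) * q)) +
      ENNReal.ofReal (2 * (m + 1 : ℕ) / 16 ^ k) +
      ENNReal.ofReal (12 * ((m + 1) * Real.exp (-(m + 1 : ℕ)))) := by
    rw [← ENNReal.ofReal_add (by positivity) (by positivity),
      ← ENNReal.ofReal_add (by positivity) (by positivity)]
  have hms : Measurable fun ξ : Sample (m + 1) p =>
      ∑ i, ENNReal.ofReal C * (Bad' i).indicator (1 : Sample (m + 1) p → ENNReal) ξ :=
    Finset.measurable_fun_sum _ fun i _ => hmi i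
  have hms' : Measurable fun ξ : Sample (m + 1) p =>
      (∑ i, ENNReal.ofReal C * (Bad' i).indicator (1 : Sample (m + 1) p → ENNReal) ξ) +
        ENNReal.ofReal (2 * (m + 1 : ℕ) / 16 ^ k) := hms.add_const _
  rw [lintegral_add_left hms', lintegral_add_left hms,
    lintegral_finsetSum _ (fun i _ => hmi i), lintegral_const, measure_univ, mul_one,
    lintegral_const_mul _ (measurable_one.indicator hmB'), lintegral_indicator_one hmB',
    measure_toMeasurable, hsplit]
  gcongr
  · calc _ ≤ ∑ i : Fin (m + 1), ENNReal.ofReal C * ENNReal.ofReal q := by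
          refine Finset.sum_le_sum fun i _ => ?_
          rw [lintegral_const_mul _ (measurable_one.indicator (hmB i)),
            lintegral_indicator_one (hmB i), measure_toMeasurable]
          gcongr
          exact hq i
      _ = ENNReal.ofReal (C * ((m + 1) * q)) := by
          rw [Finset.sum_const, Finset.card_univ, Fintype.card_fin, nsmul_eq_mul,
            ← ENNReal.ofReal_natCast, ← ENNReal.ofReal_mul hC0.le,
            ← ENNReal.ofReal_mul (Nat.cast_nonneg _)]
          congr 1
          push_cast; ring
  · calc _ ≤ ENNReal.ofReal (2 * (m + 1 : ℕ)) *
          ENNReal.ofReal (6 * Real.exp (-(m + 1 : ℕ))) := by gcongr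
      _ = _ := by
          rw [← ENNReal.ofReal_mul (by positivity)]
          congr 1
          push_cast; ring

/-! ### Exact recovery above the threshold -/

/-- Above the threshold the risk of the iterates is bounded uniformly in the dimension. -/
theorem eventually_maxRisk_lloyd_le {ε : ℝ} (hε : 0 < ε) : ∃ C : ℝ, ∀ᶠ n : ℕ in atTop,
    ∀ (p : ℕ) (Δ : ℝ) (η₀ : Sample n p → Fin n → ℝ), IsSpectralEstimator η₀ →
      (1 + ε) * threshold n p 1 ≤ Δ →
      maxRisk 1 Δ (lloyd η₀ ⌊3 * Real.log n⌋₊) ≤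
        ENNReal.ofReal (C * Real.exp (-(ε * Real.log n)) + 2 * Real.exp (1 - 2 * Real.log n) +
          12 * (n * Real.exp (-n))) := by
  -- with this `δ`, `(1 + ε) (1 - 4 δ) = 1 + ε / 2`: half of the gain remains for
  -- the terms of order `1 / m`
  set δ := ε / (8 * (1 + ε)) with hδ
  have hδ0 : 0 < δ := by positivity
  have hδ8 : δ ≤ 1 / 8 := by
    rw [hδ, div_le_div_iff₀ (by positivity) (by norm_num)]; linarith
  have hδε : (1 + ε) * (4 * δ) = ε / 2 := by rw [hδ]; field_simp; norm_num
  refine ⟨4 + 16 / δ, ?_⟩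
  have hLtop : Tendsto (fun n : ℕ => Real.log n) atTop atTop :=
    Real.tendsto_log_atTop.comp tendsto_natCast_atTop_atTop
  have hrtop : Tendsto (fun n : ℕ => √(Real.log n)) atTop atTop :=
    Real.tendsto_sqrt_atTop.comp hLtop
  filter_upwards [eventually_ge_atTop 3, hLtop.eventually_ge_atTop 1,
    hrtop.eventually_ge_atTop (368 * 16 / δ),
    tendsto_natCast_atTop_atTop.eventually_ge_atTop (10 * (1 + ε) / ε + 1)] with n hn3 hL1 hsq hnε
  intro p Δ η₀ hη₀ hΔ
  refine iSup_le fun θ => iSup_le fun hθΔ => iSup_le fun η => iSup_le fun hη => ?_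
  obtain ⟨m, rfl⟩ : ∃ m, n = m + 1 := ⟨n - 1, by omega⟩
  have hm2 : 2 ≤ m := by omega
  have hm0 : (0 : ℝ) < m := by exact_mod_cast (by omega : 0 < m)
  set L := Real.log ((m + 1 : ℕ) : ℝ) with hL
  have hL0 : 0 < L := by linarith
  have hT : (1 + ε) * threshold (m + 1) p 1 ≤ ‖θ‖ := hΔ.trans hθΔ
  have htp : 0 < threshold (m + 1) p 1 := threshold_pos (by omega)
  have hθ0 : 0 < ‖θ‖ := lt_of_lt_of_le (by positivity) hT
  have hT1 : threshold (m + 1) p 1 ≤ ‖θ‖ := by nlinarith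
  have hN : 48 * ((m + 1 : ℕ) : ℝ) * ‖θ‖ + 160 * (√(p * (m + 1 : ℕ)) + (m + 1 : ℕ)) ≤
      δ / 16 * (m + 1 : ℕ) * ‖θ‖ ^ 2 := by
    refine (noise_norm_le (by omega) hL1 hθ0.le hT1).trans ?_
    have hs0 : 0 < √L := Real.sqrt_pos.2 hL0
    suffices h : 368 / √L ≤ δ / 16 by gcongr
    rw [div_le_iff₀ hs0]
    have : δ / 16 * (368 * 16 / δ) ≤ δ / 16 * √L := by gcongr
    calc (368 : ℝ) = δ / 16 * (368 * 16 / δ) := by field_simp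
      _ ≤ _ := this
  have hq : ∀ i, noise (m + 1) p {ξ | η i * (hollowGram (fun i => η i • θ + ξ i) *ᵥ η) i ≤
        δ * (m + 1) * ‖θ‖ ^ 2} ≤ ENNReal.ofReal (Real.exp (-((1 + ε) * L))) := by
    intro i
    refine (noise_oracle_le hm2 (norm_pos_iff.1 hθ0) hη i hδ0.le).trans
      (ENNReal.ofReal_le_ofReal (Real.exp_le_exp.2 (neg_le_neg ?_)))
    have hsnr := snr_ge (n := m + 1) (p := p) (by omega) hε hT
    have ecast : ((m + 1 : ℕ) : ℝ) - 1 = m := by push_cast; ring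
    rw [ecast, ← hL] at hsnr
    rw [Nat.cast_add, Nat.cast_one] at hsnr hnε
    have h5 : (1 + ε) * (5 / m) ≤ ε / 2 := by
      have : 10 * (1 + ε) / ε ≤ m := by linarith
      rw [div_le_iff₀ hε] at this
      rw [← mul_div_assoc, div_le_div_iff₀ hm0 two_pos]
      linarith
    have hkey : 1 ≤ (1 + ε) * ((m : ℝ) / (m + 1) * (1 - 4 * δ - 4 / m)) := by
      have e1 : (m : ℝ) / (m + 1) = 1 - 1 / (m + 1) := by field_simp; ring
      have e2 : (1 : ℝ) / (m + 1) ≤ 1 / m := by gcongr; linarith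
      have e3 : (0 : ℝ) ≤ 1 / (m + 1) := by positivity
      have e4 : 0 ≤ 4 * δ + 4 / m := by positivity
      have e5 : 1 - 4 * δ - 5 / m ≤ (m : ℝ) / (m + 1) * (1 - 4 * δ - 4 / m) := by
        rw [e1]
        have : (5 : ℝ) / m = 4 / m + 1 / m := by ring
        nlinarith [mul_nonneg e3 e4]
      have e6 : (1 + ε) * (1 - 4 * δ - 5 / m) ≤
          (1 + ε) * ((m : ℝ) / (m + 1) * (1 - 4 * δ - 4 / m)) := by gcongr
      refine le_trans ?_ e6
      linarith [mul_sub (1 + ε) (1 - 4 * δ) (5 / m), mul_sub (1 + ε) 1 (4 * δ)]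
    have hw : 0 ≤ 1 / 2 - 2 * δ - 2 / (m : ℝ) := by
      by_contra! h
      have h1 : 1 - 4 * δ - 4 / (m : ℝ) < 0 := by
        have : (4 : ℝ) / m = 2 * (2 / m) := by ring
        linarith
      have h2 : (1 + ε) * ((m : ℝ) / (m + 1) * (1 - 4 * δ - 4 / m)) ≤ 0 :=
        mul_nonpos_of_nonneg_of_nonpos (by positivity)
          (mul_nonpos_of_nonneg_of_nonpos (by positivity) h1.le)
      linarith
    calc (1 + ε) * L = (1 + ε) * L * 1 := (mul_one _).symm
      _ ≤ (1 + ε) * L * ((1 + ε) * ((m : ℝ) / (m + 1) * (1 - 4 * δ - 4 / m))) := by gcongr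
      _ = (1 + ε) ^ 2 * (2 * L) * ((m : ℝ) / (m + 1)) * (1 / 2 - 2 * δ - 2 / m) := by ring
      _ ≤ _ := by gcongr
  refine (risk_lloyd_le (norm_pos_iff.1 hθ0) hη hη₀ hδ0 (by linarith) hN hq
    (Real.exp_pos _).le _).trans (ENNReal.ofReal_le_ofReal ?_)
  have hpow := two_mul_div_sixteen_pow_floor_le (n := m + 1) (by omega)
  have hexp : ((m : ℝ) + 1) * Real.exp (-((1 + ε) * L)) = Real.exp (-(ε * L)) := by
    have : (m : ℝ) + 1 = Real.exp L := by
      rw [hL, Real.exp_log (by positivity)]; push_cast; ring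
    rw [this, ← Real.exp_add]
    congr 1; ring
  rw [hexp]
  have : ((m : ℝ) + 1) = ((m + 1 : ℕ) : ℝ) := by push_cast; ring
  rw [this]
  linarith

theorem achievesExactRecovery_lloyd (p : ℕ → ℕ) (σ Δ : ℕ → ℝ) (hσ : ∀ n, 2 ≤ n → 0 < σ n)
    {ε : ℝ} (hε : 0 < ε) (h : ∀ n, 2 ≤ n → (1 + ε) * threshold n (p n) (σ n) ≤ Δ n)
    (η₀ : ∀ n, Sample n (p n) → Fin n → ℝ) (hη₀ : ∀ n, 2 ≤ n → IsSpectralEstimator (η₀ n)) :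
    AchievesExactRecovery p σ Δ (fun n => lloyd (η₀ n) ⌊3 * Real.log n⌋₊) := by
  refine ⟨fun n hn => isEstimator_lloyd (hη₀ n hn) _, ?_⟩
  obtain ⟨C, hC⟩ := eventually_maxRisk_lloyd_le hε
  have hLtop : Tendsto (fun n : ℕ => Real.log n) atTop atTop :=
    Real.tendsto_log_atTop.comp tendsto_natCast_atTop_atTop
  have t1 : Tendsto (fun n : ℕ => C * Real.exp (-(ε * Real.log n))) atTop (𝓝 0) := by
    rw [← mul_zero C]
    exact (Real.tendsto_exp_neg_atTop_nhds_zero.comp (hLtop.const_mul_atTop hε)).const_mul C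
  have t2 : Tendsto (fun n : ℕ => 2 * Real.exp (1 - 2 * Real.log n)) atTop (𝓝 0) := by
    refine (mul_zero (2 : ℝ)) ▸ Tendsto.const_mul 2 (Real.tendsto_exp_atBot.comp ?_)
    exact tendsto_atBot_add_const_left atTop 1
      (tendsto_neg_atTop_atBot.comp (hLtop.const_mul_atTop two_pos))
  have t3 : Tendsto (fun n : ℕ => 12 * ((n : ℝ) * Real.exp (-n))) atTop (𝓝 0) := by
    refine (mul_zero (12 : ℝ)) ▸ Tendsto.const_mul 12 ?_
    have := (Real.tendsto_pow_mul_exp_neg_atTop_nhds_zero 1).comp tendsto_natCast_atTop_atTop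
    simpa [Function.comp_def] using this
  have t := ENNReal.tendsto_ofReal ((t1.add t2).add t3)
  rw [add_zero, add_zero, ENNReal.ofReal_zero] at t
  refine tendsto_of_tendsto_of_tendsto_of_le_of_le' tendsto_const_nhds t
    (Eventually.of_forall fun _ => zero_le) ?_
  filter_upwards [hC, eventually_ge_atTop 2] with n hn hn2
  have hs := hσ n hn2
  rw [maxRisk_scale hs _ (isEstimator_lloyd (hη₀ n hn2) _).1]
  have e : (fun Y : Sample n (p n) => lloyd (η₀ n) ⌊3 * Real.log n⌋₊ fun i => σ n • Y i) =
      lloyd (fun Y => η₀ n fun i => σ n • Y i) ⌊3 * Real.log n⌋₊ :=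
    funext fun Y => lloyd_scale hs _ _ Y
  rw [e]
  refine hn (p n) _ _ (isSpectralEstimator_scale hs (hη₀ n hn2)) ?_
  rw [le_div_iff₀ hs, mul_assoc, mul_comm _ (σ n), ← threshold_eq_mul hs]
  exact h n hn2

/-! ### The Bayes lower bound -/

/-- The sign `ν` for which `ν f` agrees best with `η` away from the coordinate `i`, with `1` in
case of a tie. It does not depend on `η i`. -/
def align {n : ℕ} (f η : Fin n → ℝ) (i : Fin n) : ℝ :=
  if 0 ≤ ∑ j ∈ Finset.univ.erase i, f j * η j then 1 else -1

/-- The label vector with the `i`-th label changed. -/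
def flipLabel {n : ℕ} (i : Fin n) (η : Fin n → ℝ) : Fin n → ℝ := Function.update η i (-η i)

theorem flipLabel_mem_labels {n : ℕ} (i : Fin n) {η : Fin n → ℝ} (hη : η ∈ labels n) :
    flipLabel i η ∈ labels n := by
  intro j
  by_cases h : j = i
  · subst h
    rcases hη j with h | h <;> simp [flipLabel, h]
  · simpa [flipLabel, h] using hη j

theorem align_flipLabel {n : ℕ} (f η : Fin n → ℝ) (i : Fin n) :
    align f (flipLabel i η) i = align f η i := by
  unfold align
  have : ∑ j ∈ Finset.univ.erase i, f j * flipLabel i η j =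
      ∑ j ∈ Finset.univ.erase i, f j * η j :=
    Finset.sum_congr rfl fun j hj => by simp [flipLabel, Finset.ne_of_mem_erase hj]
  rw [this]

theorem align_eq {n : ℕ} (f η : Fin n → ℝ) (i : Fin n) : align f η i = 1 ∨ align f η i = -1 := by
  unfold align
  split_ifs <;> simp

theorem hamming_eq_sub_dot {n : ℕ} {f η : Fin n → ℝ} (hf : f ∈ labels n) (hη : η ∈ labels n) :
    hamming f η = n - f ⬝ᵥ η := by
  have : ∀ j, |f j - η j| = 1 - f j * η j := by
    intro j
    rcases hf j with h | h <;> rcases hη j with h' | h' <;> norm_num [h, h']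
  simp [hamming, this, dotProduct]

theorem loss_eq {n : ℕ} {f η : Fin n → ℝ} (hf : f ∈ labels n) (hη : η ∈ labels n) :
    loss f η = n - |f ⬝ᵥ η| := by
  rw [loss, hamming_eq_sub_dot hf hη, hamming_eq_sub_dot hf (neg_mem_labels hη), dotProduct_neg,
    sub_neg_eq_add]
  rcases le_total 0 (f ⬝ᵥ η) with h | h
  · rw [abs_of_nonneg h, min_eq_left (by linarith)]
  · rw [abs_of_nonpos h, min_eq_right (by linarith), sub_neg_eq_add]

/-- Estimating each label with the knowledge of all the others costs no more than a multiple of the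
loss: the global sign can be read off from the other labels. -/
theorem sum_align_le {n : ℕ} (hn : 2 ≤ n) {f η : Fin n → ℝ} (hf : f ∈ labels n)
    (hη : η ∈ labels n) : ∑ i, |align f η i * f i - η i| ≤ 4 * loss f η := by
  set s := f ⬝ᵥ η with hs
  have hn2 : (2 : ℝ) ≤ n := by exact_mod_cast hn
  have hsi : ∀ i, ∑ j ∈ Finset.univ.erase i, f j * η j = s - f i * η i := by
    intro i
    rw [hs, dotProduct, ← Finset.add_sum_erase _ _ (Finset.mem_univ i)]
    ring
  have hab : ∀ i, |f i * η i| = 1 := by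
    intro i
    rcases hf i with h | h <;> rcases hη i with h' | h' <;> norm_num [h, h']
  have hl0 : 0 ≤ loss f η :=
    le_min (Finset.sum_nonneg fun i _ => abs_nonneg _) (Finset.sum_nonneg fun i _ => abs_nonneg _)
  by_cases h1 : 1 < s
  · have ha : ∀ i, align f η i = 1 := fun i => by
      unfold align
      rw [hsi, if_pos]
      linarith [(abs_le.1 (hab i).le).2]
    have : ∑ i, |align f η i * f i - η i| = hamming f η := by simp [ha, hamming]
    rw [this, hamming_eq_sub_dot hf hη]
    rw [loss_eq hf hη, ← hs, abs_of_pos (by linarith)] at hl0 ⊢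
    linarith
  by_cases h2 : s < -1
  · have ha : ∀ i, align f η i = -1 := fun i => by
      unfold align
      rw [hsi, if_neg]
      linarith [(abs_le.1 (hab i).le).1]
    have : ∑ i, |align f η i * f i - η i| = hamming f (-η) := by
      simp only [ha, hamming]
      refine Finset.sum_congr rfl fun i _ => ?_
      rw [← abs_neg, Pi.neg_apply]
      congr 1; ring
    rw [this, hamming_eq_sub_dot hf (neg_mem_labels hη), dotProduct_neg]
    rw [loss_eq hf hη, ← hs, abs_of_neg (by linarith)] at hl0 ⊢
    linarith
  -- the remaining case `|s| ≤ 1`: the loss is at least `n - 1 ≥ n / 2`, the left side at most `2 n`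
  · have h3 : ∑ i, |align f η i * f i - η i| ≤ ∑ _i : Fin n, (2 : ℝ) := by
      refine Finset.sum_le_sum fun i _ => ?_
      rcases hf i with h | h <;> rcases hη i with h' | h' <;>
        rcases align_eq f η i with h'' | h'' <;> norm_num [h, h', h'']
    have h4 : |s| ≤ 1 := abs_le.2 ⟨by linarith, by linarith⟩
    rw [loss_eq hf hη, ← hs]
    simp only [Finset.sum_const, Finset.card_univ, Fintype.card_fin, nsmul_eq_mul] at h3
    linarith

/-- The density, with respect to the law of the noise, of the law of the sample with labels `η`
when `θ` is drawn from the prior `π`. -/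
def mixDensity {n p : ℕ} (π : Measure (EuclideanSpace ℝ (Fin p))) (η : Fin n → ℝ)
    (Y : Sample n p) : ENNReal :=
  ∫⁻ θ, ENNReal.ofReal (Real.exp (inner ℝ θ (∑ i, η i • Y i) - n * ‖θ‖ ^ 2 / 2)) ∂π

theorem measurable_mixDensity {n p : ℕ} (π : Measure (EuclideanSpace ℝ (Fin p))) [SFinite π]
    (η : Fin n → ℝ) : Measurable (mixDensity π η : Sample n p → ENNReal) := by
  unfold mixDensity
  refine Measurable.lintegral_prod_left' (f := fun q : EuclideanSpace ℝ (Fin p) × Sample n p =>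
    ENNReal.ofReal (Real.exp (inner ℝ q.1 (∑ i, η i • q.2 i) - n * ‖q.1‖ ^ 2 / 2))) ?_
  fun_prop

theorem lintegral_mixDensity {n p : ℕ} (π : Measure (EuclideanSpace ℝ (Fin p))) [SFinite π]
    {η : Fin n → ℝ} (hη : η ∈ labels n) {G : Sample n p → ENNReal} (hG : Measurable G) :
    ∫⁻ θ, ∫⁻ Y, G Y ∂(law 1 θ η) ∂π = ∫⁻ Y, G Y * mixDensity π η Y ∂(noise n p) := by
  simp_rw [law_one_eq_withDensity _ hη]
  have h1 : ∀ θ : EuclideanSpace ℝ (Fin p), ∫⁻ Y, G Y ∂((noise n p).withDensity fun Y =>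
      ENNReal.ofReal (Real.exp (inner ℝ θ (∑ i, η i • Y i) - n * ‖θ‖ ^ 2 / 2))) =
      ∫⁻ Y, G Y * ENNReal.ofReal
        (Real.exp (inner ℝ θ (∑ i, η i • Y i) - n * ‖θ‖ ^ 2 / 2)) ∂(noise n p) := by
    intro θ
    rw [lintegral_withDensity_eq_lintegral_mul _ (by fun_prop) hG]
    simp [mul_comm]
  simp_rw [h1]
  rw [lintegral_lintegral_swap (Measurable.aemeasurable (by fun_prop))]
  refine lintegral_congr fun Y => ?_
  rw [mixDensity, lintegral_const_mul _ (by fun_prop)]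

/-- The label vector of a vector of booleans, `true` standing for `1`: a parametrization of the
hypercube `labels n` by a finite type, over which the Bayes risk is averaged. -/
def ofBool {n : ℕ} (b : Fin n → Bool) : Fin n → ℝ := fun i => if b i then 1 else -1

theorem ofBool_mem_labels {n : ℕ} (b : Fin n → Bool) : ofBool b ∈ labels n := by
  intro i
  simp only [ofBool]
  split_ifs <;> simp

/-- The involution of the boolean hypercube that changes the `i`-th entry. -/
def flipEquiv {n : ℕ} (i : Fin n) : (Fin n → Bool) ≃ (Fin n → Bool) :=
  Function.Involutive.toPerm (fun b => Function.update b i (!b i)) fun b => by simp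

theorem ofBool_flipEquiv {n : ℕ} (i : Fin n) (b : Fin n → Bool) :
    ofBool (flipEquiv i b) = flipLabel i (ofBool b) := by
  have e : flipEquiv i b = Function.update b i (!b i) := rfl
  rw [e]
  ext j
  by_cases h : j = i
  · subst h
    cases hb : b j <;> simp [flipLabel, ofBool, hb]
  · simp [flipLabel, ofBool, h]

/-- The Bayes lower bound for the maximal risk: `b` bounds from below the overlap of the two
hypotheses on one label, the other labels being known. -/
theorem bayes_lower {n p : ℕ} (hn : 2 ≤ n) (Δ : ℝ) {f : Sample n p → Fin n → ℝ}
    (hf : IsEstimator f) (π : Measure (EuclideanSpace ℝ (Fin p))) [IsProbabilityMeasure π]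
    {b : ENNReal} (hb : ∀ η ∈ labels n, ∀ i,
      b ≤ ∫⁻ Y, min (mixDensity π η Y) (mixDensity π (flipLabel i η) Y) ∂(noise n p)) :
    n * b ≤ 4 * (maxRisk 1 Δ f + ENNReal.ofReal (2 * n) * π {θ | ‖θ‖ < Δ}) := by
  classical
  set R := maxRisk 1 Δ f + ENNReal.ofReal (2 * n) * π {θ | ‖θ‖ < Δ} with hR
  have hfm := hf.1
  have hrisk : ∀ η ∈ labels n, ∫⁻ θ, risk 1 f θ η ∂π ≤ R := by
    intro η hη
    have hms : MeasurableSet {θ : EuclideanSpace ℝ (Fin p) | ‖θ‖ < Δ} :=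
      measurableSet_lt measurable_norm measurable_const
    have hpt : ∀ θ : EuclideanSpace ℝ (Fin p), risk 1 f θ η ≤ maxRisk 1 Δ f +
        ENNReal.ofReal (2 * n) *
          ({θ | ‖θ‖ < Δ} : Set (EuclideanSpace ℝ (Fin p))).indicator 1 θ := by
      intro θ
      by_cases hθ : ‖θ‖ < Δ
      · rw [Set.indicator_of_mem (by exact hθ), Pi.one_apply, mul_one]
        refine le_add_left ?_
        have : IsProbabilityMeasure (law 1 θ η) :=
          Measure.isProbabilityMeasure_map (Measurable.aemeasurable (by fun_prop))
        calc risk 1 f θ η ≤ ∫⁻ _, ENNReal.ofReal (2 * n) ∂(law 1 θ η) :=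
              lintegral_mono fun Y => ENNReal.ofReal_le_ofReal (loss_le (hf.2 Y) hη)
          _ = _ := by simp
      · exact le_add_right (le_iSup₂_of_le θ (not_lt.1 hθ) (le_iSup₂_of_le η hη le_rfl))
    refine (lintegral_mono hpt).trans (le_of_eq ?_)
    rw [lintegral_add_left measurable_const, lintegral_const, measure_univ, mul_one,
      lintegral_const_mul _ (measurable_one.indicator hms), lintegral_indicator_one hms]
  let G : (Fin n → ℝ) → Fin n → Sample n p → ENNReal := fun η i Y =>
    ENNReal.ofReal |align (f Y) η i * f Y i - η i|
  have halm : ∀ η i, Measurable fun Y => align (f Y) η i := by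
    intro η i
    unfold align
    refine Measurable.ite (measurableSet_le measurable_const ?_) measurable_const measurable_const
    fun_prop
  have hGm : ∀ η i, Measurable (G η i) := by
    intro η i
    have := halm η i
    fun_prop
  have hGd : ∀ η i, Measurable fun Y => G η i Y * mixDensity π η Y := fun η i =>
    (hGm η i).mul (measurable_mixDensity π η)
  let A : (Fin n → ℝ) → Fin n → ENNReal := fun η i => ∫⁻ θ, ∫⁻ Y, G η i Y ∂(law 1 θ η) ∂π
  have hup : ∀ η ∈ labels n, ∑ i, A η i ≤ 4 * R := by
    intro η hη
    have hsum : ∀ i, A η i = ∫⁻ Y, G η i Y * mixDensity π η Y ∂(noise n p) := fun i =>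
      lintegral_mixDensity π hη (hGm η i)
    simp_rw [hsum]
    have hmd := measurable_mixDensity π (n := n) η
    rw [← lintegral_finsetSum _ (fun i _ => hGd η i)]
    have hlm : Measurable fun Y : Sample n p => ENNReal.ofReal (loss (f Y) η) := by
      unfold loss hamming
      fun_prop
    calc ∫⁻ Y, ∑ i, G η i Y * mixDensity π η Y ∂(noise n p)
        ≤ ∫⁻ Y, 4 * (ENNReal.ofReal (loss (f Y) η) * mixDensity π η Y) ∂(noise n p) := by
          refine lintegral_mono fun Y => ?_
          rw [← Finset.sum_mul, ← mul_assoc]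
          gcongr
          rw [← ENNReal.ofReal_sum_of_nonneg (fun i _ => abs_nonneg _),
            show (4 : ENNReal) = ENNReal.ofReal 4 by simp, ← ENNReal.ofReal_mul (by norm_num)]
          exact ENNReal.ofReal_le_ofReal (sum_align_le hn (hf.2 Y) hη)
      _ = 4 * ∫⁻ θ, risk 1 f θ η ∂π := by
          rw [lintegral_const_mul _ (by fun_prop), ← lintegral_mixDensity π hη hlm]
          rfl
      _ ≤ 4 * R := by gcongr; exact hrisk η hη
  -- an estimator of the `i`-th label errs under one of the two hypotheses `η`, `flipLabel i η`
  have hpair : ∀ η ∈ labels n, ∀ i, 2 * b ≤ A η i + A (flipLabel i η) i := by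
    intro η hη i
    have hη' := flipLabel_mem_labels i hη
    simp only [A]
    rw [lintegral_mixDensity π hη (hGm η i), lintegral_mixDensity π hη' (hGm _ i),
      ← lintegral_add_left (hGd η i)]
    calc 2 * b
        ≤ 2 * ∫⁻ Y, min (mixDensity π η Y) (mixDensity π (flipLabel i η) Y) ∂(noise n p) := by
          gcongr; exact hb η hη i
      _ = ∫⁻ Y, 2 * min (mixDensity π η Y) (mixDensity π (flipLabel i η) Y) ∂(noise n p) := by
          rw [lintegral_const_mul]
          exact (measurable_mixDensity π η).min (measurable_mixDensity π _)
      _ ≤ _ := by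
          refine lintegral_mono fun Y => ?_
          have h2 : G η i Y + G (flipLabel i η) i Y = 2 := by
            simp only [G, align_flipLabel]
            rw [← ENNReal.ofReal_add (abs_nonneg _) (abs_nonneg _),
              show (2 : ENNReal) = ENNReal.ofReal 2 by simp]
            congr 1
            have hfl : flipLabel i η i = -η i := by simp [flipLabel]
            rw [hfl]
            rcases hf.2 Y i with h | h <;> rcases hη i with h' | h' <;>
              rcases align_eq (f Y) η i with h'' | h'' <;> norm_num [h, h', h'']
          rw [← h2, add_mul]
          exact add_le_add (mul_le_mul_right (min_le_left _ _) _)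
            (mul_le_mul_right (min_le_right _ _) _)
  have hone : ∀ i, (Fintype.card (Fin n → Bool)) * b ≤ ∑ c : Fin n → Bool, A (ofBool c) i := by
    intro i
    have e : ∑ c : Fin n → Bool, A (flipLabel i (ofBool c)) i =
        ∑ c : Fin n → Bool, A (ofBool c) i := by
      rw [← Equiv.sum_comp (flipEquiv i) fun c => A (ofBool c) i]
      exact Finset.sum_congr rfl fun c _ => by rw [ofBool_flipEquiv]
    have h1 : (Fintype.card (Fin n → Bool)) * (2 * b) ≤
        ∑ c : Fin n → Bool, (A (ofBool c) i + A (flipLabel i (ofBool c)) i) := by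
      rw [← nsmul_eq_mul]
      exact Finset.card_nsmul_le_sum _ _ _ fun c _ => hpair _ (ofBool_mem_labels c) i
    rw [Finset.sum_add_distrib, e, ← two_mul, mul_left_comm] at h1
    exact (ENNReal.mul_le_mul_iff_right (by norm_num) (by norm_num)).1 h1
  have hall : (Fintype.card (Fin n → Bool)) * (n * b) ≤
      (Fintype.card (Fin n → Bool)) * (4 * R) := by
    calc (Fintype.card (Fin n → Bool)) * (n * b)
        = ∑ _i : Fin n, (Fintype.card (Fin n → Bool)) * b := by
          rw [Finset.sum_const, Finset.card_univ, Fintype.card_fin, nsmul_eq_mul]; ring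
      _ ≤ ∑ i : Fin n, ∑ c : Fin n → Bool, A (ofBool c) i :=
          Finset.sum_le_sum fun i _ => hone i
      _ = ∑ c : Fin n → Bool, ∑ i : Fin n, A (ofBool c) i := Finset.sum_comm
      _ ≤ ∑ _c : Fin n → Bool, 4 * R :=
          Finset.sum_le_sum fun c _ => hup _ (ofBool_mem_labels c)
      _ = _ := by rw [Finset.sum_const, Finset.card_univ, nsmul_eq_mul]
  exact (ENNReal.mul_le_mul_iff_right (by simp) (by simp)).1 hall

/-! ### Overlap of the two hypotheses on a label -/

/-- A Jensen-type bound: if `exp h` has mass `c` and the tilts `exp (h ± t X)` have mass at most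
`c'`, then `exp (h - |X|)` has mass at least `exp (-A) c` for every `A ≥ c' / (t c)`. -/
theorem lintegral_exp_sub_abs_ge {Ω : Type*} [MeasurableSpace Ω] {μ : Measure Ω} {h X : Ω → ℝ}
    (hh : Measurable h) (hX : Measurable X) {c c' t A : ℝ} (hc : 0 ≤ c) (ht : 0 < t) (hA : 0 ≤ A)
    (h0 : ENNReal.ofReal c ≤ ∫⁻ x, ENNReal.ofReal (Real.exp (h x)) ∂μ)
    (h1 : ∫⁻ x, ENNReal.ofReal (Real.exp (h x + t * X x)) ∂μ ≤ ENNReal.ofReal c')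
    (h2 : ∫⁻ x, ENNReal.ofReal (Real.exp (h x + -t * X x)) ∂μ ≤ ENNReal.ofReal c')
    (hc' : 0 ≤ c') (hle : c' ≤ A * c * t) :
    ENNReal.ofReal (Real.exp (-A) * c) ≤ ∫⁻ x, ENNReal.ofReal (Real.exp (h x - |X x|)) ∂μ := by
  have hcosh : ∀ u : ℝ, 2 * |u| ≤ Real.exp u + Real.exp (-u) := by
    intro u
    have key : ∀ v : ℝ, 0 ≤ v → 2 * v ≤ Real.exp v := fun v hv => by
      have := Real.quadratic_le_exp_of_nonneg hv
      nlinarith [sq_nonneg (v - 1)]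
    rcases le_total 0 u with hu | hu
    · rw [abs_of_nonneg hu]
      have := key u hu
      linarith [Real.exp_pos (-u)]
    · rw [abs_of_nonpos hu]
      have := key (-u) (by linarith)
      linarith [Real.exp_pos u]
  have hpt : ∀ x, (1 + A) * Real.exp (-A) * Real.exp (h x) ≤ Real.exp (h x - |X x|) +
      (Real.exp (-A) / (2 * t) * Real.exp (h x + t * X x) +
        Real.exp (-A) / (2 * t) * Real.exp (h x + -t * X x)) := by
    intro x
    have e1 : Real.exp (-A) * (1 + A - |X x|) ≤ Real.exp (-|X x|) := by
      have := Real.add_one_le_exp (A - |X x|)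
      calc Real.exp (-A) * (1 + A - |X x|) ≤ Real.exp (-A) * Real.exp (A - |X x|) := by
            gcongr; linarith
        _ = _ := by rw [← Real.exp_add]; congr 1; ring
    have e2 : |X x| ≤ (Real.exp (t * X x) + Real.exp (-t * X x)) / (2 * t) := by
      rw [le_div_iff₀ (by positivity)]
      have := hcosh (t * X x)
      rw [abs_mul, abs_of_pos ht, ← neg_mul] at this
      linarith
    have e3 : Real.exp (-A) * |X x| ≤
        Real.exp (-A) * ((Real.exp (t * X x) + Real.exp (-t * X x)) / (2 * t)) := by gcongr
    have e4 : (1 + A) * Real.exp (-A) ≤ Real.exp (-|X x|) +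
        Real.exp (-A) * ((Real.exp (t * X x) + Real.exp (-t * X x)) / (2 * t)) := by linarith
    rw [sub_eq_add_neg, Real.exp_add, Real.exp_add, Real.exp_add]
    calc (1 + A) * Real.exp (-A) * Real.exp (h x) ≤ (Real.exp (-|X x|) +
        Real.exp (-A) * ((Real.exp (t * X x) + Real.exp (-t * X x)) / (2 * t))) *
          Real.exp (h x) := by gcongr
      _ = _ := by ring
  have hint : ENNReal.ofReal ((1 + A) * Real.exp (-A)) *
      ∫⁻ x, ENNReal.ofReal (Real.exp (h x)) ∂μ ≤
      ∫⁻ x, ENNReal.ofReal (Real.exp (h x - |X x|)) ∂μ +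
        (ENNReal.ofReal (Real.exp (-A) / (2 * t)) *
          ∫⁻ x, ENNReal.ofReal (Real.exp (h x + t * X x)) ∂μ +
        ENNReal.ofReal (Real.exp (-A) / (2 * t)) *
          ∫⁻ x, ENNReal.ofReal (Real.exp (h x + -t * X x)) ∂μ) := by
    rw [← lintegral_const_mul _ (by fun_prop), ← lintegral_const_mul _ (by fun_prop),
      ← lintegral_const_mul _ (by fun_prop), ← lintegral_add_left (by fun_prop),
      ← lintegral_add_right _ (by fun_prop)]
    refine lintegral_mono fun x => ?_
    have := ENNReal.ofReal_le_ofReal (hpt x)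
    rwa [ENNReal.ofReal_mul (p := (1 + A) * Real.exp (-A)) (by positivity),
      ENNReal.ofReal_add (by positivity) (by positivity),
      ENNReal.ofReal_add (by positivity) (by positivity),
      ENNReal.ofReal_mul (p := Real.exp (-A) / (2 * t)) (by positivity),
      ENNReal.ofReal_mul (p := Real.exp (-A) / (2 * t)) (by positivity)] at this
  set I := ∫⁻ x, ENNReal.ofReal (Real.exp (h x - |X x|)) ∂μ
  have hfin : ENNReal.ofReal (Real.exp (-A) * c) + ENNReal.ofReal (Real.exp (-A) * (A * c)) ≤
      I + ENNReal.ofReal (Real.exp (-A) * (A * c)) := by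
    calc _ = ENNReal.ofReal ((1 + A) * Real.exp (-A)) * ENNReal.ofReal c := by
          rw [← ENNReal.ofReal_add (by positivity) (by positivity),
            ← ENNReal.ofReal_mul (by positivity)]
          congr 1; ring
      _ ≤ _ := by gcongr
      _ ≤ _ := hint
      _ ≤ I + (ENNReal.ofReal (Real.exp (-A) / (2 * t)) * ENNReal.ofReal c' +
          ENNReal.ofReal (Real.exp (-A) / (2 * t)) * ENNReal.ofReal c') := by gcongr
      _ ≤ _ := by
          gcongr
          rw [← ENNReal.ofReal_mul (by positivity), ← ENNReal.ofReal_add (by positivity)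
            (by positivity)]
          refine ENNReal.ofReal_le_ofReal ?_
          calc _ = Real.exp (-A) * (c' / t) := by field_simp; ring
            _ ≤ _ := by
              gcongr
              rwa [div_le_iff₀ ht]
  exact (ENNReal.add_le_add_iff_right ENNReal.ofReal_ne_top).1 hfin

theorem sum_smul_eq {m p : ℕ} (i : Fin (m + 1)) (η : Fin (m + 1) → ℝ) (Y : Sample (m + 1) p) :
    ∑ j, η j • Y j = η i • Y i + ∑ j, η (i.succAbove j) • Y (i.succAbove j) :=
  Fin.sum_univ_succAbove _ i

theorem sum_flipLabel_smul_eq {m p : ℕ} (i : Fin (m + 1)) (η : Fin (m + 1) → ℝ)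
    (Y : Sample (m + 1) p) : ∑ j, flipLabel i η j • Y j =
      -(η i • Y i) + ∑ j, η (i.succAbove j) • Y (i.succAbove j) := by
  rw [sum_smul_eq i]
  congr 1
  · simp [flipLabel]
  · exact Finset.sum_congr rfl fun j _ => by simp [flipLabel, Fin.succAbove_ne]

/-- For a known centre `θ`, the two densities that differ in the label `i` are `exp (h ± X)`; this
is the mass of `exp (h + t X)`. -/
theorem lintegral_exp_known {m p : ℕ} (i : Fin (m + 1)) {η : Fin (m + 1) → ℝ} (hη : η ∈ labels _)
    (θ : EuclideanSpace ℝ (Fin p)) (t : ℝ) :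
    ∫⁻ Y, ENNReal.ofReal (Real.exp (inner ℝ θ (∑ j, η (i.succAbove j) • Y (i.succAbove j)) -
        (m + 1 : ℕ) * ‖θ‖ ^ 2 / 2 + t * inner ℝ θ (Y i))) ∂(noise (m + 1) p) =
      ENNReal.ofReal (Real.exp ((t ^ 2 - 1) * ‖θ‖ ^ 2 / 2)) := by
  have hsq : √(m : ℝ) ^ 2 = m := Real.sq_sqrt (Nat.cast_nonneg m)
  rw [lintegral_noise_split i hη (fun y s => ENNReal.ofReal (Real.exp (inner ℝ θ s -
        (m + 1 : ℕ) * ‖θ‖ ^ 2 / 2 + t * inner ℝ θ y))) (by fun_prop)]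
  have hlin : ∀ v : EuclideanSpace ℝ (Fin p),
      ∫⁻ y, ENNReal.ofReal (Real.exp (inner ℝ v y)) ∂(gauss p) =
        ENNReal.ofReal (Real.exp (‖v‖ ^ 2 / 2)) := by
    intro v
    have := lintegral_exp_quadratic_gauss v 0 (by norm_num)
    simpa using this
  have h1 : ∀ z y : EuclideanSpace ℝ (Fin p), ENNReal.ofReal (Real.exp (inner ℝ θ (√(m : ℝ) • z) -
      (m + 1 : ℕ) * ‖θ‖ ^ 2 / 2 + t * inner ℝ θ y)) =
      ENNReal.ofReal (Real.exp (-((m + 1 : ℕ) * ‖θ‖ ^ 2 / 2))) *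
        ENNReal.ofReal (Real.exp (inner ℝ (√(m : ℝ) • θ) z)) *
        ENNReal.ofReal (Real.exp (inner ℝ (t • θ) y)) := by
    intro z y
    rw [← ENNReal.ofReal_mul (by positivity), ← ENNReal.ofReal_mul (by positivity),
      ← Real.exp_add, ← Real.exp_add, real_inner_smul_left, real_inner_smul_left,
      real_inner_smul_right]
    congr 2; ring
  simp_rw [h1]
  have h2 : ∀ z : EuclideanSpace ℝ (Fin p), ∫⁻ y,
      ENNReal.ofReal (Real.exp (-((m + 1 : ℕ) * ‖θ‖ ^ 2 / 2))) *
        ENNReal.ofReal (Real.exp (inner ℝ (√(m : ℝ) • θ) z)) *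
        ENNReal.ofReal (Real.exp (inner ℝ (t • θ) y)) ∂(gauss p) =
      ENNReal.ofReal (Real.exp (-((m + 1 : ℕ) * ‖θ‖ ^ 2 / 2))) *
        ENNReal.ofReal (Real.exp (‖t • θ‖ ^ 2 / 2)) *
        ENNReal.ofReal (Real.exp (inner ℝ (√(m : ℝ) • θ) z)) := by
    intro z
    rw [lintegral_const_mul _ (by fun_prop), hlin, mul_right_comm]
  simp_rw [h2]
  rw [lintegral_const_mul _ (by fun_prop), hlin, ← ENNReal.ofReal_mul (by positivity),
    ← ENNReal.ofReal_mul (by positivity), ← Real.exp_add, ← Real.exp_add]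
  have n1 : ∀ a : ℝ, ‖a • θ‖ ^ 2 = a ^ 2 * ‖θ‖ ^ 2 := fun a => by
    rw [norm_smul, mul_pow, Real.norm_eq_abs, sq_abs]
  rw [n1, n1, hsq]
  congr 2
  push_cast
  ring

theorem exp_half_le_two : Real.exp (1 / 2) ≤ 2 := by
  have h1 : Real.exp (1 / 2) ^ 2 ≤ 2 ^ 2 := by
    rw [← Real.exp_nat_mul]
    norm_num
    linarith [Real.exp_one_lt_d9]
  exact le_of_sq_le_sq h1 (by norm_num)

/-- A lower bound for the overlap when the centre `θ` is known. -/
theorem overlap_dirac {m p : ℕ} {θ : EuclideanSpace ℝ (Fin p)} (hθ : θ ≠ 0)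
    {η : Fin (m + 1) → ℝ} (hη : η ∈ labels _) (i : Fin (m + 1)) :
    ENNReal.ofReal (Real.exp (-(2 * ‖θ‖)) * Real.exp (-(‖θ‖ ^ 2 / 2))) ≤
      ∫⁻ Y, min (mixDensity (Measure.dirac θ) η Y) (mixDensity (Measure.dirac θ) (flipLabel i η) Y)
        ∂(noise (m + 1) p) := by
  have hT : 0 < ‖θ‖ := norm_pos_iff.2 hθ
  set h : Sample (m + 1) p → ℝ := fun Y =>
    inner ℝ θ (∑ j, η (i.succAbove j) • Y (i.succAbove j)) - (m + 1 : ℕ) * ‖θ‖ ^ 2 / 2 with hh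
  set X : Sample (m + 1) p → ℝ := fun Y => inner ℝ θ (Y i) with hX
  have hI : ∀ t : ℝ, ∫⁻ Y, ENNReal.ofReal (Real.exp (h Y + t * X Y)) ∂(noise (m + 1) p) =
      ENNReal.ofReal (Real.exp ((t ^ 2 - 1) * ‖θ‖ ^ 2 / 2)) := lintegral_exp_known i hη θ
  have htt : Real.exp (((‖θ‖⁻¹) ^ 2 - 1) * ‖θ‖ ^ 2 / 2) ≤ 2 * Real.exp (-(‖θ‖ ^ 2 / 2)) := by
    have e : ((‖θ‖⁻¹) ^ 2 - 1) * ‖θ‖ ^ 2 / 2 = 1 / 2 + -(‖θ‖ ^ 2 / 2) := by field_simp; ring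
    rw [e, Real.exp_add]
    gcongr
    exact exp_half_le_two
  have key := lintegral_exp_sub_abs_ge (μ := noise (m + 1) p) (h := h) (X := X) (by fun_prop)
    (by fun_prop) (c := Real.exp (-(‖θ‖ ^ 2 / 2))) (c' := 2 * Real.exp (-(‖θ‖ ^ 2 / 2)))
    -- `t = 1 / ‖θ‖` costs the tilted masses a factor `exp (1 / 2) ≤ 2` only
    (t := ‖θ‖⁻¹) (A := 2 * ‖θ‖) (by positivity) (by positivity) (by positivity)
    (by
      have := hI 0
      simp only [zero_mul, add_zero] at this
      rw [this]
      exact ENNReal.ofReal_le_ofReal (le_of_eq (by congr 1; ring)))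
    (by rw [hI]; exact ENNReal.ofReal_le_ofReal htt)
    (by rw [hI, neg_sq]; exact ENNReal.ofReal_le_ofReal htt) (by positivity)
    (le_of_eq (by field_simp))
  refine key.trans (lintegral_mono fun Y => ?_)
  simp only [mixDensity, lintegral_dirac]
  have habs : |inner ℝ θ (η i • Y i)| = |X Y| := by
    rw [real_inner_smul_right, abs_mul]
    rcases hη i with h' | h' <;> simp [h', hX]
  refine le_min (ENNReal.ofReal_le_ofReal (Real.exp_le_exp.2 ?_))
    (ENNReal.ofReal_le_ofReal (Real.exp_le_exp.2 ?_))
  · rw [sum_smul_eq i, inner_add_right, ← habs]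
    simp only [hh]
    linarith [neg_abs_le (inner ℝ θ (η i • Y i))]
  · rw [sum_flipLabel_smul_eq i, inner_add_right, inner_neg_right, ← habs]
    simp only [hh]
    linarith [le_abs_self (inner ℝ θ (η i • Y i))]

/-- The density of the mixture over a centred Gaussian prior. -/
theorem mixDensity_gauss {n p : ℕ} (α : ℝ) (η : Fin n → ℝ) (Y : Sample n p) :
    mixDensity ((gauss p).map fun z => α • z) η Y =
      ENNReal.ofReal ((√(1 + n * α ^ 2))⁻¹ ^ p) *
        ENNReal.ofReal (Real.exp (α ^ 2 / (1 + n * α ^ 2) / 2 * ‖∑ i, η i • Y i‖ ^ 2)) := by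
  rw [mixDensity, lintegral_map (by fun_prop) (by fun_prop)]
  set S := ∑ i, η i • Y i
  have h : ∀ z : EuclideanSpace ℝ (Fin p), ENNReal.ofReal (Real.exp (inner ℝ (α • z) S -
      n * ‖α • z‖ ^ 2 / 2)) = ENNReal.ofReal (Real.exp (inner ℝ (α • S) z +
      -(n * α ^ 2) / 2 * ‖z‖ ^ 2)) := by
    intro z
    rw [norm_smul, mul_pow, Real.norm_eq_abs, sq_abs, real_inner_smul_left, real_inner_smul_left,
      real_inner_comm S z]
    congr 2; ring
  simp_rw [h]
  have hpos : 0 ≤ n * α ^ 2 := by positivity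
  rw [lintegral_exp_quadratic_gauss _ _ (by linarith), sub_neg_eq_add,
    ENNReal.ofReal_mul (by positivity), norm_smul, mul_pow, Real.norm_eq_abs, sq_abs]
  congr 3
  field_simp

/-- The analogue of `lintegral_exp_known` for a Gaussian prior, where `h` and `X` are quadratic
forms. -/
theorem lintegral_exp_gauss_pair {m p : ℕ} (i : Fin (m + 1)) {η : Fin (m + 1) → ℝ}
    (hη : η ∈ labels _) {κ r : ℝ} (hκ : κ < 1) (hr : m * (κ + r ^ 2 / (1 - κ)) < 1) :
    ∫⁻ Y, ENNReal.ofReal (Real.exp (κ / 2 * (‖∑ j, η (i.succAbove j) • Y (i.succAbove j)‖ ^ 2 +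
        ‖Y i‖ ^ 2) + r * inner ℝ (∑ j, η (i.succAbove j) • Y (i.succAbove j)) (Y i)))
        ∂(noise (m + 1) p) =
      ENNReal.ofReal ((√((1 - κ) * (1 - m * κ) - m * r ^ 2))⁻¹ ^ p) := by
  have hsq : √(m : ℝ) ^ 2 = m := Real.sq_sqrt (Nat.cast_nonneg m)
  have hκ0 : 0 < 1 - κ := by linarith
  rw [lintegral_noise_split i hη (fun y s => ENNReal.ofReal (Real.exp (κ / 2 * (‖s‖ ^ 2 +
        ‖y‖ ^ 2) + r * inner ℝ s y))) (by fun_prop)]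
  have hin : ∀ z : EuclideanSpace ℝ (Fin p), ∫⁻ y, ENNReal.ofReal (Real.exp (κ / 2 *
      (‖√(m : ℝ) • z‖ ^ 2 + ‖y‖ ^ 2) + r * inner ℝ (√(m : ℝ) • z) y)) ∂(gauss p) =
      ENNReal.ofReal ((√(1 - κ))⁻¹ ^ p) * ENNReal.ofReal (Real.exp (inner ℝ 0 z +
        m * (κ + r ^ 2 / (1 - κ)) / 2 * ‖z‖ ^ 2)) := by
    intro z
    set s := √(m : ℝ) • z with hs
    have hsn : ‖s‖ ^ 2 = m * ‖z‖ ^ 2 := by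
      rw [hs, norm_smul, mul_pow, Real.norm_eq_abs, sq_abs, hsq]
    have e : ∀ y : EuclideanSpace ℝ (Fin p), ENNReal.ofReal (Real.exp (κ / 2 *
        (‖s‖ ^ 2 + ‖y‖ ^ 2) + r * inner ℝ s y)) = ENNReal.ofReal (Real.exp (κ / 2 * ‖s‖ ^ 2)) *
        ENNReal.ofReal (Real.exp (inner ℝ (r • s) y + κ / 2 * ‖y‖ ^ 2)) := by
      intro y
      rw [← ENNReal.ofReal_mul (by positivity), ← Real.exp_add, real_inner_smul_left s y r]
      congr 2; ring
    have hrs : ‖r • s‖ ^ 2 = r ^ 2 * (m * ‖z‖ ^ 2) := by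
      rw [norm_smul r s, mul_pow, Real.norm_eq_abs, sq_abs, hsn]
    simp_rw [e]
    rw [lintegral_const_mul _ (by fun_prop), lintegral_exp_quadratic_gauss _ _ hκ,
      ← ENNReal.ofReal_mul (by positivity), ← ENNReal.ofReal_mul (by positivity), mul_left_comm,
      ← Real.exp_add, hrs, hsn, inner_zero_left]
    congr 3
    field_simp
    ring
  simp_rw [hin]
  rw [lintegral_const_mul _ (by fun_prop), lintegral_exp_quadratic_gauss _ _ hr,
    ← ENNReal.ofReal_mul (by positivity)]
  congr 1
  simp only [norm_zero, ne_eq, OfNat.ofNat_ne_zero, not_false_eq_true, zero_pow, zero_div,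
    Real.exp_zero, mul_one]
  rw [← mul_pow, ← mul_inv, ← Real.sqrt_mul hκ0.le]
  congr 3
  field_simp
  ring

/-- A lower bound for the overlap when the centre is drawn from the centred Gaussian prior of
variance `α²`. -/
theorem overlap_gauss {m p : ℕ} (hm : 1 ≤ m) (hp : 1 ≤ p) {α : ℝ} (hα : 0 < α)
    {η : Fin (m + 1) → ℝ} (hη : η ∈ labels _) (i : Fin (m + 1)) {Q : ℝ}
    (hQ : Q = p * (m * α ^ 4 / (1 + (m + 1 : ℕ) * α ^ 2))) :
    ENNReal.ofReal (Real.exp (-(3 * √Q)) * Real.exp (-(Q / 2))) ≤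
      ∫⁻ Y, min (mixDensity ((gauss p).map fun z => α • z) η Y)
        (mixDensity ((gauss p).map fun z => α • z) (flipLabel i η) Y) ∂(noise (m + 1) p) := by
  have hm0 : (0 : ℝ) < m := by exact_mod_cast hm
  have hp0 : (1 : ℝ) ≤ p := by exact_mod_cast hp
  set b : ℝ := 1 + (m + 1 : ℕ) * α ^ 2 with hb
  have hb0 : 0 < b := by positivity
  have hbm : b = 1 + m * α ^ 2 + α ^ 2 := by rw [hb]; push_cast; ring
  set q := m * α ^ 4 / b with hq
  have hq0 : 0 < q := by positivity
  have hQ0 : 0 < Q := by rw [hQ]; positivity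
  set κ := α ^ 2 / b with hκ
  have hκ1 : κ < 1 := by
    rw [hκ, div_lt_one hb0, hbm]
    have : 0 < m * α ^ 2 := by positivity
    linarith
  have h1κ : 1 - κ = (1 + m * α ^ 2) / b := by rw [hκ, hbm]; field_simp; ring
  have h1κ0 : 0 < 1 - κ := by linarith
  set C : ℝ := (√b)⁻¹ ^ p with hC
  have hC0 : 0 < C := by positivity
  set h : Sample (m + 1) p → ℝ := fun Y =>
    κ / 2 * (‖∑ j, η (i.succAbove j) • Y (i.succAbove j)‖ ^ 2 + ‖Y i‖ ^ 2) with hh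
  set X : Sample (m + 1) p → ℝ := fun Y =>
    κ * inner ℝ (∑ j, η (i.succAbove j) • Y (i.succAbove j)) (Y i) with hX
  have hdet : ∀ t : ℝ, (1 - κ) * (1 - m * κ) - m * (t * κ) ^ 2 = (1 + q * (1 - t ^ 2)) / b := by
    intro t
    rw [h1κ, hκ, hq, hbm]
    have : 1 + m * α ^ 2 + α ^ 2 ≠ 0 := by rw [← hbm]; exact hb0.ne'
    field_simp
    ring
  -- the mass of the tilted geometric mean of the two densities
  have hI : ∀ t : ℝ, 0 < 1 + q * (1 - t ^ 2) →
      ∫⁻ Y, ENNReal.ofReal (Real.exp (h Y + t * X Y)) ∂(noise (m + 1) p) =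
        ENNReal.ofReal (C⁻¹ * (√(1 + q * (1 - t ^ 2)))⁻¹ ^ p) := by
    intro t ht
    have hr : m * (κ + (t * κ) ^ 2 / (1 - κ)) < 1 := by
      have h1 : 0 < (1 - κ) * (1 - m * (κ + (t * κ) ^ 2 / (1 - κ))) := by
        have : (1 - κ) * (1 - m * (κ + (t * κ) ^ 2 / (1 - κ))) =
            (1 - κ) * (1 - m * κ) - m * (t * κ) ^ 2 := by field_simp; ring
        rw [this, hdet]; positivity
      have := (mul_pos_iff_of_pos_left h1κ0).1 h1
      linarith
    have := lintegral_exp_gauss_pair (p := p) i hη hκ1 hr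
    rw [hdet] at this
    have e : (√((1 + q * (1 - t ^ 2)) / b))⁻¹ ^ p = C⁻¹ * (√(1 + q * (1 - t ^ 2)))⁻¹ ^ p := by
      rw [hC, Real.sqrt_div ht.le, inv_div, div_pow, inv_pow, inv_pow, inv_inv, div_eq_mul_inv]
    rw [← e, ← this]
    refine lintegral_congr fun Y => ?_
    simp only [hh, hX]
    congr 2; ring
  -- this tilt changes the mass by a factor of at most `2`, because `q t² = 1 / (2 p)`
  set t := (√(2 * Q))⁻¹ with ht
  have ht0 : 0 < t := by positivity
  have ht2 : t ^ 2 = 1 / (2 * Q) := by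
    rw [ht, inv_pow, Real.sq_sqrt (by positivity), one_div]
  have hqt : q * t ^ 2 = 1 / (2 * p) := by
    rw [ht2, hQ]; field_simp
  have hp2 : 1 / (2 * (p : ℝ)) ≤ 1 / 2 := by
    rw [div_le_div_iff₀ (by positivity) two_pos]; linarith
  have hpos : 0 < 1 + q * (1 - t ^ 2) := by
    rw [mul_sub, hqt]; linarith
  set F0 : ℝ := C⁻¹ * (√(1 + q))⁻¹ ^ p with hF0
  have hF : C⁻¹ * (√(1 + q * (1 - t ^ 2)))⁻¹ ^ p ≤ 2 * F0 := by
    set u := 1 / (2 * p * (1 + q)) with hu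
    have hu0 : 0 ≤ u := by positivity
    have hup : p * u ≤ 1 / 2 := by
      have : p * u = 1 / 2 * (1 / (1 + q)) := by rw [hu]; field_simp
      rw [this]
      have : 1 / (1 + q) ≤ 1 := by rw [div_le_one (by positivity)]; linarith
      linarith
    have hu1 : u ≤ 1 / 2 := by nlinarith
    have e1 : 1 + q * (1 - t ^ 2) = (1 + q) * (1 - u) := by
      rw [mul_sub, hqt, hu]; field_simp; ring
    rw [e1, Real.sqrt_mul (by positivity), mul_inv, mul_pow, hF0]
    have e2 : (√(1 - u))⁻¹ ^ p ≤ 2 := by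
      calc (√(1 - u))⁻¹ ^ p ≤ Real.exp (u / 2 + u ^ 2 / 2) ^ p := by
            gcongr
            exact inv_sqrt_one_sub_le (by rwa [abs_of_nonneg hu0])
        _ = Real.exp (p * (u / 2 + u ^ 2 / 2)) := by rw [Real.exp_nat_mul]
        _ ≤ Real.exp (1 / 2) := by
            gcongr
            have : p * (u / 2 + u ^ 2 / 2) = p * u * (1 / 2 + u / 2) := by ring
            rw [this]
            have h3 : p * u * (1 / 2 + u / 2) ≤ 1 / 2 * 1 := by
              gcongr
              linarith
            linarith
        _ ≤ 2 := exp_half_le_two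
    calc C⁻¹ * ((√(1 + q))⁻¹ ^ p * (√(1 - u))⁻¹ ^ p) ≤ C⁻¹ * ((√(1 + q))⁻¹ ^ p * 2) := by gcongr
      _ = _ := by ring
  have hF00 : 0 < F0 := by positivity
  have key := lintegral_exp_sub_abs_ge (μ := noise (m + 1) p) (h := h) (X := X) (by fun_prop)
    (by fun_prop) (c := F0) (c' := 2 * F0) (t := t) (A := 3 * √Q) hF00.le ht0 (by positivity)
    (by
      have := hI 0 (by simp; positivity)
      simp only [zero_mul, add_zero, ne_eq, OfNat.ofNat_ne_zero, not_false_eq_true, zero_pow,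
        sub_zero, mul_one] at this
      rw [this])
    (by rw [hI t hpos]; exact ENNReal.ofReal_le_ofReal hF)
    (by rw [hI (-t) (by rwa [neg_sq]), neg_sq]; exact ENNReal.ofReal_le_ofReal hF) (by positivity)
    (by
      have h2 : √2 ≤ 3 / 2 := by
        rw [Real.sqrt_le_left (by norm_num)]; norm_num
      have hsQ : 0 < √Q := Real.sqrt_pos.2 hQ0
      have e : 3 * √Q * F0 * t = F0 * (3 / √2) := by
        rw [ht, Real.sqrt_mul (by norm_num)]; field_simp
      rw [e, mul_comm]
      gcongr
      rw [le_div_iff₀ (by positivity)]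
      linarith)
  have hmass : Real.exp (-(3 * √Q)) * Real.exp (-(Q / 2)) ≤ C * (Real.exp (-(3 * √Q)) * F0) := by
    have e : C * (Real.exp (-(3 * √Q)) * F0) = Real.exp (-(3 * √Q)) * (√(1 + q))⁻¹ ^ p := by
      rw [hF0]; field_simp
    rw [e]
    gcongr
    have h1 : √(1 + q) ≤ Real.exp (q / 2) := by
      rw [Real.sqrt_le_left (Real.exp_pos _).le, ← Real.exp_nat_mul]
      have := Real.add_one_le_exp q
      calc 1 + q ≤ Real.exp q := by linarith
        _ = _ := by congr 1; push_cast; ring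
    have h2 : (√(1 + q)) ^ p ≤ Real.exp (q / 2) ^ p := by gcongr
    rw [inv_pow, Real.exp_neg]
    gcongr
    refine h2.trans (le_of_eq ?_)
    rw [← Real.exp_nat_mul, hQ]
    congr 1; ring
  refine (ENNReal.ofReal_le_ofReal hmass).trans ?_
  rw [ENNReal.ofReal_mul hC0.le]
  refine (mul_le_mul_right key _).trans ?_
  rw [← lintegral_const_mul _ (by fun_prop)]
  refine lintegral_mono fun Y => ?_
  simp only [mixDensity_gauss]
  have hn1 : ‖η i • Y i‖ ^ 2 = ‖Y i‖ ^ 2 := by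
    rcases hη i with h' | h' <;> simp [h']
  set S := ∑ j, η (i.succAbove j) • Y (i.succAbove j) with hS
  have habs : κ * |inner ℝ (η i • Y i) S| = |X Y| := by
    rw [real_inner_smul_left, abs_mul, real_inner_comm]
    simp only [hX, abs_mul]
    rw [abs_of_pos (by positivity : 0 < κ)]
    rcases hη i with h' | h' <;> simp [h', hS]
  have hκ0 : 0 < κ := by positivity
  refine le_min (mul_le_mul_right (ENNReal.ofReal_le_ofReal (Real.exp_le_exp.2 ?_)) _)
    (mul_le_mul_right (ENNReal.ofReal_le_ofReal (Real.exp_le_exp.2 ?_)) _)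
  · rw [sum_smul_eq i, ← hS, norm_add_sq_real, hn1, ← habs]
    have := mul_le_mul_of_nonneg_left (neg_abs_le (inner ℝ (η i • Y i) S)) hκ0.le
    simp only [hh, ← hS]
    linarith
  · rw [sum_flipLabel_smul_eq i, ← hS, norm_add_sq_real, norm_neg, hn1, ← habs, inner_neg_left]
    have := mul_le_mul_of_nonneg_left (le_abs_self (inner ℝ (η i • Y i) S)) hκ0.le
    simp only [hh, ← hS]
    linarith

/-! ### Impossibility below the threshold -/

/-- If `n` times the overlap exceeds `8` and the prior hardly charges centres of norm below `Δ`,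
then the maximal risk is at least `1`. -/
theorem one_le_maxRisk_of_overlap {n p : ℕ} (hn : 2 ≤ n) {Δ : ℝ} {f : Sample n p → Fin n → ℝ}
    (hf : IsEstimator f) (π : Measure (EuclideanSpace ℝ (Fin p))) [IsProbabilityMeasure π] {b : ℝ}
    (hb : ∀ η ∈ labels n, ∀ i, ENNReal.ofReal b ≤
      ∫⁻ Y, min (mixDensity π η Y) (mixDensity π (flipLabel i η) Y) ∂(noise n p))
    (hnb : 8 ≤ n * b) (hπ : ENNReal.ofReal (2 * n) * π {θ | ‖θ‖ < Δ} ≤ 1) :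
    1 ≤ maxRisk 1 Δ f := by
  have h := bayes_lower hn Δ hf π hb
  have h8 : (4 : ENNReal) * 2 ≤ n * ENNReal.ofReal b := by
    rw [← ENNReal.ofReal_natCast, ← ENNReal.ofReal_mul (Nat.cast_nonneg n)]
    have := ENNReal.ofReal_le_ofReal hnb
    refine le_trans (le_of_eq ?_) this
    norm_num
  have h2 : (4 : ENNReal) * 2 ≤ 4 * (maxRisk 1 Δ f + 1) :=
    h8.trans (h.trans (by gcongr))
  have h3 : (2 : ENNReal) ≤ maxRisk 1 Δ f + 1 :=
    (ENNReal.mul_le_mul_iff_right (by norm_num) (by norm_num)).1 h2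
  rw [← one_add_one_eq_two] at h3
  exact (ENNReal.add_le_add_iff_right ENNReal.one_ne_top).1 h3

/-- Below the threshold and in low dimension, `p ≤ ε n log n`, the risk is large already when the
centre `θ` is known. -/
theorem one_le_maxRisk_of_low_dim {n p : ℕ} (hn : 2 ≤ n) (hp : 1 ≤ p) {ε : ℝ} (hε : 0 < ε)
    (hε1 : ε < 1) {Δ : ℝ} {f : Sample n p → Fin n → ℝ} (hf : IsEstimator f)
    (hΔ : Δ ≤ (1 - ε) * threshold n p 1)
    (hgap : 8 ≤ n * Real.exp (-((1 - ε) * Real.log n + 5 * √(Real.log n))))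
    (hcase : (p : ℝ) ≤ ε * n * Real.log n) : 1 ≤ maxRisk 1 Δ f := by
  obtain ⟨m, rfl⟩ : ∃ m, n = m + 1 := ⟨n - 1, by omega⟩
  have hn0 : (0 : ℝ) < ((m + 1 : ℕ) : ℝ) := by positivity
  obtain ⟨hD1, hD2⟩ := threshold_sq_sq (n := m + 1) (p := p) hn
  have hτ0 := threshold_pos (p := p) hn
  have hL0 : 0 < Real.log ((m + 1 : ℕ) : ℝ) := Real.log_pos (by exact_mod_cast (by omega))
  set x : ℝ := ((m + 1 : ℕ) : ℝ) with hx
  set L := Real.log x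
  set τ := threshold (m + 1) p 1
  set D := τ ^ 2 with hD
  have hD0 : 0 < D := by positivity
  have hε' : 0 < 1 - ε := by linarith
  set r := √L
  have hr2 : r ^ 2 = L := Real.sq_sqrt hL0.le
  set T := (1 - ε) * τ with hT
  have hT0 : 0 < T := by positivity
  set θ : EuclideanSpace ℝ (Fin p) := EuclideanSpace.single ⟨0, hp⟩ T with hθ
  have hθn : ‖θ‖ = T := by rw [hθ, PiLp.norm_single, Real.norm_of_nonneg hT0.le]
  have hDle : D ≤ (2 + ε) * L := by
    have hc : p / x ≤ ε * L := by rw [div_le_iff₀ hn0]; linarith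
    by_contra! hcon
    have h1 : 2 * L * (D + p / x) ≤ 2 * L * (D + ε * L) := by gcongr
    nlinarith [mul_pos hε (mul_pos hL0 hL0)]
  have hT2 : T ^ 2 ≤ 2 * ((1 - ε) * L) := by
    have h1 : T ^ 2 = (1 - ε) ^ 2 * D := by rw [hT, hD]; ring
    have h2 : (1 - ε) ^ 2 * D ≤ (1 - ε) ^ 2 * ((2 + ε) * L) := by gcongr
    have h3 : (1 - ε) * (2 + ε) ≤ 2 := by nlinarith
    calc T ^ 2 ≤ _ := h1.trans_le h2
      _ = (1 - ε) * ((1 - ε) * (2 + ε)) * L := by ring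
      _ ≤ (1 - ε) * 2 * L := by gcongr
      _ = _ := by ring
  have hTr : T ≤ 2 * r := by
    refine le_of_sq_le_sq ?_ (by positivity)
    have e : (2 * r) ^ 2 = 4 * L := by rw [mul_pow, hr2]; norm_num
    rw [e]
    linarith [mul_pos hε hL0]
  refine one_le_maxRisk_of_overlap hn hf (Measure.dirac θ)
    (b := Real.exp (-(2 * ‖θ‖)) * Real.exp (-(‖θ‖ ^ 2 / 2)))
    (fun η hη i => overlap_dirac (norm_pos_iff.1 (by rw [hθn]; exact hT0)) hη i)
    (hgap.trans ?_) ?_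
  · rw [← Real.exp_add, hθn, ← hx]
    gcongr
    have hr0 : 0 ≤ r := Real.sqrt_nonneg _
    linarith
  · have : (Measure.dirac θ) {θ' : EuclideanSpace ℝ (Fin p) | ‖θ'‖ < Δ} = 0 := by
      rw [Measure.dirac_apply' _ (measurableSet_lt measurable_norm measurable_const)]
      refine Set.indicator_of_notMem ?_ _
      simp only [Set.mem_ofPred_eq, not_lt, hθn]
      exact hΔ
    rw [this, mul_zero]
    exact zero_le_one

/-- Below the threshold and in high dimension, `p > ε n log n`, the risk is large for a centre with
a Gaussian prior: its norm is concentrated, so that the prior charges small centres very little. -/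
theorem one_le_maxRisk_of_high_dim {n p : ℕ} (hn : 2 ≤ n) (hp : 1 ≤ p) {ε : ℝ} (hε : 0 < ε)
    (hε1 : ε < 1) {Δ : ℝ} {f : Sample n p → Fin n → ℝ} (hf : IsEstimator f)
    (hΔ : Δ ≤ (1 - ε) * threshold n p 1) (hL1 : 1 ≤ Real.log n)
    (hgap : 8 ≤ n * Real.exp (-((1 - ε) * Real.log n + 5 * √(Real.log n))))
    (hprior : 2 * n * Real.exp (-(ε ^ 3 / 8 * n)) ≤ 1)
    (hcase : ε * n * Real.log n < p) : 1 ≤ maxRisk 1 Δ f := by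
  obtain ⟨m, rfl⟩ : ∃ m, n = m + 1 := ⟨n - 1, by omega⟩
  have hn0 : (0 : ℝ) < ((m + 1 : ℕ) : ℝ) := by positivity
  have hp0 : (0 : ℝ) < p := by exact_mod_cast hp
  obtain ⟨hD1, hD2⟩ := threshold_sq_sq (n := m + 1) (p := p) hn
  have hτ0 := threshold_pos (p := p) hn
  set x : ℝ := ((m + 1 : ℕ) : ℝ) with hx
  set L := Real.log x
  set τ := threshold (m + 1) p 1
  set D := τ ^ 2 with hD
  have hD0 : 0 < D := by positivity
  have hL0 : 0 < L := by linarith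
  have hε' : 0 < 1 - ε := by linarith
  set r := √L
  have hr2 : r ^ 2 = L := Real.sq_sqrt hL0.le
  have hr0 : 0 ≤ r := Real.sqrt_nonneg _
  -- under the prior `‖θ‖²` has mean `(1 - ε) D`, strictly between `(1 - ε)² D` and `D`
  set y := (1 - ε) * D with hy
  have hy0 : 0 < y := by positivity
  set α := √(y / p) with hα
  have hα2 : α ^ 2 = y / p := Real.sq_sqrt (by positivity)
  have hα0 : 0 < α := Real.sqrt_pos.2 (by positivity)
  set Q : ℝ := p * (m * α ^ 4 / (1 + (m + 1 : ℕ) * α ^ 2)) with hQ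
  have hQ0 : 0 ≤ Q := by positivity
  have hQle : Q ≤ 2 * ((1 - ε) * L) := by
    have h1 : α ^ 4 = (y / p) ^ 2 := by rw [← hα2]; ring
    have h2 : y ^ 2 ≤ 2 * ((1 - ε) * L) * (p / x + y) := by
      have e : y ^ 2 = (1 - ε) ^ 2 * (2 * L * (D + p / x)) := by rw [hy, ← hD1]; ring
      rw [e, hy]
      have h3 : 0 ≤ ε * ((1 - ε) * (2 * L * (p / x))) := by positivity
      linarith
    have hmn : (m : ℝ) ≤ x := by rw [hx]; push_cast; linarith
    rw [hQ, h1, hα2, ← hx, ← mul_div_assoc, div_le_iff₀ (by positivity)]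
    calc (p : ℝ) * (m * (y / p) ^ 2) ≤ p * (x * (y / p) ^ 2) := by gcongr
      _ = x / p * y ^ 2 := by field_simp
      _ ≤ x / p * (2 * ((1 - ε) * L) * (p / x + y)) := by gcongr
      _ = _ := by field_simp
  have hQr : √Q ≤ 3 / 2 * r := by
    rw [Real.sqrt_le_left (by positivity), mul_pow, hr2]
    linarith [mul_pos hε hL0]
  have hpm : IsProbabilityMeasure ((gauss p).map fun z => α • z) :=
    Measure.isProbabilityMeasure_map (by fun_prop)
  refine one_le_maxRisk_of_overlap hn hf ((gauss p).map fun z => α • z)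
    (b := Real.exp (-(3 * √Q)) * Real.exp (-(Q / 2)))
    (fun η hη i => overlap_gauss (by omega) hp hα0 hη i hQ) (hgap.trans ?_) ?_
  · rw [← Real.exp_add, ← hx]
    gcongr
    linarith
  · rw [Measure.map_apply (by fun_prop) (measurableSet_lt measurable_norm measurable_const)]
    have hsub : (fun z : EuclideanSpace ℝ (Fin p) => α • z) ⁻¹' {θ | ‖θ‖ < Δ} ⊆
        {z | ‖z‖ ^ 2 - p ≤ -(ε * p)} := by
      intro z hz
      simp only [Set.mem_preimage, Set.mem_ofPred_eq, norm_smul] at hz ⊢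
      rw [Real.norm_of_nonneg hα0.le] at hz
      have h1 : (α * ‖z‖) ^ 2 ≤ ((1 - ε) * τ) ^ 2 :=
        pow_le_pow_left₀ (by positivity) (hz.le.trans hΔ) 2
      rw [mul_pow, hα2] at h1
      have h2 : ((1 - ε) * τ) ^ 2 = y / p * ((1 - ε) * p) := by rw [hy, hD]; field_simp
      rw [h2] at h1
      have := le_of_mul_le_mul_left h1 (by positivity)
      linarith
    have h3 := (measure_mono hsub).trans
      (gauss_normSq_le_le (p := p) (s := ε / 4) (t := ε * p) (by positivity) (by linarith))
    have h4 : Real.exp (2 * (ε / 4) ^ 2 * p - ε / 4 * (ε * p)) ≤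
        Real.exp (-(ε ^ 3 / 8 * x)) := by
      refine Real.exp_le_exp.2 ?_
      have h5 : ε * x * 1 ≤ ε * x * L := mul_le_mul_of_nonneg_left hL1 (by positivity)
      have h6 : ε ^ 2 / 8 * (ε * x) ≤ ε ^ 2 / 8 * p :=
        mul_le_mul_of_nonneg_left (by linarith) (by positivity)
      have e1 : 2 * (ε / 4) ^ 2 * p - ε / 4 * (ε * p) = -(ε ^ 2 / 8 * p) := by ring
      have e2 : ε ^ 3 / 8 * x = ε ^ 2 / 8 * (ε * x) := by ring
      rw [e1, e2]
      exact neg_le_neg h6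
    calc _ ≤ ENNReal.ofReal (2 * x) * ENNReal.ofReal (Real.exp (-(ε ^ 3 / 8 * x))) := by
          gcongr
          exact h3.trans (ENNReal.ofReal_le_ofReal h4)
      _ = ENNReal.ofReal (2 * x * Real.exp (-(ε ^ 3 / 8 * x))) :=
          (ENNReal.ofReal_mul (by positivity)).symm
      _ ≤ 1 := ENNReal.ofReal_le_one.2 hprior

/-- Below the threshold every estimator has maximal risk at least `1`, uniformly in the
dimension. -/
theorem eventually_one_le_maxRisk {ε : ℝ} (hε : 0 < ε) (hε1 : ε < 1) : ∀ᶠ n : ℕ in atTop,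
    ∀ (p : ℕ) (Δ : ℝ) (f : Sample n p → Fin n → ℝ), 1 ≤ p → IsEstimator f →
      Δ ≤ (1 - ε) * threshold n p 1 → 1 ≤ maxRisk 1 Δ f := by
  have hLtop : Tendsto (fun n : ℕ => Real.log n) atTop atTop :=
    Real.tendsto_log_atTop.comp tendsto_natCast_atTop_atTop
  have hrtop : Tendsto (fun n : ℕ => √(Real.log n)) atTop atTop :=
    Real.tendsto_sqrt_atTop.comp hLtop
  have hexp : Tendsto (fun n : ℕ => 2 * n * Real.exp (-(ε ^ 3 / 8 * n))) atTop (𝓝 0) := by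
    have h1 := (Real.tendsto_pow_mul_exp_neg_atTop_nhds_zero 1).comp
      ((tendsto_natCast_atTop_atTop (R := ℝ)).const_mul_atTop (by positivity : 0 < ε ^ 3 / 8))
    have h2 := h1.const_mul (2 / (ε ^ 3 / 8))
    rw [mul_zero] at h2
    refine h2.congr fun n => ?_
    simp only [Function.comp, pow_one]
    field_simp
  filter_upwards [eventually_ge_atTop 2, hLtop.eventually_ge_atTop 1,
    hrtop.eventually_ge_atTop (13 / ε), hexp.eventually_le_const zero_lt_one]
    with n hn2 hL1 hsq hexpn
  intro p Δ f hp hf hΔ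
  have hn0 : (0 : ℝ) < n := by exact_mod_cast (by omega : 0 < n)
  have hgap : 8 ≤ n * Real.exp (-((1 - ε) * Real.log n + 5 * √(Real.log n))) := by
    set L := Real.log n
    set r := √L
    have hr2 : r ^ 2 = L := Real.sq_sqrt (by linarith)
    have hr1 : 1 ≤ r := Real.one_le_sqrt.2 hL1
    have e : n * Real.exp (-((1 - ε) * L + 5 * r)) = Real.exp (ε * L - 5 * r) := by
      have : (n : ℝ) = Real.exp L := (Real.exp_log hn0).symm
      rw [this, ← Real.exp_add]; congr 1; ring
    rw [e]
    -- `ε r ≥ 13` gives `ε L - 5 r ≥ 8 r ≥ 8`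
    have h1 : 13 ≤ ε * r := by rw [div_le_iff₀ hε] at hsq; linarith
    have h2 := Real.add_one_le_exp (ε * L - 5 * r)
    rw [← hr2] at h2 ⊢
    nlinarith
  by_cases hcase : (p : ℝ) ≤ ε * n * Real.log n
  · exact one_le_maxRisk_of_low_dim hn2 hp hε hε1 hf hΔ hgap hcase
  · exact one_le_maxRisk_of_high_dim hn2 hp hε hε1 hf hΔ hL1 hgap hexpn (not_le.1 hcase)

theorem exactRecoveryImpossible_of_le (p : ℕ → ℕ) (σ Δ : ℕ → ℝ) (hp : ∀ n, 2 ≤ n → 1 ≤ p n)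
    (hσ : ∀ n, 2 ≤ n → 0 < σ n) {ε : ℝ} (hε : 0 < ε) (hε1 : ε < 1)
    (h : ∀ n, 2 ≤ n → Δ n ≤ (1 - ε) * threshold n (p n) (σ n)) :
    ExactRecoveryImpossible p σ Δ := by
  refine lt_of_lt_of_le (zero_lt_one (α := ENNReal)) (le_liminf_of_le (by isBoundedDefault) ?_)
  filter_upwards [eventually_one_le_maxRisk hε hε1, eventually_ge_atTop 2] with n hn hn2
  have hs := hσ n hn2
  refine le_iInf₂ fun f hf => ?_
  rw [maxRisk_scale hs _ hf.1]
  refine hn (p n) _ _ (hp n hn2) ⟨hf.1.comp (by fun_prop), fun Y => hf.2 _⟩ ?_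
  rw [div_le_iff₀ hs, mul_assoc, mul_comm _ (σ n), ← threshold_eq_mul hs]
  exact h n hn2

end TwoGaussianMixture

end

theorem theorem5p3 (p : ℕ → ℕ) (σ Δ : ℕ → ℝ)
    (hp : ∀ n, 2 ≤ n → 1 ≤ p n) (hσ : ∀ n, 2 ≤ n → 0 < σ n) (hΔ : ∀ n, 2 ≤ n → 0 < Δ n)
    (ε : ℝ) (hε : 0 < ε) :
    ((∀ n, 2 ≤ n → (1 + ε) * TwoGaussianMixture.threshold n (p n) (σ n) ≤ Δ n) →
      ∀ η₀ : ∀ n, TwoGaussianMixture.Sample n (p n) → Fin n → ℝ,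
        (∀ n, 2 ≤ n → TwoGaussianMixture.IsSpectralEstimator (η₀ n)) →
        TwoGaussianMixture.AchievesExactRecovery p σ Δ
          (fun n => TwoGaussianMixture.lloyd (η₀ n) ⌊3 * Real.log n⌋₊)) ∧
    ((∀ n, 2 ≤ n → Δ n ≤ (1 - ε) * TwoGaussianMixture.threshold n (p n) (σ n)) →
      TwoGaussianMixture.ExactRecoveryImpossible p σ Δ) := by
  refine ⟨fun h η₀ hη₀ => TwoGaussianMixture.achievesExactRecovery_lloyd p σ Δ hσ hε h η₀ hη₀,
    fun h => ?_⟩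
  -- `Δ 2 > 0` forces `ε < 1`
  have hε1 : ε < 1 := by
    by_contra! hcon
    have h2 := h 2 le_rfl
    have h3 := TwoGaussianMixture.threshold_nonneg 2 (p 2) (σ 2)
    nlinarith [hΔ 2 le_rfl]
  exact TwoGaussianMixture.exactRecoveryImpossible_of_le p σ Δ hp hσ hε hε1 h
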